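/- A *machine* is a partial computable function $U(p,x)$ of two binary strings with binary strings as values. It is *prefix-free* if, for each $x$, the set of $p$ on which $U(p,x)$ is defined contains no two distinct strings one of which is a prefix of the other; it is *prefix-stable* if whenever $U(p,x)$ is defined, $U(q,x)$ is defined and equal to $U(p,x)$ for every extension $q$ of $p$. Given a class of functions of two strings with values in $\mathbb{N}\cup\{\infty\}$, call $f$ *minimal* in the class if $f$ belongs to it and for every $g$ in the class there is a constant $c$ such that $f(x,y)\le g(x,y)+c$ for all $x,y$. The conditional prefix complexity $\mathrm{K}(y\mid x)$ is a minimal function among the functions $\mathrm{K}_U(y\mid x)=\min\{|p| : U(p,x)=y\}$ with $U$ prefix-free. The prefix-free [prefix-stable] information distance is a minimal function among the functions $\mathrm{D}_U(x,y)=\min\{|p| : U(p,x)=y \text{ and } U(p,y)=x\}$ with $U$ prefix-free [prefix-stable]. The bipartite prefix-free [prefix-stable] information distance is a minimal function among the functions $\mathrm{D}_{U,U'}(x,y)=\min\{|p| : U(p,x)=y \text{ and } U'(p,y)=x\}$ with both $U$ and $U'$ prefix-free [prefix-stable]. Fix any versions of these five functions, and let $\mathrm{E}(x,y)=\max(\mathrm{K}(x\mid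 y),\mathrm{K}(y\mid x))$. **Theorem.** There is a constant $c$ such that for all $n$ and all binary strings $x$ and $y$, both of length exactly $n$, with $\mathrm{E}(x,y)\ge 1.01\log_2 n$ (where $\log_2 0$ is read as $0$), each of the four information distances (prefix-free or prefix-stable, bipartite or not) differs from $\mathrm{E}(x,y)$ by at most $c$. -/

import Mathlib

/-- Binary strings. -/
abbrev BitString : Type := List Bool

/-- Partial functions of two string arguments (a program and an input) with string values. -/
abbrev Machine : Type := BitString → BitString →. BitString

/-- `U` is a prefix-free machine: it is partial computable, and for each input `x` no program on
which `U` is defined is a proper prefix of another one. -/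
structure IsPrefixFree (U : Machine) : Prop where
  partrec : Partrec₂ U
  prefix_free : ∀ x p q : BitString, p <+: q → (U p x).Dom → (U q x).Dom → p = q

/-- `U` is a prefix-stable machine: it is partial computable, and if `U p x` is defined, then
`U q x` is defined and has the same value for all extensions `q` of `p`. -/
structure IsPrefixStable (U : Machine) : Prop where
  partrec : Partrec₂ U
  prefix_stable : ∀ x y p q : BitString, p <+: q → y ∈ U p x → y ∈ U q x

/-- `condComplexity U y x` is the minimal length of a program that maps `x` to `y` on the
machine `U` (and `⊤` if there is none). -/
noncomputable def condComplexity (U : Machine) (y x : BitString) : ℕ∞ :=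
  ⨅ p : BitString, ⨅ _ : y ∈ U p x, (p.length : ℕ∞)

/-- The minimal length of a program that maps `x` to `y` on `U` and maps `y` to `x` on `U'`
(and `⊤` if there is none). -/
noncomputable def bipartiteDist (U U' : Machine) (x y : BitString) : ℕ∞ :=
  ⨅ p : BitString, ⨅ _ : y ∈ U p x ∧ x ∈ U' p y, (p.length : ℕ∞)

/-- The minimal length of a program that on `U` both maps `x` to `y` and `y` to `x`
(and `⊤` if there is none). -/
noncomputable def dist₁ (U : Machine) (x y : BitString) : ℕ∞ :=
  ⨅ p : BitString, ⨅ _ : y ∈ U p x ∧ x ∈ U p y, (p.length : ℕ∞)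

/-- `f` belongs to the class `C`, and is minimal in it up to an additive constant (that may
depend on the function with which `f` is compared, but not on the strings). -/
def IsMinimalUpToConst (C : Set (BitString → BitString → ℕ∞)) (f : BitString → BitString → ℕ∞) :
    Prop :=
  f ∈ C ∧ ∀ g ∈ C, ∃ c : ℕ, ∀ x y : BitString, f x y ≤ g x y + c

/-- `K y x` is (a version of) the prefix complexity of `y` given `x`. -/
def IsPrefixComplexity (K : BitString → BitString → ℕ∞) : Prop :=
  IsMinimalUpToConst {f | ∃ U, IsPrefixFree U ∧ f = condComplexity U} K

/-- `D` is (a version of) the non-bipartite prefix-free information distance. -/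
def IsPrefixFreeDistance (D : BitString → BitString → ℕ∞) : Prop :=
  IsMinimalUpToConst {f | ∃ U, IsPrefixFree U ∧ f = dist₁ U} D

/-- `D` is (a version of) the non-bipartite prefix-stable information distance. -/
def IsPrefixStableDistance (D : BitString → BitString → ℕ∞) : Prop :=
  IsMinimalUpToConst {f | ∃ U, IsPrefixStable U ∧ f = dist₁ U} D

/-- `D` is (a version of) the bipartite prefix-free information distance. -/
def IsBipartitePrefixFreeDistance (D : BitString → BitString → ℕ∞) : Prop :=
  IsMinimalUpToConst
    {f | ∃ U U', IsPrefixFree U ∧ IsPrefixFree U' ∧ f = bipartiteDist U U'} D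

/-- `D` is (a version of) the bipartite prefix-stable information distance. -/
def IsBipartitePrefixStableDistance (D : BitString → BitString → ℕ∞) : Prop :=
  IsMinimalUpToConst
    {f | ∃ U U', IsPrefixStable U ∧ IsPrefixStable U' ∧ f = bipartiteDist U U'} D

/-- The maximum of the two conditional complexities. -/
noncomputable def maxComplexity (K : BitString → BitString → ℕ∞) (x y : BitString) : ℕ∞ :=
  max (K x y) (K y x)

/-- `a` and `b` differ by at most `c`. -/
def EqUpTo (c : ℕ) (a b : ℕ∞) : Prop := a ≤ b + c ∧ b ≤ a + c

/-! The lower bounds are soft. A program for any of the distances solves both conditional tasks, and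
a prefix-stable machine can be replaced by a prefix-free one at the cost of two bits
(`exists_isPrefixFree_of_coherent`, a Kraft–Chaitin allocation). Hence E is bounded by the smallest
distance, the bipartite prefix-stable one, and only the largest, the non-bipartite prefix-free one,
has to be bounded by E.

Enumerate the pairs of strings of length n whose two conditional complexities are at most k. Each is
an edge that must be given online a word of length k + 42, so that words on edges with a common
endpoint are incomparable. By Kraft the weights 2^(-k) at a vertex sum to at most 2
(`Coherent.sum_le`), so this is online edge colouring with constant slack (`Winnable`). A winning
strategy only has to exist: a finite certificate of it can be searched for
(`Winnable.exists_certificate`), and `exists_exchange_machine` plays it.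

The strategy splits a word into a block and a slot. Blocks form a table with 2^a rows and columns in
(ZMod 2)^H. The type of a request is its level together with a stage, which measures dyadically how
many requests of that level the busier ("heavy") endpoint has. A type of stage h has in each row a
coset of the subgroup `colsBelow H h`, the same for all vertices. The heavy endpoint may use all of
it; the light endpoint uses a smaller coset around its own base point, which grows with its number
of requests. Random base points ensure that the blocks filled by one heavy vertex clog the regions
of few light vertices (`exists_spread_points`); random shifts ensure that blocks used for other
types are sparse in every region (`exists_shifts`). So a suitable block exists
(`Layout.exists_block`), no block is overloaded, and a slot is free (`Layout.Inv.exists_slot`).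

Union bounds over 2^n vertices make a about log n. The slots of a block must outnumber the clogged
vertices, which needs k ≥ a + 2H - O(1), while 2^H must exceed the number of levels times H. Between
129/128 log n and 4 log n there are O(log n) levels, so H can be a small fraction of log n; this
gives the threshold. From 4 log n on, H slightly above log n is affordable. The two ranges are
served by two machines. -/

open Finset

/-! ### Random base points and shifts -/

/-- An exponential moment bound for the number of assignments that hit the sets `F j` often. -/
theorem card_bad_mul_le {ι Ω G : Type*} [Fintype ι] [DecidableEq ι] [Fintype Ω] [Nonempty Ω]
    [AddCommGroup G] [DecidableEq G] (e : Ω → G) (he : Function.Injective e)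
    (B F : ι → Finset G) (w : ℕ) (hw : 0 < w) (hB : ∀ j, #(B j) = w)
    (hF : 2 ^ 17 * ∑ j, #(F j) ≤ Fintype.card Ω * Fintype.card ι) :
    #{ρ : ι → Ω | w * Fintype.card ι ≤ 8 * ∑ j, #{b ∈ B j | e (ρ j) + b ∈ F j}}
      * 2 ^ Fintype.card ι ≤ Fintype.card Ω ^ Fintype.card ι := by
  classical
  set t := Fintype.card ι with ht
  set N := Fintype.card Ω with hN
  have hN0 : 0 < N := Fintype.card_pos
  -- The fraction of the translated window that lies in `F j`. The event says that these fractions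
  -- sum to at least t/8, so with base 2^16 it contributes (2^16)^(t/8) = 2^(2t), while sparseness
  -- keeps the mean moment below exp(t/2) ≤ 2^t.
  let φ : ι → Ω → ℝ := fun j ω => (#{b ∈ B j | e ω + b ∈ F j} : ℝ) / w
  have hw' : (0 : ℝ) < w := by exact_mod_cast hw
  have hφ0 : ∀ j ω, 0 ≤ φ j ω := fun j ω => by positivity
  have hφ1 : ∀ j ω, φ j ω ≤ 1 := fun j ω => by
    rw [div_le_one hw']
    exact_mod_cast (card_filter_le _ _).trans (hB j).le
  have hφs : ∀ j, ∑ ω, φ j ω ≤ #(F j) := fun j => by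
    simp only [φ]
    rw [← sum_div, div_le_iff₀ hw', ← Nat.cast_sum]
    norm_cast
    simp only [card_filter]
    rw [sum_comm]
    calc ∑ b ∈ B j, ∑ ω, (if e ω + b ∈ F j then 1 else 0) ≤ ∑ b ∈ B j, #(F j) := by
          refine sum_le_sum fun b _ => ?_
          rw [← card_filter]
          refine card_le_card_of_injOn (fun ω => e ω + b) (fun ω hω => by simpa using hω) ?_
          intro ω _ ω' _ h
          exact he (add_right_cancel h)
      _ = #(F j) * w := by rw [sum_const, hB, smul_eq_mul, mul_comm]
  have hrow : ∀ j, ∑ ω, (2 ^ 16 : ℝ) ^ φ j ω ≤ N * Real.exp (2 ^ 16 * #(F j) / N) := fun j => by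
    have hN' : (0 : ℝ) < N := by exact_mod_cast hN0
    calc ∑ ω, (2 ^ 16 : ℝ) ^ φ j ω ≤ ∑ ω, (1 + φ j ω * 2 ^ 16) := by
          refine sum_le_sum fun ω _ => ?_
          have := rpow_one_add_le_one_add_mul_self (s := 2 ^ 16 - 1) (p := φ j ω)
            (by norm_num) (hφ0 j ω) (hφ1 j ω)
          rw [add_sub_cancel] at this
          refine this.trans ?_
          have := hφ0 j ω
          nlinarith
      _ = N + (∑ ω, φ j ω) * 2 ^ 16 := by
          rw [sum_add_distrib, ← sum_mul]; simp [hN]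
      _ ≤ N + #(F j) * 2 ^ 16 := by have := hφs j; nlinarith
      _ = N * (2 ^ 16 * #(F j) / N + 1) := by field_simp; ring
      _ ≤ _ := by gcongr; exact Real.add_one_le_exp _
  have htot : ∑ ρ : ι → Ω, (2 ^ 16 : ℝ) ^ (∑ j, φ j (ρ j)) ≤ N ^ t * 2 ^ t := by
    have h1 : ∀ ρ : ι → Ω, (2 ^ 16 : ℝ) ^ (∑ j, φ j (ρ j)) = ∏ j, (2 ^ 16 : ℝ) ^ φ j (ρ j) :=
      fun ρ => Real.rpow_sum_of_pos (by norm_num) _ _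
    simp only [h1]
    rw [← Fintype.piFinset_univ, ← prod_univ_sum (fun _ => univ) (fun j ω => (2 ^ 16 : ℝ) ^ φ j ω)]
    have hN' : (0 : ℝ) < N := by exact_mod_cast hN0
    calc ∏ j, ∑ ω, (2 ^ 16 : ℝ) ^ φ j ω ≤ ∏ j, (N * Real.exp (2 ^ 16 * #(F j) / N)) :=
          prod_le_prod (fun j _ => sum_nonneg fun ω _ => by positivity) fun j _ => hrow j
      _ = N ^ t * Real.exp (∑ j, 2 ^ 16 * #(F j) / N) := by
          rw [prod_mul_distrib, ← Real.exp_sum]; simp [ht]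
      _ ≤ N ^ t * 2 ^ t := by
          gcongr
          have h2 : ∑ j, 2 ^ 16 * (#(F j) : ℝ) / N ≤ (t : ℝ) * (1 / 2) := by
            rw [← sum_div, ← mul_sum, div_le_iff₀ hN']
            have : ((2 ^ 17 * ∑ j, #(F j) : ℕ) : ℝ) ≤ ((N * t : ℕ) : ℝ) := by exact_mod_cast hF
            push_cast at this
            nlinarith
          calc Real.exp (∑ j, 2 ^ 16 * (#(F j) : ℝ) / N) ≤ Real.exp (t * (1 / 2)) :=
                Real.exp_le_exp.2 h2
            _ = Real.exp (1 / 2) ^ t := by rw [← Real.exp_nat_mul]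
            _ ≤ 2 ^ t := by
                gcongr
                have h3 : Real.exp (1 / 2) ^ 2 ≤ 2 ^ 2 := by
                  rw [← Real.exp_nat_mul]
                  norm_num
                  have := Real.exp_one_lt_d9
                  linarith
                exact le_of_sq_le_sq h3 (by norm_num)
  have hlow : (#{ρ : ι → Ω | w * t ≤ 8 * ∑ j, #{b ∈ B j | e (ρ j) + b ∈ F j}} : ℝ) * 2 ^ (2 * t)
      ≤ ∑ ρ : ι → Ω, (2 ^ 16 : ℝ) ^ (∑ j, φ j (ρ j)) := by
    rw [← nsmul_eq_mul, ← sum_const]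
    refine (sum_le_sum fun ρ hρ => ?_).trans
      (sum_le_sum_of_subset_of_nonneg (subset_univ _) fun ρ _ _ => by positivity)
    simp only [mem_filter, mem_univ, true_and] at hρ
    have h4 : (t : ℝ) / 8 ≤ ∑ j, φ j (ρ j) := by
      simp only [φ]
      rw [← sum_div, le_div_iff₀ hw']
      have : ((w * t : ℕ) : ℝ) ≤ ((8 * ∑ j, #{b ∈ B j | e (ρ j) + b ∈ F j} : ℕ) : ℝ) := by
        exact_mod_cast hρ
      push_cast at this
      linarith
    calc (2 : ℝ) ^ (2 * t) = (2 ^ 16 : ℝ) ^ ((t : ℝ) / 8) := by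
          rw [← Real.rpow_natCast 2 16, ← Real.rpow_mul (by norm_num), ← Real.rpow_natCast]
          congr 1; push_cast; ring
      _ ≤ _ := Real.rpow_le_rpow_of_exponent_le (by norm_num) h4
  have hfin := hlow.trans htot
  rw [two_mul, pow_add, ← mul_assoc] at hfin
  have := le_of_mul_le_mul_right hfin (by positivity)
  exact_mod_cast this

/-- Resampling one coordinate of a uniform point leaves it uniform; this allows conditioning on the
other coordinates. -/
theorem card_update_mul {I Ω : Type*} [Fintype I] [DecidableEq I] [Fintype Ω] (i : I)
    (bad : (I → Ω) → Prop) [DecidablePred bad] :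
    #{r | bad r} * Fintype.card Ω = ∑ r : I → Ω, #{ρ | bad (Function.update r i ρ)} := by
  classical
  simp only [card_filter]
  rw [sum_mul, ← Fintype.sum_prod_type'
    (f := fun r ρ => if bad (Function.update r i ρ) then 1 else 0)]
  have : ∀ r : I → Ω, (if bad r then 1 else 0) * Fintype.card Ω
      = ∑ ρ : Ω, (if bad r then 1 else 0) := fun r => by simp [mul_comm]
  simp only [this]
  rw [← Fintype.sum_prod_type' (f := fun r (_ : Ω) => if bad r then 1 else 0)]
  refine sum_bij' (fun p _ => (Function.update p.1 i p.2, p.1 i))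
    (fun p _ => (Function.update p.1 i p.2, p.1 i)) ?_ ?_ ?_ ?_ ?_ <;> simp

/-- Union bound over `F` for a random `f`. For fixed sparse `F` a vertex is bad with probability at
most (h+1)·2^(-2t'). Vertices are independent, so 4·2^h bad ones occur with probability at most
4·2^(-4t'·2^h), which beats the 2^(2t'·2^h) families `F`. -/
theorem exists_spread_points {V ι Ω G : Type*} [Fintype V] [Fintype ι] [DecidableEq ι]
    [Fintype Ω] [Nonempty Ω] [DecidableEq Ω] [AddCommGroup G] [DecidableEq G]
    (e : Ω → G) (he : Function.Injective e) (W : ℕ → Finset G) (n t' h : ℕ)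
    (hW : ∀ h' ≤ h, #(W h') = 2 ^ h') (hΩ : Fintype.card Ω = 2 ^ h)
    (hV : Fintype.card V ≤ 2 ^ n) (ht : Fintype.card ι = 2 * t') (ht2 : 2 ≤ t')
    (hn : 2 ^ n * (h + 1) ≤ 2 ^ t') :
    ∃ f : V → ι → Ω, ∀ F : ι → Finset Ω, 2 ^ 17 * ∑ j, #(F j) ≤ 2 ^ h * Fintype.card ι →
      #{y | ∃ h' ≤ h, 2 ^ h' * Fintype.card ι ≤
        8 * ∑ j, #{b ∈ W h' | e (f y j) + b ∈ (F j).image e}} < 4 * 2 ^ h := by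
  classical
  let bad : (ι → Finset Ω) → (ι → Ω) → Prop := fun F ρ =>
    ∃ h' ≤ h, 2 ^ h' * Fintype.card ι ≤ 8 * ∑ j, #{b ∈ W h' | e (ρ j) + b ∈ (F j).image e}
  change ∃ f : V → ι → Ω, ∀ F : ι → Finset Ω, _ → #{y | bad F (f y)} < 4 * 2 ^ h
  by_contra! hcon
  set T := Fintype.card (ι → Ω) with hT
  have hT0 : 0 < T := Fintype.card_pos
  have hTt : T = Fintype.card Ω ^ Fintype.card ι := by simp [hT]
  have hbad : ∀ F : ι → Finset Ω, 2 ^ 17 * ∑ j, #(F j) ≤ 2 ^ h * Fintype.card ι →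
      #{ρ | bad F ρ} * 2 ^ (2 * t') ≤ (h + 1) * T := by
    intro F hF
    have hsub : ({ρ | bad F ρ} : Finset (ι → Ω)) ⊆ (range (h + 1)).biUnion fun h' =>
        {ρ | 2 ^ h' * Fintype.card ι ≤
          8 * ∑ j, #{b ∈ W h' | e (ρ j) + b ∈ (F j).image e}} := by
      intro ρ hρ
      simp only [mem_filter, mem_univ, true_and, bad] at hρ
      obtain ⟨h', hh', h2⟩ := hρ
      simp only [mem_biUnion, mem_range, mem_filter, mem_univ, true_and]
      exact ⟨h', by omega, h2⟩
    calc #{ρ | bad F ρ} * 2 ^ (2 * t') ≤ (∑ h' ∈ range (h + 1), #{ρ : ι → Ω |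
          2 ^ h' * Fintype.card ι ≤ 8 * ∑ j, #{b ∈ W h' | e (ρ j) + b ∈ (F j).image e}})
            * 2 ^ (2 * t') := Nat.mul_le_mul_right _ ((card_le_card hsub).trans card_biUnion_le)
      _ ≤ ∑ h' ∈ range (h + 1), T := by
          rw [sum_mul]
          refine sum_le_sum fun h' hh' => ?_
          rw [← ht, hTt]
          refine card_bad_mul_le e he (fun _ => W h') (fun j => (F j).image e) (2 ^ h')
            (by positivity) (fun _ => hW h' (by simpa [Nat.lt_succ_iff] using hh')) ?_
          rw [hΩ]
          refine le_trans (Nat.mul_le_mul_left _ (sum_le_sum fun j _ => card_image_le)) hF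
      _ = _ := by simp
  -- Each bad vertex gets weight 2^t', half of the available exponent. The other half pays for the
  -- h+1 window sizes and the 2^n vertices: the mean product is at most (1 + 2^(-n))^(2^n) < 4.
  have hF : ∀ F : ι → Finset Ω, 2 ^ 17 * ∑ j, #(F j) ≤ 2 ^ h * Fintype.card ι →
      (#{f : V → ι → Ω | 4 * 2 ^ h ≤ #{y | bad F (f y)}} : ℝ) * (2 ^ t') ^ (4 * 2 ^ h)
        ≤ T ^ Fintype.card V * 4 := by
    intro F hF
    calc (#{f : V → ι → Ω | 4 * 2 ^ h ≤ #{y | bad F (f y)}} : ℝ) * (2 ^ t') ^ (4 * 2 ^ h)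
        ≤ ∑ f : V → ι → Ω, ∏ y, (if bad F (f y) then (2 : ℝ) ^ t' else 1) := by
          rw [← nsmul_eq_mul, ← sum_const]
          refine (sum_le_sum fun f hf => ?_).trans
            (sum_le_sum_of_subset_of_nonneg (subset_univ _) fun f _ _ =>
              prod_nonneg fun y _ => by split_ifs <;> positivity)
          rw [← prod_filter, prod_const]
          exact pow_le_pow_right₀ (one_le_pow₀ (by norm_num)) (by simpa using hf)
      _ = (∑ ρ : ι → Ω, (if bad F ρ then (2 : ℝ) ^ t' else 1)) ^ Fintype.card V := by
          rw [← Fintype.piFinset_univ, ← prod_univ_sum (fun _ => univ)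
            (fun (_ : V) ρ => if bad F ρ then (2 : ℝ) ^ t' else 1), prod_const, card_univ]
      _ ≤ (T * (1 / 2 ^ n + 1)) ^ Fintype.card V := by
          refine pow_le_pow_left₀ (sum_nonneg fun ρ _ => by split_ifs <;> positivity) ?_ _
          calc ∑ ρ : ι → Ω, (if bad F ρ then (2 : ℝ) ^ t' else 1)
              ≤ ∑ ρ : ι → Ω, ((if bad F ρ then (2 : ℝ) ^ t' else 0) + 1) := by
                refine sum_le_sum fun ρ _ => ?_
                split_ifs <;> simp
            _ = #{ρ | bad F ρ} * 2 ^ t' + T := by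
                rw [sum_add_distrib, ← sum_filter]; simp [hT]
            _ ≤ T * (1 / 2 ^ n + 1) := by
                have h1 : (#{ρ | bad F ρ} : ℝ) * 2 ^ (2 * t') ≤ (h + 1) * T := by
                  exact_mod_cast hbad F hF
                have h2 : (2 : ℝ) ^ n * (h + 1) ≤ 2 ^ t' := by exact_mod_cast hn
                rw [mul_add, mul_one, mul_one_div]
                gcongr
                rw [le_div_iff₀ (by positivity)]
                refine le_of_mul_le_mul_right (a := (2 : ℝ) ^ t') ?_ (by positivity)
                calc (#{ρ | bad F ρ} : ℝ) * 2 ^ t' * 2 ^ n * 2 ^ t'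
                    = #{ρ | bad F ρ} * 2 ^ (2 * t') * 2 ^ n := by rw [two_mul, pow_add]; ring
                  _ ≤ (h + 1) * T * 2 ^ n := by gcongr
                  _ = T * (2 ^ n * (h + 1)) := by ring
                  _ ≤ _ := by gcongr
      _ = T ^ Fintype.card V * (1 / 2 ^ n + 1) ^ Fintype.card V := by rw [mul_pow]
      _ ≤ T ^ Fintype.card V * 4 := by
          gcongr
          calc ((1 : ℝ) / 2 ^ n + 1) ^ Fintype.card V ≤ (1 / 2 ^ n + 1) ^ (2 ^ n) :=
                pow_le_pow_right₀ (by simp) hV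
            _ ≤ Real.exp (1 / 2 ^ n) ^ (2 ^ n) := by
                gcongr; exact Real.add_one_le_exp _
            _ = Real.exp 1 := by
                rw [← Real.exp_nat_mul]; congr 1; push_cast; field_simp
            _ ≤ 4 := by have := Real.exp_one_lt_d9; linarith
  have hcover : (univ : Finset (V → ι → Ω)) ⊆
      ({F | 2 ^ 17 * ∑ j, #(F j) ≤ 2 ^ h * Fintype.card ι} : Finset (ι → Finset Ω)).biUnion
        fun F => {f | 4 * 2 ^ h ≤ #{y | bad F (f y)}} := by
    intro f _
    obtain ⟨F, hF1, hF2⟩ := hcon f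
    simp only [mem_biUnion, mem_filter, mem_univ, true_and]
    exact ⟨F, hF1, hF2⟩
  have hcount : (T : ℝ) ^ Fintype.card V * (2 ^ t') ^ (4 * 2 ^ h) ≤
      (2 ^ 2 ^ h) ^ (2 * t') * (T ^ Fintype.card V * 4) := by
    have h1 : (T : ℝ) ^ Fintype.card V ≤ ∑ F ∈ ({F | 2 ^ 17 * ∑ j, #(F j) ≤
        2 ^ h * Fintype.card ι} : Finset (ι → Finset Ω)),
          (#{f : V → ι → Ω | 4 * 2 ^ h ≤ #{y | bad F (f y)}} : ℝ) := by
      have := (card_le_card hcover).trans card_biUnion_le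
      rw [card_univ, Fintype.card_fun, ← hT] at this
      exact_mod_cast this
    calc (T : ℝ) ^ Fintype.card V * (2 ^ t') ^ (4 * 2 ^ h)
        ≤ (∑ F ∈ ({F | 2 ^ 17 * ∑ j, #(F j) ≤ 2 ^ h * Fintype.card ι} : Finset (ι → Finset Ω)),
          (#{f : V → ι → Ω | 4 * 2 ^ h ≤ #{y | bad F (f y)}} : ℝ)) * (2 ^ t') ^ (4 * 2 ^ h) := by
          gcongr
      _ ≤ ∑ F ∈ ({F | 2 ^ 17 * ∑ j, #(F j) ≤ 2 ^ h * Fintype.card ι} : Finset (ι → Finset Ω)),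
          ((T : ℝ) ^ Fintype.card V * 4) := by
          rw [sum_mul]
          exact sum_le_sum fun F hF' => hF F (by simpa using hF')
      _ ≤ _ := by
          rw [sum_const, nsmul_eq_mul]
          gcongr
          have := (card_filter_le (univ : Finset (ι → Finset Ω))
            (fun F => 2 ^ 17 * ∑ j, #(F j) ≤ 2 ^ h * Fintype.card ι)).trans_eq
              (show _ = (2 ^ 2 ^ h) ^ (2 * t') by
                rw [card_univ, Fintype.card_fun, Fintype.card_finset, hΩ, ht])
          exact_mod_cast this
  have hTpos : (0 : ℝ) < T ^ Fintype.card V := by positivity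
  rw [mul_comm ((2 ^ 2 ^ h) ^ (2 * t') : ℝ), mul_assoc] at hcount
  have h5 := le_of_mul_le_mul_left hcount hTpos
  have h6 : (2 : ℕ) ^ (t' * (4 * 2 ^ h)) ≤ 2 ^ (2 + 2 ^ h * (2 * t')) := by
    have h7 : ((2 : ℕ) ^ t') ^ (4 * 2 ^ h) ≤ 4 * (2 ^ 2 ^ h) ^ (2 * t') := by exact_mod_cast h5
    rw [pow_mul, pow_add, pow_mul 2 (2 ^ h)]
    simpa using h7
  have h7 := (Nat.pow_le_pow_iff_right (by norm_num)).1 h6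
  have h8 : 1 ≤ 2 ^ h := Nat.one_le_two_pow
  nlinarith

/-- The shifted dyadic region. -/
def shiftedRegion {I V ι G : Type*} [AddCommGroup G] [DecidableEq G] (W : ℕ → Finset G)
    (f : I → V → ι → G) (r : I → ι → G) (x : V) (i : I) (h : ℕ) (j : ι) : Finset G :=
  (W h).image fun b => r i j + (f i x j + b)

/-- The blocks that a vertex with the given profile uses for other types. -/
def foreignRegion {I V ι G : Type*} [Fintype I] [DecidableEq I] [AddCommGroup G] [DecidableEq G]
    (W : ℕ → Finset G) (f : I → V → ι → G) (r : I → ι → G) (x : V) {H : ℕ}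
    (a : I → Option (Fin (H + 1))) (i : I) (j : ι) : Finset G :=
  (univ.erase i).biUnion fun i' =>
    ((a i').elim ∅ fun h => shiftedRegion W f r x i' h j)

/-- The foreign region of type `i` does not involve the shifts of `i` itself. With all other shifts
fixed, the moment bound makes each event fail with probability at most 2^(-|ι|); `hcard` is the
union bound over two vertices, a profile, a type and a window size. -/
theorem exists_shifts {I V ι G : Type*} [Fintype I] [DecidableEq I] [Fintype V] [Fintype ι]
    [DecidableEq ι] [AddCommGroup G] [DecidableEq G] [Fintype G] (W : ℕ → Finset G) (H : ℕ)
    (f : I → V → ι → G) (hW : ∀ h' ≤ H, #(W h') = 2 ^ h') (hG : Fintype.card G = 2 ^ H)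
    (hcard : Fintype.card V * Fintype.card V * (H + 2) ^ Fintype.card I * Fintype.card I * (H + 1)
      < 2 ^ Fintype.card ι) :
    ∃ r : I → ι → G, ∀ (x : V) (a : I → Option (Fin (H + 1))),
      2 ^ 17 * ∑ i, ((a i).elim 0 fun h => 2 ^ (h : ℕ)) ≤ 2 ^ H →
      ∀ (i : I) (y : V) (h : Fin (H + 1)),
        8 * ∑ j, #{b ∈ W h | r i j + (f i y j + b) ∈ foreignRegion W f r x a i j} <
          2 ^ (h : ℕ) * Fintype.card ι := by
  classical
  by_contra! hcon
  let E := V × (I → Option (Fin (H + 1))) × I × V × Fin (H + 1)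
  let bad : E → (I → ι → G) → Prop := fun E r =>
    2 ^ 17 * ∑ i, ((E.2.1 i).elim 0 fun h => 2 ^ (h : ℕ)) ≤ 2 ^ H ∧
      2 ^ (E.2.2.2.2 : ℕ) * Fintype.card ι ≤
        8 * ∑ j, #{b ∈ W E.2.2.2.2 | r E.2.2.1 j + (f E.2.2.1 E.2.2.2.1 j + b) ∈
          foreignRegion W f r E.1 E.2.1 E.2.2.1 j}
  have hbad : ∀ ε : E, #{r | bad ε r} * 2 ^ Fintype.card ι ≤ Fintype.card (I → ι → G) := by
    rintro ⟨x, a, i, y, h⟩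
    have hpos : 0 < Fintype.card (ι → G) := Fintype.card_pos
    refine Nat.le_of_mul_le_mul_right ?_ hpos
    rw [mul_right_comm, card_update_mul i, sum_mul]
    have : Fintype.card (I → ι → G) * Fintype.card (ι → G)
        = ∑ r : I → ι → G, Fintype.card (ι → G) := by simp
    rw [this]
    refine sum_le_sum fun r _ => ?_
    by_cases hwt : 2 ^ 17 * ∑ i, ((a i).elim 0 fun h => 2 ^ (h : ℕ)) ≤ 2 ^ H
    swap
    · have : ({ρ | bad (x, a, i, y, h) (Function.update r i ρ)} : Finset (ι → G)) = ∅ := by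
        rw [filter_eq_empty_iff]
        intro ρ _ hb
        exact hwt hb.1
      rw [this]; simp
    have hfor : ∀ ρ j, foreignRegion W f (Function.update r i ρ) x a i j
        = foreignRegion W f r x a i j := by
      intro ρ j
      unfold foreignRegion
      refine biUnion_congr rfl fun i' hi' => ?_
      rcases a i' with _ | h'
      · rfl
      · simp [shiftedRegion, Function.update_of_ne (ne_of_mem_erase hi')]
    refine le_trans (Nat.mul_le_mul_right _ (card_le_card ?_))
      ((card_bad_mul_le (Ω := G) id Function.injective_id
        (fun j => (W h).image fun b => f i y j + b) (fun j => foreignRegion W f r x a i j)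
        (2 ^ (h : ℕ)) (by positivity) ?_ ?_).trans (by simp))
    · intro ρ hρ
      simp only [mem_filter, mem_univ, true_and, bad, Function.update_self, hfor] at hρ ⊢
      refine hρ.2.trans (Nat.mul_le_mul_left _ (sum_le_sum fun j _ => ?_))
      refine card_le_card_of_injOn (fun b => f i y j + b) ?_
        (fun b _ b' _ hbb => add_left_cancel hbb)
      intro b hb
      simp only [coe_filter, Set.mem_ofPred_eq, mem_image, id] at hb ⊢
      exact ⟨⟨b, hb.1, rfl⟩, hb.2⟩
    · intro j
      rw [card_image_of_injective _ (add_right_injective _), hW _ (by omega)]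
    · have hrow : ∀ j, #(foreignRegion W f r x a i j) ≤
          ∑ i, ((a i).elim 0 fun h => 2 ^ (h : ℕ)) := by
        intro j
        refine card_biUnion_le.trans ((sum_le_sum fun i' _ => ?_).trans
          (sum_le_sum_of_subset (erase_subset i univ)))
        rcases a i' with _ | h'
        · simp
        · simpa [shiftedRegion] using card_image_le.trans (hW h' (by omega)).le
      calc 2 ^ 17 * ∑ j, #(foreignRegion W f r x a i j)
          ≤ 2 ^ 17 * ∑ j : ι, ∑ i, ((a i).elim 0 fun h => 2 ^ (h : ℕ)) :=
            Nat.mul_le_mul_left _ (sum_le_sum fun j _ => hrow j)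
        _ = (2 ^ 17 * ∑ i, ((a i).elim 0 fun h => 2 ^ (h : ℕ))) * Fintype.card ι := by
            rw [sum_const, smul_eq_mul, card_univ]; ring
        _ ≤ _ := by rw [hG]; exact Nat.mul_le_mul_right _ hwt
  have hcover : (univ : Finset (I → ι → G)) ⊆ (univ : Finset E).biUnion
      fun ε => {r | bad ε r} := by
    intro r _
    obtain ⟨x, a, hwt, i, y, h, hb⟩ := hcon r
    simp only [mem_biUnion, mem_filter, mem_univ, true_and]
    exact ⟨(x, a, i, y, h), hwt, hb⟩
  have h1 := (card_le_card hcover).trans card_biUnion_le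
  have h2 : Fintype.card (I → ι → G) * 2 ^ Fintype.card ι ≤
      Fintype.card E * Fintype.card (I → ι → G) := by
    calc _ ≤ (∑ ε : E, #{r | bad ε r}) * 2 ^ Fintype.card ι := Nat.mul_le_mul_right _ h1
      _ ≤ ∑ ε : E, Fintype.card (I → ι → G) := by
          rw [sum_mul]; exact sum_le_sum fun ε _ => hbad ε
      _ = _ := by simp
  have hpos : 0 < Fintype.card (I → ι → G) := Fintype.card_pos
  rw [mul_comm] at h2
  have h3 := Nat.le_of_mul_le_mul_right h2 hpos
  have hE : Fintype.card E = Fintype.card V * Fintype.card V * (H + 2) ^ Fintype.card I *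
      Fintype.card I * (H + 1) := by
    simp only [E, Fintype.card_prod, Fintype.card_fun, Fintype.card_option, Fintype.card_fin]
    ring
  omega

/-! ### The block table -/

/-- Columns of the block table. -/
abbrev Col (H : ℕ) : Type := Fin H → ZMod 2

/-- The columns whose coordinates beyond the first `h` vanish. -/
def colsBelow (H h : ℕ) : Finset (Col H) := {g | ∀ i : Fin H, h ≤ i → g i = 0}

theorem mem_colsBelow {H h : ℕ} {g : Col H} :
    g ∈ colsBelow H h ↔ ∀ i : Fin H, h ≤ i → g i = 0 := by simp [colsBelow]

theorem card_colsBelow {H h : ℕ} (hh : h ≤ H) : #(colsBelow H h) = 2 ^ h := by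
  have : colsBelow H h = Fintype.piFinset fun i : Fin H =>
      if h ≤ i then ({0} : Finset (ZMod 2)) else univ := by
    ext g
    simp only [mem_colsBelow, Fintype.mem_piFinset]
    refine forall_congr' fun i => ?_
    split_ifs with h1 <;> simp [h1]
  rw [this, Fintype.card_piFinset]
  have h2 : ∀ i : Fin H, #(if h ≤ i then ({0} : Finset (ZMod 2)) else univ)
      = if h ≤ i then 1 else 2 := fun i => by split_ifs <;> simp
  simp only [h2]
  rw [prod_ite, prod_const_one, one_mul, prod_const]
  congr 1
  simp only [not_le]
  rw [Fin.card_filter_val_lt]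
  omega

theorem add_mem_colsBelow {H h : ℕ} {g g' : Col H} (hg : g ∈ colsBelow H h)
    (hg' : g' ∈ colsBelow H h) : g + g' ∈ colsBelow H h := by
  rw [mem_colsBelow] at *
  intro i hi
  simp [hg i hi, hg' i hi]

theorem sub_mem_colsBelow {H h : ℕ} {g g' : Col H} (hg : g ∈ colsBelow H h)
    (hg' : g' ∈ colsBelow H h) : g - g' ∈ colsBelow H h := by
  rw [mem_colsBelow] at *
  intro i hi
  simp [hg i hi, hg' i hi]

theorem colsBelow_mono {H h h' : ℕ} (hh : h ≤ h') : colsBelow H h ⊆ colsBelow H h' := by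
  intro g hg
  rw [mem_colsBelow] at *
  exact fun i hi => hg i (hh.trans hi)

/-- Types of requests: a level and a stage. -/
abbrev ReqType (K : Finset ℕ) (H : ℕ) : Type := K × Fin (H + 1)

/-- The number of vertices that fill up a prescribed sparse part of the table is small, and
foreign regions are sparse in every region. -/
structure Layout (V : Type) [Fintype V] (K : Finset ℕ) (a H : ℕ) where
  base : Fin (H + 1) → V → Fin (2 ^ a) → Col H
  shift : ReqType K H → Fin (2 ^ a) → Col H
  base_mem : ∀ (h : Fin (H + 1)) y j, base h y j ∈ colsBelow H h
  spread : ∀ (h : Fin (H + 1)) (F : Fin (2 ^ a) → Finset (Col H)), (∀ j, F j ⊆ colsBelow H h) →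
    2 ^ 17 * ∑ j, #(F j) ≤ 2 ^ (h : ℕ) * 2 ^ a →
    #{y | ∃ h' ≤ (h : ℕ), 2 ^ h' * 2 ^ a ≤
      8 * ∑ j, #{b ∈ colsBelow H h' | base h y j + b ∈ F j}} < 4 * 2 ^ (h : ℕ)
  foreign : ∀ (x : V) (p : ReqType K H → Option (Fin (H + 1))),
    2 ^ 17 * ∑ i, ((p i).elim 0 fun h => 2 ^ (h : ℕ)) ≤ 2 ^ H →
      ∀ (i : ReqType K H) (y : V) (h : Fin (H + 1)),
        8 * ∑ j, #{b ∈ colsBelow H h | shift i j + (base i.2 y j + b) ∈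
          foreignRegion (colsBelow H) (fun i => base i.2) shift x p i j} < 2 ^ (h : ℕ) * 2 ^ a

/-- Base points are drawn inside the subgroup of their stage, one stage at a time, with t' =
2^(a-1); the shifts are chosen once these are fixed. -/
theorem exists_layout (V : Type) [Fintype V] (K : Finset ℕ) (a H n : ℕ)
    (hV : Fintype.card V ≤ 2 ^ n) (ha : 2 ≤ a) (hn : 2 ^ n * (H + 1) ≤ 2 ^ 2 ^ (a - 1))
    (hcard : 2 ^ n * 2 ^ n * (H + 2) ^ (#K * (H + 1)) * (#K * (H + 1)) * (H + 1) < 2 ^ 2 ^ a) :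
    Nonempty (Layout V K a H) := by
  classical
  have hex : ∀ h : Fin (H + 1), ∃ f : V → Fin (2 ^ a) → Col H, (∀ y j, f y j ∈ colsBelow H h) ∧
      ∀ F : Fin (2 ^ a) → Finset (Col H), (∀ j, F j ⊆ colsBelow H h) →
      2 ^ 17 * ∑ j, #(F j) ≤ 2 ^ (h : ℕ) * 2 ^ a →
      #{y | ∃ h' ≤ (h : ℕ), 2 ^ h' * 2 ^ a ≤
        8 * ∑ j, #{b ∈ colsBelow H h' | f y j + b ∈ F j}} < 4 * 2 ^ (h : ℕ) := by
    intro h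
    have h0 : (0 : Col H) ∈ colsBelow H h := by rw [mem_colsBelow]; simp
    have : Nonempty (colsBelow H h) := ⟨⟨0, h0⟩⟩
    obtain ⟨f, hf⟩ := exists_spread_points (V := V) (ι := Fin (2 ^ a)) (Ω := colsBelow H h)
      Subtype.val Subtype.val_injective (colsBelow H) n (2 ^ (a - 1)) h
      (fun h' hh' => card_colsBelow (by omega))
      (by simp [card_colsBelow (show (h : ℕ) ≤ H by omega)])
      hV (by rw [Fintype.card_fin, ← pow_succ', Nat.sub_add_cancel (by omega)])
      (by
        calc 2 = 2 ^ 1 := rfl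
          _ ≤ _ := Nat.pow_le_pow_right (by norm_num) (by omega))
      ((Nat.mul_le_mul_left _ (by omega)).trans hn)
    refine ⟨fun y j => f y j, fun y j => (f y j).2, fun F hF hc => ?_⟩
    have himg : ∀ j, ((F j).subtype (· ∈ colsBelow H h)).image Subtype.val = F j := by
      intro j
      ext g
      simp only [mem_image, mem_subtype, Subtype.exists, exists_and_left, exists_prop,
        exists_eq_right_right]
      exact ⟨fun h => h.1, fun hg => ⟨hg, hF j hg⟩⟩
    have hcd : ∀ j, #((F j).subtype (· ∈ colsBelow H h)) = #(F j) := by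
      intro j
      conv_rhs => rw [← himg j, card_image_of_injective _ Subtype.val_injective]
    have := hf (fun j => (F j).subtype (· ∈ colsBelow H h))
      (by simpa only [hcd, Fintype.card_fin] using hc)
    simpa only [himg, Fintype.card_fin] using this
  choose f hf1 hf2 using hex
  obtain ⟨r, hr⟩ := exists_shifts (I := ReqType K H) (V := V) (ι := Fin (2 ^ a)) (colsBelow H) H
    (fun i => f i.2) (fun h' hh' => card_colsBelow hh') (by simp)
    (by
      simp only [Fintype.card_prod, Fintype.card_coe, Fintype.card_fin]
      refine lt_of_le_of_lt ?_ hcard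
      gcongr)
  exact ⟨⟨f, r, hf1, hf2, fun x p hp i y h => by simpa using hr x p hp i y h⟩⟩

/-! ### Bookkeeping of the answered requests -/

/-- An answered request between two vertices. -/
structure Placement (V : Type) (K : Finset ℕ) (a H : ℕ) where
  heavy : V
  light : V
  type : ReqType K H
  block : Fin (2 ^ a) × Col H
  slot : ℕ

section Dynamics

variable {V : Type} [DecidableEq V] {K : Finset ℕ} {a H : ℕ}

/-- The number of answered requests of level `k` at `z`. -/
def levelDegree (σ : List (Placement V K a H)) (z : V) (k : ℕ) : ℕ :=
  σ.countP fun m => (m.type.1 : ℕ) = k ∧ (m.heavy = z ∨ m.light = z)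

/-- The number of requests of a type with a given heavy endpoint. -/
def heavyCount (σ : List (Placement V K a H)) (z : V) (i : ReqType K H) : ℕ :=
  σ.countP fun m => m.type = i ∧ m.heavy = z

/-- The number of requests of a type with a given light endpoint. -/
def lightCount (σ : List (Placement V K a H)) (z : V) (i : ReqType K H) : ℕ :=
  σ.countP fun m => m.type = i ∧ m.light = z

/-- The number of requests of a type in a block with a given heavy endpoint. -/
def heavyBlockCount (σ : List (Placement V K a H)) (z : V) (i : ReqType K H)
    (b : Fin (2 ^ a) × Col H) : ℕ :=
  σ.countP fun m => m.type = i ∧ m.heavy = z ∧ m.block = b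

/-- The number of requests of a type in a block with a given light endpoint. -/
def lightBlockCount (σ : List (Placement V K a H)) (z : V) (i : ReqType K H)
    (b : Fin (2 ^ a) × Col H) : ℕ :=
  σ.countP fun m => m.type = i ∧ m.light = z ∧ m.block = b

/-- The total weight (in units `2 ^ (-R)`) of the requests at `z`. -/
def placementLoad (R : ℕ) (σ : List (Placement V K a H)) (z : V) : ℕ :=
  (σ.map fun m => if m.heavy = z ∨ m.light = z then 2 ^ (R - m.type.1) else 0).sum

/-- The number of requests of level `k` that a vertex may have at stage `h`. -/
def stageCap (H k h : ℕ) : ℕ := 2 ^ (h + k + 22 - H)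

theorem stageCap_mono {H k h h' : ℕ} (hh : h ≤ h') : stageCap H k h ≤ stageCap H k h' :=
  Nat.pow_le_pow_right (by norm_num) (by omega)

theorem exists_le_stageCap (H k c : ℕ) : ∃ h, c ≤ stageCap H k h :=
  ⟨c + H, (Nat.lt_two_pow_self).le.trans (Nat.pow_le_pow_right (by norm_num) (by omega))⟩

/-- The stage of the region that is used by a light vertex with `c` requests. -/
noncomputable def growth (H k c : ℕ) : ℕ := sInf {h | c ≤ stageCap H k h}

theorem growth_le_iff {H k c h : ℕ} : growth H k c ≤ h ↔ c ≤ stageCap H k h := by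
  refine ⟨fun hg => ?_, fun hc => Nat.sInf_le hc⟩
  exact (Nat.sInf_mem (s := {h | c ≤ stageCap H k h}) (exists_le_stageCap H k c)).trans
    (stageCap_mono hg)

theorem growth_mono {H k c c' : ℕ} (hc : c ≤ c') : growth H k c ≤ growth H k c' :=
  growth_le_iff.2 (hc.trans (growth_le_iff.1 le_rfl))

/-- The stages of the regions that a vertex uses for the various types. -/
noncomputable def profile (σ : List (Placement V K a H)) (z : V) (i : ReqType K H) :
    Option (Fin (H + 1)) :=
  if 0 < heavyCount σ z i then some i.2
  else if 0 < lightCount σ z i then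
    some ⟨min (growth H i.1 (lightCount σ z i)) H, by omega⟩
  else none

theorem levelDegree_cons (m : Placement V K a H) (σ : List (Placement V K a H)) (z : V) (k : ℕ) :
    levelDegree (m :: σ) z k = levelDegree σ z k +
      if (m.type.1 : ℕ) = k ∧ (m.heavy = z ∨ m.light = z) then 1 else 0 := by
  simp [levelDegree, List.countP_cons]

theorem heavyCount_cons (m : Placement V K a H) (σ : List (Placement V K a H)) (z : V)
    (i : ReqType K H) :
    heavyCount (m :: σ) z i = heavyCount σ z i + if m.type = i ∧ m.heavy = z then 1 else 0 := by
  simp [heavyCount, List.countP_cons]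

theorem lightCount_cons (m : Placement V K a H) (σ : List (Placement V K a H)) (z : V)
    (i : ReqType K H) :
    lightCount (m :: σ) z i = lightCount σ z i + if m.type = i ∧ m.light = z then 1 else 0 := by
  simp [lightCount, List.countP_cons]

theorem heavyBlockCount_cons (m : Placement V K a H) (σ : List (Placement V K a H)) (z : V)
    (i : ReqType K H) (b : Fin (2 ^ a) × Col H) :
    heavyBlockCount (m :: σ) z i b = heavyBlockCount σ z i b +
      if m.type = i ∧ m.heavy = z ∧ m.block = b then 1 else 0 := by
  simp [heavyBlockCount, List.countP_cons]

theorem lightBlockCount_cons (m : Placement V K a H) (σ : List (Placement V K a H)) (z : V)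
    (i : ReqType K H) (b : Fin (2 ^ a) × Col H) :
    lightBlockCount (m :: σ) z i b = lightBlockCount σ z i b +
      if m.type = i ∧ m.light = z ∧ m.block = b then 1 else 0 := by
  simp [lightBlockCount, List.countP_cons]

theorem placementLoad_cons (R : ℕ) (m : Placement V K a H) (σ : List (Placement V K a H)) (z : V) :
    placementLoad R (m :: σ) z =
      (if m.heavy = z ∨ m.light = z then 2 ^ (R - m.type.1) else 0) + placementLoad R σ z := by
  simp [placementLoad]

theorem sum_levelDegree_le (R : ℕ) (σ : List (Placement V K a H)) (z : V) :
    ∑ k ∈ K, levelDegree σ z k * 2 ^ (R - k) ≤ placementLoad R σ z := by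
  induction σ with
  | nil => simp [levelDegree]
  | cons m σ ih =>
    rw [placementLoad_cons]
    simp only [levelDegree_cons, add_mul, sum_add_distrib]
    rw [add_comm]
    refine Nat.add_le_add ?_ ih
    by_cases hm : m.heavy = z ∨ m.light = z
    · simp only [hm, and_true, if_true, ite_mul, one_mul, zero_mul]
      rw [sum_ite_eq]
      split_ifs <;> simp
    · simp [hm]

theorem sum_lightCount_le (σ : List (Placement V K a H)) (z : V) (k : K) :
    ∑ h, lightCount σ z (k, h) ≤ levelDegree σ z k := by
  induction σ with
  | nil => simp [lightCount]
  | cons m σ ih =>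
    simp only [levelDegree_cons, lightCount_cons, sum_add_distrib]
    refine Nat.add_le_add ih ?_
    by_cases hm : (m.type.1 : ℕ) = k ∧ (m.heavy = z ∨ m.light = z)
    · rw [if_pos hm]
      calc ∑ h, (if m.type = (k, h) ∧ m.light = z then 1 else 0)
          ≤ ∑ h, (if m.type.2 = h then 1 else 0) := by
            refine sum_le_sum fun h _ => ?_
            split_ifs with h1 h2 <;> simp
            exact h2 (by rw [h1.1])
        _ ≤ 1 := by simp
    · rw [if_neg hm]
      refine (sum_eq_zero fun h _ => if_neg ?_).le
      rintro ⟨h1, h2⟩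
      exact hm ⟨by rw [h1], Or.inr h2⟩

theorem lightCount_le_levelDegree (σ : List (Placement V K a H)) (z : V) (i : ReqType K H) :
    lightCount σ z i ≤ levelDegree σ z i.1 :=
  (single_le_sum (f := fun h => lightCount σ z (i.1, h)) (fun _ _ => Nat.zero_le _)
    (mem_univ i.2)).trans (sum_lightCount_le σ z i.1)

theorem heavyCount_le_levelDegree (σ : List (Placement V K a H)) (z : V) (i : ReqType K H) :
    heavyCount σ z i ≤ levelDegree σ z i.1 := by
  refine List.countP_mono_left fun m _ h => ?_
  simp only [decide_eq_true_eq] at *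
  exact ⟨by rw [h.1], Or.inl h.2⟩

theorem exists_of_heavyCount_pos {σ : List (Placement V K a H)} {z : V} {i : ReqType K H}
    (h : 0 < heavyCount σ z i) :
    ∃ m ∈ σ, m.type = i ∧ m.heavy = z := by
  obtain ⟨m, hm, h⟩ := List.countP_pos_iff.1 h
  exact ⟨m, hm, by simpa using h⟩

theorem sum_block_count_le {α β : Type*} [DecidableEq β] (σ : List α)
    (p : α → Bool) (g : α → β) (S : Finset β) :
    ∑ b ∈ S, σ.countP (fun m => p m ∧ g m = b) ≤ σ.countP p := by
  induction σ with
  | nil => simp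
  | cons m σ ih =>
    simp only [List.countP_cons, sum_add_distrib]
    refine Nat.add_le_add ih ?_
    cases hp : p m
    · simp
    · simp only [true_and, decide_eq_true_eq, if_true]
      rw [sum_ite_eq]
      split_ifs <;> simp

theorem sum_heavyBlockCount_le (σ : List (Placement V K a H)) (z : V) (i : ReqType K H)
    (S : Finset (Fin (2 ^ a) × Col H)) :
    ∑ b ∈ S, heavyBlockCount σ z i b ≤ heavyCount σ z i := by
  refine le_trans (le_of_eq (sum_congr rfl fun b _ => ?_)) (sum_block_count_le σ
    (fun m => decide (m.type = i ∧ m.heavy = z)) (fun m => m.block) S)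
  simp [heavyBlockCount, and_assoc]

theorem sum_lightBlockCount_le (σ : List (Placement V K a H)) (z : V) (i : ReqType K H)
    (S : Finset (Fin (2 ^ a) × Col H)) :
    ∑ b ∈ S, lightBlockCount σ z i b ≤ lightCount σ z i := by
  refine le_trans (le_of_eq (sum_congr rfl fun b _ => ?_)) (sum_block_count_le σ
    (fun m => decide (m.type = i ∧ m.light = z)) (fun m => m.block) S)
  simp [lightBlockCount, and_assoc]

/-- A geometric series is dominated by its last term, and the largest positive stage h that occurs
has 2^h ≤ 2d/D; the summand D accounts for stage 0. -/
theorem sum_stages_le (H D d : ℕ) :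
    (∑ h ∈ range (H + 1) with h = 0 ∨ D * 2 ^ (h - 1) ≤ d, 2 ^ h) * D ≤ D + 4 * d := by
  induction H with
  | zero => simp [filter_singleton]
  | succ H ih =>
    by_cases hd : D * 2 ^ H ≤ d
    · calc (∑ h ∈ range (H + 1 + 1) with h = 0 ∨ D * 2 ^ (h - 1) ≤ d, 2 ^ h) * D
          ≤ (∑ h ∈ range (H + 1 + 1), 2 ^ h) * D :=
            Nat.mul_le_mul_right _ (sum_le_sum_of_subset (filter_subset _ _))
        _ ≤ 2 ^ (H + 1 + 1) * D := by
            refine Nat.mul_le_mul_right _ ?_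
            have := Nat.geomSum_lt (m := 2) (n := H + 1 + 1) (s := range (H + 1 + 1)) le_rfl
              (fun k hk => by simpa using hk)
            exact this.le
        _ = 4 * (D * 2 ^ H) := by ring
        _ ≤ _ := by omega
    · rw [range_add_one, filter_insert, if_neg (by simpa using hd)]
      exact ih

/-- The blocks of a region that are filled by a heavy vertex. -/
def filledCols (r : ReqType K H → Fin (2 ^ a) → Col H) (σ : List (Placement V K a H))
    (z : V) (i : ReqType K H) (j : Fin (2 ^ a)) : Finset (Col H) :=
  {g ∈ colsBelow H i.2 | 2 ^ (i.1 + 42 - a - H) ≤ 8 * heavyBlockCount σ z i (j, r i j + g)}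

end Dynamics

/-! ### The invariant of the strategy -/

section Invariant

variable {V : Type} [DecidableEq V] [Fintype V] {K : Finset ℕ} {a H : ℕ}

/-- Too many blocks of some region of `y` are filled by `z`. -/
def Layout.Clogged (Λ : Layout V K a H) (σ : List (Placement V K a H)) (z : V) (i : ReqType K H)
    (y : V) : Prop :=
  ∃ h' ≤ (i.2 : ℕ), 2 ^ h' * 2 ^ a ≤
    8 * ∑ j, #{b ∈ colsBelow H h' | Λ.base i.2 y j + b ∈ filledCols Λ.shift σ z i j}

/-- The properties of the reachable states. -/
structure Layout.Inv (Λ : Layout V K a H) (σ : List (Placement V K a H)) : Prop where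
  region : ∀ m ∈ σ, ∃ b ∈ colsBelow H (growth H m.type.1 (lightCount σ m.light m.type)),
    m.block.2 = Λ.shift m.type m.block.1 + (Λ.base m.type.2 m.light m.block.1 + b)
  heavy_le : ∀ z i, heavyCount σ z i ≤ stageCap H i.1 i.2
  light_le : ∀ z i, lightCount σ z i ≤ stageCap H i.1 i.2
  stage : ∀ m ∈ σ, (m.type.2 : ℕ) = 0 ∨
    stageCap H m.type.1 (m.type.2 - 1) ≤ levelDegree σ m.heavy m.type.1
  heavy_block : ∀ z (i : ReqType K H) b, ∃ S : Finset V, 8 * heavyBlockCount σ z i b ≤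
      2 ^ (i.1 + 42 - a - H) + 8 * #S ∧ ∀ y ∈ S, Λ.Clogged σ z i y ∧
        ∃ m ∈ σ, m.heavy = z ∧ m.light = y ∧ m.type = i
  light_block : ∀ z (i : ReqType K H) b, 8 * lightBlockCount σ z i b ≤ 2 ^ (i.1 + 42 - a - H)

theorem Layout.inv_nil (Λ : Layout V K a H) : Λ.Inv [] where
  region := by simp
  heavy_le := by simp [heavyCount]
  light_le := by simp [lightCount]
  stage := by simp
  heavy_block := fun z i b => ⟨∅, by simp [heavyBlockCount]⟩
  light_block := by simp [lightBlockCount]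

variable {Λ : Layout V K a H} {σ : List (Placement V K a H)}

/-- Regions used as heavy endpoint form a geometric series controlled by the degree (D + 4d). Those
used as light endpoint have size at most twice their request count over D, plus one for rounding
((H+1)D + 2d in all). -/
theorem Layout.Inv.profile_weight_level (hσ : Λ.Inv σ) (z : V) (k : K) (hk : H ≤ k + 22) :
    (∑ h, ((profile σ z (k, h)).elim 0 fun h => 2 ^ (h : ℕ))) * stageCap H k 0 ≤
      (H + 2) * stageCap H k 0 + 6 * levelDegree σ z k := by
  have hcap : ∀ h, stageCap H k h = stageCap H k 0 * 2 ^ h := fun h => by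
    rw [stageCap, stageCap, ← pow_add]; congr 1; omega
  set D := stageCap H k 0
  set d := levelDegree σ z k
  have hterm : ∀ h : Fin (H + 1), ((profile σ z (k, h)).elim 0 fun h => 2 ^ (h : ℕ)) * D ≤
      (if (h : ℕ) = 0 ∨ D * 2 ^ ((h : ℕ) - 1) ≤ d then 2 ^ (h : ℕ) else 0) * D +
        (D + 2 * lightCount σ z (k, h)) := by
    intro h
    have hlight : 2 ^ (min (growth H k (lightCount σ z (k, h))) H) * D ≤
        D + 2 * lightCount σ z (k, h) := by
      rcases Nat.eq_zero_or_pos (growth H k (lightCount σ z (k, h))) with h7 | h7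
      · simp [h7]
      · have h8 : ¬ lightCount σ z (k, h) ≤ stageCap H k
            (growth H k (lightCount σ z (k, h)) - 1) := by
          rw [← growth_le_iff]; omega
        rw [hcap, not_le] at h8
        set g := growth H k (lightCount σ z (k, h))
        calc 2 ^ (min g H) * D ≤ 2 ^ g * D := by gcongr <;> simp
          _ = 2 * (D * 2 ^ (g - 1)) := by
              obtain ⟨g', hg'⟩ : ∃ g', g = g' + 1 := ⟨g - 1, by omega⟩
              rw [hg', Nat.add_sub_cancel, pow_succ]; ring
          _ ≤ _ := by omega
    unfold profile
    by_cases h1 : 0 < heavyCount σ z (k, h)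
    · obtain ⟨m, hm, h5, h6⟩ := exists_of_heavyCount_pos h1
      have := hσ.stage m hm
      rw [h5, h6, hcap] at this
      rw [if_pos h1, if_pos this]
      simp
    · rw [if_neg h1]
      refine le_trans ?_ (Nat.le_add_left _ _)
      by_cases h2 : 0 < lightCount σ z (k, h)
      · rw [if_pos h2]
        exact hlight
      · simp [if_neg h2]
  rw [sum_mul]
  refine (sum_le_sum fun h _ => hterm h).trans ?_
  rw [sum_add_distrib, ← sum_mul, sum_add_distrib, ← mul_sum,
    Fin.sum_univ_eq_sum_range (fun h => if h = 0 ∨ D * 2 ^ (h - 1) ≤ d then 2 ^ h else 0),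
    ← sum_filter]
  have h1 := sum_stages_le H D d
  have h2 := sum_lightCount_le σ z k
  simp only [sum_const, card_univ, Fintype.card_fin, smul_eq_mul]
  have : (H + 2) * D = D + (H + 1) * D := by ring
  omega

/-- This is the sparseness hypothesis of the `foreign` field of a layout. The rounding terms are
paid by `hL`, the main terms by the load bound, because 2^22 in `stageCap` makes a region much
larger than the load needs. -/
theorem Layout.Inv.profile_weight (hσ : Λ.Inv σ) (R : ℕ) (z : V) (hK : ∀ k ∈ K, H ≤ k + 22 ∧ k ≤ R)
    (hL : #K * (H + 2) * 2 ^ 18 ≤ 2 ^ H) (hload : placementLoad R σ z ≤ 2 ^ (R + 1)) :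
    2 ^ 17 * ∑ i, ((profile σ z i).elim 0 fun h => 2 ^ (h : ℕ)) ≤ 2 ^ H := by
  set w : K → ℕ := fun k => ∑ h, ((profile σ z (k, h)).elim 0 fun h => 2 ^ (h : ℕ)) with hw
  have hsum : ∑ i, ((profile σ z i).elim 0 fun h => 2 ^ (h : ℕ)) = ∑ k, w k :=
    Fintype.sum_prod_type _
  have hk : ∀ k : K, w k * 2 ^ (22 + R) ≤
      (H + 2) * 2 ^ (22 + R) + 6 * 2 ^ H * (levelDegree σ z k * 2 ^ (R - k)) := by
    intro k
    obtain ⟨hk1, hk2⟩ := hK k k.2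
    have h1 := Nat.mul_le_mul_right (2 ^ H * 2 ^ (R - k)) (hσ.profile_weight_level z k hk1)
    have h2 : stageCap H k 0 * (2 ^ H * 2 ^ (R - k)) = 2 ^ (22 + R) := by
      rw [stageCap, ← pow_add, ← pow_add]; congr 1; omega
    calc w k * 2 ^ (22 + R) = w k * stageCap H k 0 * (2 ^ H * 2 ^ (R - k)) := by
          rw [mul_assoc, h2]
      _ ≤ _ := h1
      _ = _ := by rw [add_mul, mul_assoc (H + 2), h2]; ring
  have h3 : (∑ k, w k) * 2 ^ (22 + R) ≤
      #K * (H + 2) * 2 ^ (22 + R) + 6 * 2 ^ H * 2 ^ (R + 1) := by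
    rw [sum_mul]
    refine (sum_le_sum fun k _ => hk k).trans ?_
    rw [sum_add_distrib, ← mul_sum, ← mul_sum, sum_const, card_univ, Fintype.card_coe,
      smul_eq_mul]
    refine Nat.add_le_add (le_of_eq (by ring)) (Nat.mul_le_mul_left _ ?_)
    rw [sum_coe_sort K (fun k => levelDegree σ z k * 2 ^ (R - k))]
    exact (sum_levelDegree_le R σ z).trans hload
  rw [hsum]
  have h4 : (2 ^ 17 * ∑ k, w k) * 2 ^ (5 + R) ≤ 2 ^ H * 2 ^ (5 + R) := by
    calc (2 ^ 17 * ∑ k, w k) * 2 ^ (5 + R) = (∑ k, w k) * 2 ^ (22 + R) := by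
          rw [show 22 + R = 17 + (5 + R) by omega, pow_add 2 17]; ring
      _ ≤ _ := h3
      -- In units of 2^(H-22) the total is 16 + 12 = 28, below the allowed 32.
      _ = (#K * (H + 2) * 2 ^ 18) * 2 ^ (4 + R) + 12 * 2 ^ H * 2 ^ R := by
          rw [show 22 + R = 18 + (4 + R) by omega, pow_add 2 18, pow_succ]; ring
      _ ≤ 2 ^ H * 2 ^ (4 + R) + 12 * 2 ^ H * 2 ^ R := by gcongr
      _ = 28 * (2 ^ H * 2 ^ R) := by rw [pow_add]; ring
      _ ≤ 32 * (2 ^ H * 2 ^ R) := by gcongr; norm_num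
      _ = _ := by rw [pow_add]; ring
  exact Nat.le_of_mul_le_mul_right h4 (by positivity)

/-- The blocks used by a vertex for another type lie in its foreign region. -/
theorem Layout.Inv.mem_foreignRegion (hσ : Λ.Inv σ) {z : V} {m : Placement V K a H} (hm : m ∈ σ)
    (hz : m.heavy = z ∨ m.light = z) {i : ReqType K H} (hi : m.type ≠ i) :
    m.block.2 ∈ foreignRegion (colsBelow H) (fun i => Λ.base i.2) Λ.shift z (profile σ z) i
      m.block.1 := by
  obtain ⟨b, hb, hmb⟩ := hσ.region m hm
  have hgr : growth H m.type.1 (lightCount σ m.light m.type) ≤ m.type.2 :=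
    growth_le_iff.2 (hσ.light_le _ _)
  -- Base points lie in the subgroup of the stage, so at full size the regions of all vertices are
  -- the same coset; the light vertex's block therefore lies in the full region of `z`.
  have hfull : m.block.2 ∈ shiftedRegion (colsBelow H) (fun i => Λ.base i.2) Λ.shift z m.type
      m.type.2 m.block.1 := by
    rw [shiftedRegion, mem_image]
    refine ⟨Λ.base m.type.2 m.light m.block.1 + b - Λ.base m.type.2 z m.block.1,
      sub_mem_colsBelow (add_mem_colsBelow (Λ.base_mem _ _ _) (colsBelow_mono hgr hb))
        (Λ.base_mem _ _ _), ?_⟩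
    rw [hmb]
    simp
  rw [foreignRegion, mem_biUnion]
  refine ⟨m.type, by simpa using hi, ?_⟩
  by_cases hpos : 0 < heavyCount σ z m.type
  · simpa [profile, hpos] using hfull
  · rcases hz with hz | hz
    · exact absurd (List.countP_pos_iff.2 ⟨m, hm, by simp [hz]⟩) hpos
    · have hl : 0 < lightCount σ z m.type := List.countP_pos_iff.2 ⟨m, hm, by simp [hz]⟩
      rw [hz] at hb hgr hmb
      simp only [profile, hpos, if_false, hl, if_true, Option.elim_some]
      rw [shiftedRegion, mem_image, min_eq_left (by omega)]
      exact ⟨b, hb, hmb.symm⟩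

theorem filledCols_mono (m : Placement V K a H) (σ : List (Placement V K a H)) (z : V)
    (i : ReqType K H) (j : Fin (2 ^ a)) :
    filledCols Λ.shift σ z i j ⊆ filledCols Λ.shift (m :: σ) z i j := by
  intro g
  simp only [filledCols, mem_filter, heavyBlockCount_cons]
  rintro ⟨h1, h2⟩
  exact ⟨h1, by omega⟩

theorem Layout.Clogged.cons {z y : V} {i : ReqType K H} (h : Λ.Clogged σ z i y)
    (m : Placement V K a H) : Λ.Clogged (m :: σ) z i y := by
  obtain ⟨h', hh', h⟩ := h
  refine ⟨h', hh', h.trans (Nat.mul_le_mul_left _ (sum_le_sum fun j _ => card_le_card ?_))⟩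
  exact monotone_filter_right _ fun b _ hb => filledCols_mono m σ z i j hb

/-- A filled block carries an eighth of its capacity, 2^(k+39-a-H), and `z` has at most 2^(h+k+22-H)
heavy requests. So at most a 2^(-17) fraction of the region is filled, which is the sparseness
required by `spread`; here 42 = 22 + 17 + 3. -/
theorem Layout.Inv.card_clogged_lt (hσ : Λ.Inv σ) (z : V) (i : ReqType K H)
    (hk : a + H + 20 ≤ i.1 + 42) (S : Finset V) (hS : ∀ y ∈ S, Λ.Clogged σ z i y) :
    #S < 4 * 2 ^ (i.2 : ℕ) := by
  classical
  refine lt_of_le_of_lt (card_le_card fun y hy => ?_) (Λ.spread i.2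
    (fun j => filledCols Λ.shift σ z i j) (fun j => filter_subset _ _) ?_)
  · exact mem_filter.2 ⟨mem_univ _, hS y hy⟩
  · set M := 2 ^ ((i.1 : ℕ) + 42 - a - H) with hM
    have h1 : (∑ j, #(filledCols Λ.shift σ z i j)) * M ≤ 8 * heavyCount σ z i := by
      have h2 : ∀ j, #(filledCols Λ.shift σ z i j) * M ≤
          ∑ g ∈ colsBelow H i.2, 8 * heavyBlockCount σ z i (j, Λ.shift i j + g) := by
        intro j
        rw [← smul_eq_mul, ← sum_const]
        refine (sum_le_sum fun g hg => ?_).trans (sum_le_sum_of_subset (filter_subset _ _))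
        exact (mem_filter.1 hg).2
      rw [sum_mul]
      refine (sum_le_sum fun j _ => h2 j).trans ?_
      simp only [← mul_sum]
      refine Nat.mul_le_mul_left _ ?_
      rw [← sum_product' univ (colsBelow H i.2)
        (fun j g => heavyBlockCount σ z i (j, Λ.shift i j + g))]
      rw [← sum_image (s := univ ×ˢ colsBelow H i.2)
        (g := fun p : Fin (2 ^ a) × Col H => (p.1, Λ.shift i p.1 + p.2))
        (f := fun b => heavyBlockCount σ z i b)]
      · exact sum_heavyBlockCount_le σ z i _
      · rintro ⟨j, g⟩ _ ⟨j', g'⟩ _ h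
        simp only [Prod.mk.injEq] at h
        obtain ⟨rfl, h⟩ := h
        rw [add_left_cancel h]
    have h3 := h1.trans (Nat.mul_le_mul_left 8 (hσ.heavy_le z i))
    refine Nat.le_of_mul_le_mul_right (c := M) ?_ (by positivity)
    calc 2 ^ 17 * (∑ j, #(filledCols Λ.shift σ z i j)) * M
        ≤ 2 ^ 17 * (8 * stageCap H i.1 i.2) := by rw [mul_assoc]; exact Nat.mul_le_mul_left _ h3
      _ = 2 ^ (i.2 : ℕ) * 2 ^ a * M := by
          rw [show 8 = 2 ^ 3 from rfl, stageCap, hM, ← pow_add, ← pow_add, ← pow_add, ← pow_add]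
          congr 1
          omega

end Invariant

theorem Layout.block_injective {V : Type} [Fintype V] {K : Finset ℕ} {a H : ℕ}
    (Λ : Layout V K a H) (i : ReqType K H) (y : V) :
    Function.Injective fun p : Fin (2 ^ a) × Col H =>
      (p.1, Λ.shift i p.1 + (Λ.base i.2 y p.1 + p.2)) := by
  rintro ⟨j, g⟩ ⟨j', g'⟩ h
  simp only [Prod.mk.injEq] at h
  obtain ⟨rfl, h⟩ := h
  rw [add_left_cancel (add_left_cancel h)]

/-! ### Answering one request -/

section Step

variable {V : Type} [DecidableEq V] [Fintype V] {K : Finset ℕ} {a H : ℕ}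
variable {Λ : Layout V K a H} {σ : List (Placement V K a H)}

/-- A block may exceed an eighth of its capacity at the heavy endpoint only through clogged light
vertices, and each of them contributes at most one request of a given type. -/
theorem Layout.Inv.cons (hσ : Λ.Inv σ) (m : Placement V K a H)
    (hnew : ∀ m' ∈ σ, m'.heavy = m.heavy → m'.light = m.light → m'.type ≠ m.type)
    (hheavy : heavyCount σ m.heavy m.type < stageCap H m.type.1 m.type.2)
    (hlight : lightCount σ m.light m.type < stageCap H m.type.1 m.type.2)
    (hstage : (m.type.2 : ℕ) = 0 ∨
      stageCap H m.type.1 (m.type.2 - 1) ≤ levelDegree σ m.heavy m.type.1)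
    (hregion : ∃ b ∈ colsBelow H (growth H m.type.1 (lightCount σ m.light m.type + 1)),
      m.block.2 = Λ.shift m.type m.block.1 + (Λ.base m.type.2 m.light m.block.1 + b))
    (hM : 3 ≤ m.type.1 + 42 - a - H)
    (hlb : 8 * lightBlockCount σ m.light m.type m.block < 2 ^ (m.type.1 + 42 - a - H))
    (hhb : 8 * heavyBlockCount σ m.heavy m.type m.block < 2 ^ (m.type.1 + 42 - a - H) ∨
      Λ.Clogged σ m.heavy m.type m.light) :
    Λ.Inv (m :: σ) where
  region := by
    intro m' hm'
    rcases List.mem_cons.1 hm' with rfl | hm'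
    · obtain ⟨b, hb, h⟩ := hregion
      refine ⟨b, ?_, h⟩
      rw [lightCount_cons]
      simpa using hb
    · obtain ⟨b, hb, h⟩ := hσ.region m' hm'
      refine ⟨b, colsBelow_mono (growth_mono ?_) hb, h⟩
      rw [lightCount_cons]
      omega
  heavy_le := by
    intro z i
    rw [heavyCount_cons]
    have := hσ.heavy_le z i
    split_ifs with h
    · rw [← h.1, ← h.2]; omega
    · exact this
  light_le := by
    intro z i
    rw [lightCount_cons]
    have := hσ.light_le z i
    split_ifs with h
    · rw [← h.1, ← h.2]; omega
    · exact this
  stage := by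
    intro m' hm'
    have : (m'.type.2 : ℕ) = 0 ∨
        stageCap H m'.type.1 (m'.type.2 - 1) ≤ levelDegree σ m'.heavy m'.type.1 := by
      rcases List.mem_cons.1 hm' with rfl | hm'
      · exact hstage
      · exact hσ.stage m' hm'
    refine this.imp id fun h => h.trans ?_
    rw [levelDegree_cons]
    omega
  heavy_block := by
    intro z i b
    obtain ⟨S, hS1, hS2⟩ := hσ.heavy_block z i b
    rw [heavyBlockCount_cons]
    by_cases h : m.type = i ∧ m.heavy = z ∧ m.block = b
    · rw [if_pos h]
      obtain ⟨rfl, rfl, rfl⟩ := h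
      rcases hhb with hhb | hhb
      · refine ⟨∅, ?_, by simp⟩
        rw [card_empty, mul_zero, add_zero]
        -- By `hM` the capacity is a multiple of 8, so the strict inequality leaves room for one
        -- more request.
        obtain ⟨e, he⟩ := Nat.exists_eq_add_of_le hM
        rw [he, pow_add] at hhb ⊢
        omega
      -- The new request is charged to its light endpoint, which is not in `S` because the pair has
      -- no earlier request of this type with these roles.
      · refine ⟨insert m.light S, ?_, ?_⟩
        · rw [card_insert_of_notMem]
          · omega
          · intro hmem
            obtain ⟨-, m', hm', h1, h2, h3⟩ := hS2 _ hmem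
            exact hnew m' hm' h1 h2 h3
        · intro y hy
          rcases mem_insert.1 hy with rfl | hy
          · exact ⟨hhb.cons m, m, by simp⟩
          · obtain ⟨h1, m', hm', h2⟩ := hS2 y hy
            exact ⟨h1.cons m, m', List.mem_cons_of_mem _ hm', h2⟩
    · rw [if_neg h, add_zero]
      refine ⟨S, hS1, fun y hy => ?_⟩
      obtain ⟨h1, m', hm', h2⟩ := hS2 y hy
      exact ⟨h1.cons m, m', List.mem_cons_of_mem _ hm', h2⟩
  light_block := by
    intro z i b
    rw [lightBlockCount_cons]
    split_ifs with h
    · obtain ⟨rfl, rfl, rfl⟩ := h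
      obtain ⟨e, he⟩ := Nat.exists_eq_add_of_le hM
      rw [he, pow_add] at hlb ⊢
      omega
    · exact hσ.light_block z i b

/-- Within the current region of `y` there are four obstacles: foreign blocks of `x`, foreign blocks
of `y`, blocks full for the light endpoint, and blocks filled by `x`. Each covers at most an eighth,
the last by definition unless `y` is clogged, in which case it is ignored. -/
theorem Layout.exists_block (Λ : Layout V K a H) (σ : List (Placement V K a H)) (x y : V)
    (i : ReqType K H)
    (hk : a + H + 20 ≤ i.1 + 42)
    (hx : 2 ^ 17 * ∑ i, ((profile σ x i).elim 0 fun h => 2 ^ (h : ℕ)) ≤ 2 ^ H)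
    (hy : 2 ^ 17 * ∑ i, ((profile σ y i).elim 0 fun h => 2 ^ (h : ℕ)) ≤ 2 ^ H)
    (hlight : lightCount σ y i < stageCap H i.1 i.2) :
    ∃ (j : Fin (2 ^ a)) (g : Col H),
      (∃ b ∈ colsBelow H (growth H i.1 (lightCount σ y i + 1)),
        g = Λ.shift i j + (Λ.base i.2 y j + b)) ∧
      8 * lightBlockCount σ y i (j, g) < 2 ^ (i.1 + 42 - a - H) ∧
      (8 * heavyBlockCount σ x i (j, g) < 2 ^ (i.1 + 42 - a - H) ∨ Λ.Clogged σ x i y) ∧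
      g ∉ foreignRegion (colsBelow H) (fun i => Λ.base i.2) Λ.shift x (profile σ x) i j ∧
      g ∉ foreignRegion (colsBelow H) (fun i => Λ.base i.2) Λ.shift y (profile σ y) i j := by
  classical
  set h' := growth H i.1 (lightCount σ y i + 1) with hh'
  set M := 2 ^ ((i.1 : ℕ) + 42 - a - H) with hM
  have hle : h' ≤ i.2 := growth_le_iff.2 hlight
  have hcap : lightCount σ y i + 1 ≤ stageCap H i.1 h' := growth_le_iff.1 le_rfl
  set A : Finset (Fin (2 ^ a) × Col H) := univ ×ˢ colsBelow H h' with hA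
  have hAcard : #A = 2 ^ h' * 2 ^ a := by
    rw [hA, card_product, card_colsBelow (by omega), card_univ, Fintype.card_fin, mul_comm]
  let pos : Fin (2 ^ a) × Col H → Fin (2 ^ a) × Col H := fun p =>
    (p.1, Λ.shift i p.1 + (Λ.base i.2 y p.1 + p.2))
  have hrows : ∀ P : Fin (2 ^ a) → Col H → Prop, [∀ j g, Decidable (P j g)] →
      #{p ∈ A | P p.1 p.2} = ∑ j, #{b ∈ colsBelow H h' | P j b} := by
    intro P _
    simp only [card_filter]
    rw [hA, sum_product]
  set X := {p ∈ A | Λ.shift i p.1 + (Λ.base i.2 y p.1 + p.2) ∈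
    foreignRegion (colsBelow H) (fun i => Λ.base i.2) Λ.shift x (profile σ x) i p.1} with hXdef
  set Y := {p ∈ A | Λ.shift i p.1 + (Λ.base i.2 y p.1 + p.2) ∈
    foreignRegion (colsBelow H) (fun i => Λ.base i.2) Λ.shift y (profile σ y) i p.1} with hYdef
  set B := {p ∈ A | M ≤ 8 * lightBlockCount σ y i (pos p)} with hBdef
  set F := {p ∈ A | M ≤ 8 * heavyBlockCount σ x i (pos p) ∧ ¬ Λ.Clogged σ x i y} with hFdef
  have hX : 8 * #X < 2 ^ h' * 2 ^ a := by
    rw [hXdef, hrows fun j b => Λ.shift i j + (Λ.base i.2 y j + b) ∈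
      foreignRegion (colsBelow H) (fun i => Λ.base i.2) Λ.shift x (profile σ x) i j]
    exact Λ.foreign x (profile σ x) hx i y ⟨h', by omega⟩
  have hY : 8 * #Y < 2 ^ h' * 2 ^ a := by
    rw [hYdef, hrows fun j b => Λ.shift i j + (Λ.base i.2 y j + b) ∈
      foreignRegion (colsBelow H) (fun i => Λ.base i.2) Λ.shift y (profile σ y) i j]
    exact Λ.foreign y (profile σ y) hy i y ⟨h', by omega⟩
  -- The region has grown in proportion to the number of light requests of `y`, so few of its blocks
  -- can be full.
  have hB : 8 * #B ≤ 2 ^ h' * 2 ^ a := by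
    have h1 : #B * M ≤ 8 * lightCount σ y i := by
      rw [← smul_eq_mul, ← sum_const]
      refine (sum_le_sum fun p hp => (mem_filter.1 hp).2).trans ?_
      rw [← mul_sum, ← sum_image (s := B) (g := pos) (f := fun b => lightBlockCount σ y i b)
        (fun p _ p' _ h => Λ.block_injective i y h)]
      exact Nat.mul_le_mul_left _ (sum_lightBlockCount_le σ y i _)
    refine Nat.le_of_mul_le_mul_right (c := M) ?_ (by positivity)
    calc 8 * #B * M ≤ 8 * (8 * stageCap H i.1 h') := by
          rw [mul_assoc]; exact Nat.mul_le_mul_left _ (by omega)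
      _ = 2 ^ 6 * stageCap H i.1 h' := by ring
      _ ≤ 2 ^ h' * 2 ^ a * M := by
          rw [stageCap, hM, ← pow_add, ← pow_add, ← pow_add]
          exact Nat.pow_le_pow_right (by norm_num) (by omega)
  have hF : 8 * #F < 2 ^ h' * 2 ^ a := by
    by_cases hcl : Λ.Clogged σ x i y
    · have : F = ∅ := by rw [hFdef, filter_eq_empty_iff]; tauto
      rw [this, card_empty]
      positivity
    · by_contra hge
      refine hcl ⟨h', hle, (not_lt.1 hge).trans (Nat.mul_le_mul_left _ ?_)⟩
      rw [← hrows fun j b => Λ.base i.2 y j + b ∈ filledCols Λ.shift σ x i j]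
      refine card_le_card fun p hp => ?_
      obtain ⟨h1, h2, -⟩ := mem_filter.1 hp
      refine mem_filter.2 ⟨h1, mem_filter.2 ⟨?_, h2⟩⟩
      exact add_mem_colsBelow (Λ.base_mem _ _ _)
        (colsBelow_mono hle (mem_product.1 (hA ▸ h1)).2)
  have hex : ∃ p ∈ A, p ∉ X ∪ Y ∪ B ∪ F := by
    by_contra! hcon
    have h1 : #A ≤ #X + #Y + #B + #F :=
      (card_le_card hcon).trans ((card_union_le _ _).trans (Nat.add_le_add_right
        ((card_union_le _ _).trans (Nat.add_le_add_right (card_union_le _ _) _)) _))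
    rw [hAcard] at h1
    have : 0 < 2 ^ h' * 2 ^ a := by positivity
    omega
  obtain ⟨⟨j, b⟩, hpA, hp⟩ := hex
  simp only [mem_union, not_or] at hp
  obtain ⟨⟨⟨h1, h2⟩, h3⟩, h4⟩ := hp
  refine ⟨j, Λ.shift i j + (Λ.base i.2 y j + b), ⟨b, (mem_product.1 (hA ▸ hpA)).2, rfl⟩,
    ?_, ?_, ?_, ?_⟩
  · by_contra h5
    exact h3 (mem_filter.2 ⟨hpA, not_lt.1 h5⟩)
  · by_contra! h5
    exact h4 (mem_filter.2 ⟨hpA, h5⟩)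
  · exact fun h5 => h1 (mem_filter.2 ⟨hpA, h5⟩)
  · exact fun h5 => h2 (mem_filter.2 ⟨hpA, h5⟩)

/-- Three contributions of at most an eighth of the capacity: ordinary heavy requests, heavy
requests to clogged vertices (fewer than 4·2^h, where `hk'` enters), and light requests. -/
theorem Layout.Inv.block_count_lt (hσ : Λ.Inv σ) (z : V) (i : ReqType K H) (b)
    (hk : a + H + 20 ≤ i.1 + 42) (hk' : a + 2 * H + 5 ≤ i.1 + 42) :
    8 * (heavyBlockCount σ z i b + lightBlockCount σ z i b) < 3 * 2 ^ (i.1 + 42 - a - H) := by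
  obtain ⟨S, hS1, hS2⟩ := hσ.heavy_block z i b
  have h1 := hσ.card_clogged_lt z i hk S fun y hy => (hS2 y hy).1
  have h2 := hσ.light_block z i b
  have h3 : 8 * (4 * 2 ^ (i.2 : ℕ)) ≤ 2 ^ ((i.1 : ℕ) + 42 - a - H) := by
    calc 8 * (4 * 2 ^ (i.2 : ℕ)) = 2 ^ (5 + (i.2 : ℕ)) := by rw [pow_add]; ring
      _ ≤ _ := Nat.pow_le_pow_right (by norm_num) (by omega)
  omega

/-- Each endpoint occupies less than 3/8 of the slots, so together less than 3/4. -/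
theorem Layout.Inv.exists_slot (hσ : Λ.Inv σ) (x y : V) (i : ReqType K H) (b)
    (hk : a + H + 20 ≤ i.1 + 42) (hk' : a + 2 * H + 5 ≤ i.1 + 42) :
    ∃ s < 2 ^ (i.1 + 42 - a - H), ∀ m ∈ σ, (m.heavy = x ∨ m.light = x ∨ m.heavy = y ∨ m.light = y) →
      m.type = i → m.block = b → m.slot ≠ s := by
  classical
  let P : V → List (Placement V K a H) := fun z =>
    σ.filter (fun m => m.type = i ∧ m.heavy = z ∧ m.block = b) ++
      σ.filter (fun m => m.type = i ∧ m.light = z ∧ m.block = b)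
  have hP : ∀ z, 8 * (P z).length < 3 * 2 ^ ((i.1 : ℕ) + 42 - a - H) := by
    intro z
    have := hσ.block_count_lt z i b hk hk'
    rw [List.length_append, ← List.countP_eq_length_filter, ← List.countP_eq_length_filter]
    exact this
  let S : Finset ℕ := ((P x ++ P y).map fun m => m.slot).toFinset
  have hS : #S < 2 ^ ((i.1 : ℕ) + 42 - a - H) := by
    refine lt_of_le_of_lt (List.toFinset_card_le _) ?_
    rw [List.length_map, List.length_append]
    have h1 := hP x
    have h2 := hP y
    omega
  obtain ⟨s, hs1, hs2⟩ := exists_mem_notMem_of_card_lt_card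
    (show #S < #(range (2 ^ ((i.1 : ℕ) + 42 - a - H))) by rwa [card_range])
  refine ⟨s, mem_range.1 hs1, fun m hm hz hi hb hs => hs2 ?_⟩
  simp only [S, P, List.mem_toFinset, List.mem_map, List.mem_append, List.mem_filter,
    decide_eq_true_eq]
  refine ⟨m, ?_, hs⟩
  tauto

/-- The stage is the least one whose cap exceeds the degree of the heavy endpoint. As the light
endpoint has no larger degree, it respects the same cap. -/
theorem Layout.Inv.exists_placement (hσ : Λ.Inv σ) (x y : V) (k : K) (R : ℕ)
    (hK : ∀ k ∈ K, a + H + 20 ≤ k + 42 ∧ a + 2 * H + 5 ≤ k + 42 ∧ k ≤ R)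
    (hL : #K * (H + 2) * 2 ^ 18 ≤ 2 ^ H)
    (hnew : ∀ m ∈ σ, m.type.1 = k → m.heavy = x → m.light ≠ y)
    (hx : placementLoad R σ x + 2 ^ (R - k) ≤ 2 ^ (R + 1))
    (hy : placementLoad R σ y + 2 ^ (R - k) ≤ 2 ^ (R + 1))
    (hdeg : levelDegree σ y k ≤ levelDegree σ x k) :
    ∃ m : Placement V K a H, m.heavy = x ∧ m.light = y ∧ m.type.1 = k ∧
      m.slot < 2 ^ (k + 42 - a - H) ∧ Λ.Inv (m :: σ) ∧
      ∀ m' ∈ σ, (m'.heavy = x ∨ m'.light = x ∨ m'.heavy = y ∨ m'.light = y) →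
        m'.block ≠ m.block ∨ (m'.type = m.type ∧ m'.slot ≠ m.slot) := by
  classical
  obtain ⟨hk1, hk2, hk3⟩ := hK k k.2
  have hKH : ∀ k ∈ K, H ≤ k + 22 ∧ k ≤ R := fun k hk => ⟨by have := hK k hk; omega, (hK k hk).2.2⟩
  -- The load bound gives degree below 2^(k+1), so a stage up to `H` suffices.
  have hdx : levelDegree σ x k < stageCap H k H := by
    have h1 := (single_le_sum (f := fun k => levelDegree σ x k * 2 ^ (R - k))
      (fun _ _ => Nat.zero_le _) k.2).trans (sum_levelDegree_le R σ x)
    have h2 : levelDegree σ x k * 2 ^ (R - k) < 2 ^ ((k : ℕ) + 1) * 2 ^ (R - k) := by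
      rw [← pow_add, show (k : ℕ) + 1 + (R - k) = R + 1 by omega]
      have : 0 < 2 ^ (R - (k : ℕ)) := by positivity
      omega
    refine lt_of_lt_of_le (Nat.lt_of_mul_lt_mul_right h2) ?_
    exact Nat.pow_le_pow_right (by norm_num) (by omega)
  have hex : ∃ h, levelDegree σ x k < stageCap H k h := ⟨H, hdx⟩
  set h := Nat.find hex with hh
  have hhH : h ≤ H := Nat.find_min' hex hdx
  have hlt : levelDegree σ x k < stageCap H k h := Nat.find_spec hex
  have hst : h = 0 ∨ stageCap H k (h - 1) ≤ levelDegree σ x k := by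
    rcases Nat.eq_zero_or_pos h with h0 | h0
    · exact Or.inl h0
    · exact Or.inr (not_lt.1 (Nat.find_min hex (by omega)))
  let i : ReqType K H := (k, ⟨h, by omega⟩)
  have hly : lightCount σ y i < stageCap H i.1 i.2 :=
    ((lightCount_le_levelDegree σ y i).trans hdeg).trans_lt hlt
  have hhx : heavyCount σ x i < stageCap H i.1 i.2 := (heavyCount_le_levelDegree σ x i).trans_lt hlt
  obtain ⟨j, g, hreg, hlb, hhb, hfx, hfy⟩ := Λ.exists_block σ x y i hk1
    (hσ.profile_weight R x hKH hL ((Nat.le_add_right _ _).trans hx))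
    (hσ.profile_weight R y hKH hL ((Nat.le_add_right _ _).trans hy)) hly
  obtain ⟨s, hs1, hs2⟩ := hσ.exists_slot x y i (j, g) hk1 hk2
  refine ⟨⟨x, y, i, (j, g), s⟩, rfl, rfl, rfl, hs1, ?_, ?_⟩
  · refine hσ.cons _ (fun m' hm' h1 h2 h3 => hnew m' hm' ?_ h1 h2) hhx hly hst hreg ?_ hlb hhb
    · rw [h3]
    · change 3 ≤ (k : ℕ) + 42 - a - H
      omega
  · intro m' hm' hinc
    by_cases hb : m'.block = (j, g)
    · right
      -- An earlier request of another type at `x` or `y` would put this block into a foreign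
      -- region, which the choice of the block excludes.
      have htype : m'.type = i := by
        by_contra hne
        have h1 : m'.block.1 = j := by rw [hb]
        have h2 : m'.block.2 = g := by rw [hb]
        rcases (by tauto : (m'.heavy = x ∨ m'.light = x) ∨ (m'.heavy = y ∨ m'.light = y))
          with hz | hz
        · have := hσ.mem_foreignRegion hm' hz hne
          rw [h1, h2] at this
          exact hfx this
        · have := hσ.mem_foreignRegion hm' hz hne
          rw [h1, h2] at this
          exact hfy this
      exact ⟨htype, hs2 m' hm' hinc htype hb⟩
    · exact Or.inl hb

end Step

/-! ### The game on strings and its winning strategy -/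

/-- A request `((x, y), k)` for a program of length about `k` that exchanges `x` and `y`. -/
abbrev Request : Type := (BitString × BitString) × ℕ

/-- A finite list of requests with the assigned programs. -/
abbrev GameState : Type := List (Request × BitString)

/-- The request has the endpoint `z`. -/
def Touches (z : BitString) (r : Request) : Prop := r.1.1 = z ∨ r.1.2 = z

instance (z : BitString) (r : Request) : Decidable (Touches z r) :=
  inferInstanceAs (Decidable (_ ∨ _))

/-- The total weight (in units `2 ^ (-R)`) of the answered requests at `z`. -/
def stateLoad (R : ℕ) (s : GameState) (z : BitString) : ℕ :=
  (s.map fun e => if Touches z e.1 then 2 ^ (R - e.1.2) else 0).sum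

/-- A request between strings of length `n` of a level allowed by `A` that respects the bound on
the weights. -/
def Legal (A : ℕ → ℕ → Prop) (n : ℕ) (s : GameState) (r : Request) : Prop :=
  r.1.1.length = n ∧ r.1.2.length = n ∧ Encodable.encode r.1.1 < Encodable.encode r.1.2 ∧
    A n r.2 ∧ r.2 ≤ 2 * n ∧ r ∉ s.map Prod.fst ∧
    stateLoad (2 * n) s r.1.1 + 2 ^ (2 * n - r.2) ≤ 2 ^ (2 * n + 1) ∧
    stateLoad (2 * n) s r.1.2 + 2 ^ (2 * n - r.2) ≤ 2 ^ (2 * n + 1)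

/-- `p` is an admissible answer to the request `r`. -/
def Answers (s : GameState) (r : Request) (p : BitString) : Prop :=
  p.length = r.2 + 42 ∧
    ∀ e ∈ s, (Touches r.1.1 e.1 ∨ Touches r.1.2 e.1) → ¬ p <+: e.2 ∧ ¬ e.2 <+: p

/-- All legal requests can be answered online. -/
def Winnable (A : ℕ → ℕ → Prop) (n : ℕ) : Prop :=
  ∃ good : GameState → Prop, good [] ∧
    ∀ s, good s → ∀ r, Legal A n s r → ∃ p, Answers s r p ∧ good ((r, p) :: s)

/-- The `L` lowest binary digits. -/
def binaryWord (L s : ℕ) : BitString := List.ofFn fun i : Fin L => s.testBit i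

@[simp] theorem length_binaryWord (L s : ℕ) : (binaryWord L s).length = L := by
  simp [binaryWord]

theorem binaryWord_inj {L s s' : ℕ} (hs : s < 2 ^ L) (hs' : s' < 2 ^ L)
    (h : binaryWord L s = binaryWord L s') : s = s' := by
  refine Nat.eq_of_testBit_eq fun i => ?_
  by_cases hi : i < L
  · exact congrFun (List.ofFn_injective h) ⟨i, hi⟩
  · have hle : 2 ^ L ≤ 2 ^ i := Nat.pow_le_pow_right (by norm_num) (by omega)
    rw [Nat.testBit_lt_two_pow (hs.trans_le hle), Nat.testBit_lt_two_pow (hs'.trans_le hle)]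

theorem exists_blockWord (a H : ℕ) : ∃ w : Fin (2 ^ a) × Col H → BitString,
    Function.Injective w ∧ ∀ b, (w b).length = a + H := by
  have hc : Fintype.card (Fin (2 ^ a) × Col H) = 2 ^ (a + H) := by simp [pow_add]
  refine ⟨fun b => binaryWord (a + H) (Fintype.equivFinOfCardEq hc b), fun b b' h => ?_, by simp⟩
  exact (Fintype.equivFinOfCardEq hc).injective (Fin.ext (binaryWord_inj (Fin.is_lt _)
    (Fin.is_lt _) h))

/-- The program encoded by a placement. -/
def placementWord {V : Type} {K : Finset ℕ} {a H : ℕ} (w : Fin (2 ^ a) × Col H → BitString)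
    (m : Placement V K a H) : BitString :=
  w m.block ++ binaryWord (m.type.1 + 42 - a - H) m.slot

/-- Block parts have a common length, so comparable words share their block; then the types agree,
the words have equal length, and the slots differ. -/
theorem placementWord_not_prefix {V : Type} {K : Finset ℕ} {a H : ℕ}
    {w : Fin (2 ^ a) × Col H → BitString} (hw : Function.Injective w)
    (hl : ∀ b, (w b).length = a + H) {m m' : Placement V K a H}
    (hm : m.slot < 2 ^ (m.type.1 + 42 - a - H)) (hm' : m'.slot < 2 ^ (m'.type.1 + 42 - a - H))
    (h : m'.block ≠ m.block ∨ (m'.type = m.type ∧ m'.slot ≠ m.slot)) :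
    ¬ placementWord w m <+: placementWord w m' := by
  intro hp
  have hblock : w m.block = w m'.block := by
    have h1 : w m.block <+: placementWord w m' := (List.prefix_append _ _).trans hp
    have h2 : w m'.block <+: placementWord w m' := List.prefix_append _ _
    exact (List.prefix_of_prefix_length_le h1 h2 (by rw [hl, hl])).eq_of_length (by rw [hl, hl])
  rcases h with h | ⟨h1, h2⟩
  · exact h (hw hblock).symm
  · have heq := hp.eq_of_length (by simp [placementWord, hl, h1])
    unfold placementWord at heq
    rw [hblock] at heq
    have h3 := List.append_cancel_left heq
    rw [h1] at h3 hm'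
    exact h2 (binaryWord_inj hm hm' h3).symm

/-- The placement represents the answered request. -/
def Represents {n : ℕ} {K : Finset ℕ} {a H : ℕ} (w : Fin (2 ^ a) × Col H → BitString)
    (e : Request × BitString) (m : Placement (List.Vector Bool n) K a H) : Prop :=
  (e.1.1 = (m.heavy.toList, m.light.toList) ∨ e.1.1 = (m.light.toList, m.heavy.toList)) ∧
    Encodable.encode e.1.1.1 < Encodable.encode e.1.1.2 ∧ e.1.2 = m.type.1 ∧
    m.slot < 2 ^ (m.type.1 + 42 - a - H) ∧ e.2 = placementWord w m

theorem Represents.touches_iff {n : ℕ} {K : Finset ℕ} {a H : ℕ}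
    {w : Fin (2 ^ a) × Col H → BitString} {e : Request × BitString}
    {m : Placement (List.Vector Bool n) K a H} (h : Represents w e m) (z : List.Vector Bool n) :
    Touches z.toList e.1 ↔ m.heavy = z ∨ m.light = z := by
  rw [Touches, ← List.Vector.toList_injective.eq_iff, ← List.Vector.toList_injective.eq_iff]
  rcases h.1 with h | h <;> rw [h]
  exact or_comm

theorem stateLoad_eq_placementLoad {n : ℕ} {K : Finset ℕ} {a H : ℕ}
    {w : Fin (2 ^ a) × Col H → BitString} {s : GameState}
    {σ : List (Placement (List.Vector Bool n) K a H)} (h : List.Forall₂ (Represents w) s σ) (R : ℕ)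
    (z : List.Vector Bool n) : stateLoad R s z.toList = placementLoad R σ z := by
  induction h with
  | nil => rfl
  | cons h1 _ ih =>
    rw [placementLoad_cons, ← ih, stateLoad, List.map_cons, List.sum_cons, ← stateLoad, h1.2.2.1]
    simp only [h1.touches_iff z]

/-- The good states are those represented by a list of placements satisfying the invariant. At each
request the endpoint of larger level degree becomes heavy. -/
theorem winnable_of_parameters (A : ℕ → ℕ → Prop) (n a H : ℕ) (K : Finset ℕ)
    (hAK : ∀ k, A n k → k ≤ 2 * n → k ∈ K) (ha : 2 ≤ a)
    (hK : ∀ k ∈ K, a + H + 20 ≤ k + 42 ∧ a + 2 * H + 5 ≤ k + 42 ∧ k ≤ 2 * n)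
    (hL : #K * (H + 2) * 2 ^ 18 ≤ 2 ^ H) (hn : 2 ^ n * (H + 1) ≤ 2 ^ 2 ^ (a - 1))
    (hcard : 2 ^ n * 2 ^ n * (H + 2) ^ (#K * (H + 1)) * (#K * (H + 1)) * (H + 1) < 2 ^ 2 ^ a) :
    Winnable A n := by
  classical
  obtain ⟨Λ⟩ := exists_layout (List.Vector Bool n) K a H n (by simp) ha hn hcard
  obtain ⟨w, hw, hwl⟩ := exists_blockWord a H
  refine ⟨fun s => ∃ σ, Λ.Inv σ ∧ List.Forall₂ (Represents w) s σ, ⟨[], Λ.inv_nil, .nil⟩, ?_⟩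
  rintro s ⟨σ, hσ, hsσ⟩ ⟨⟨x, y⟩, k⟩ ⟨hxn, hyn, hxy, hA, hk, hnew, hlx, hly⟩
  simp only at hxn hyn hxy hA hk hnew hlx hly
  let x' : List.Vector Bool n := ⟨x, hxn⟩
  let y' : List.Vector Bool n := ⟨y, hyn⟩
  let k' : K := ⟨k, hAK k hA hk⟩
  rw [show x = x'.toList from rfl, stateLoad_eq_placementLoad hsσ] at hlx
  rw [show y = y'.toList from rfl, stateLoad_eq_placementLoad hsσ] at hly
  have hold : ∀ m ∈ σ, ∃ e ∈ s, Represents w e m := by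
    intro m hm
    obtain ⟨i, hi, rfl⟩ := List.getElem_of_mem hm
    exact ⟨s[i]'(by rw [hsσ.length_eq]; exact hi), List.getElem_mem _, hsσ.get _ _⟩
  have hold' : ∀ e ∈ s, ∃ m ∈ σ, Represents w e m := by
    intro e he
    obtain ⟨i, hi, rfl⟩ := List.getElem_of_mem he
    exact ⟨σ[i]'(by rw [← hsσ.length_eq]; exact hi), List.getElem_mem _, hsσ.get _ _⟩
  have hnewσ : ∀ m ∈ σ, m.type.1 = k' → ¬ (m.heavy = x' ∧ m.light = y') ∧
      ¬ (m.heavy = y' ∧ m.light = x') := by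
    intro m hm hmk
    obtain ⟨e, he, h1, h2, h3, -⟩ := hold m hm
    have hek : e.1.2 = k := by rw [h3, hmk]
    have hmain : ¬ (e.1.1 = (x, y)) ∧ ¬ (e.1.1 = (y, x)) := by
      constructor
      · intro h
        exact hnew (List.mem_map.2 ⟨e, he, Prod.ext h hek⟩)
      · intro h
        rw [h] at h2
        exact lt_asymm h2 hxy
    constructor
    · rintro ⟨h4, h5⟩
      rw [h4, h5] at h1
      exact h1.elim hmain.1 hmain.2
    · rintro ⟨h4, h5⟩
      rw [h4, h5] at h1
      exact h1.elim hmain.2 hmain.1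
  have hex : ∃ m : Placement (List.Vector Bool n) K a H,
      ((x, y) = (m.heavy.toList, m.light.toList) ∨ (x, y) = (m.light.toList, m.heavy.toList)) ∧
      m.type.1 = k' ∧
      m.slot < 2 ^ (k + 42 - a - H) ∧ Λ.Inv (m :: σ) ∧
      ∀ m' ∈ σ, (m'.heavy = x' ∨ m'.light = x' ∨ m'.heavy = y' ∨ m'.light = y') →
        m'.block ≠ m.block ∨ (m'.type = m.type ∧ m'.slot ≠ m.slot) := by
    rcases le_total (levelDegree σ y' k') (levelDegree σ x' k') with hd | hd
    · obtain ⟨m, h1, h2, h3, h4, h5, h6⟩ := hσ.exists_placement x' y' k' (2 * n) hK hL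
        (fun m hm h1 h2 h3 => (hnewσ m hm h1).1 ⟨h2, h3⟩) hlx hly hd
      exact ⟨m, Or.inl (by rw [h1, h2]; rfl), h3, h4, h5, h6⟩
    · obtain ⟨m, h1, h2, h3, h4, h5, h6⟩ := hσ.exists_placement y' x' k' (2 * n) hK hL
        (fun m hm h1 h2 h3 => (hnewσ m hm h1).2 ⟨h2, h3⟩) hly hlx hd
      exact ⟨m, Or.inr (by rw [h1, h2]; rfl), h3, h4, h5, fun m' hm' h => h6 m' hm' (by tauto)⟩
  obtain ⟨m, h1, h2, h3, h4, h5⟩ := hex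
  have hmk : ((m.type.1 : K) : ℕ) = k := by rw [h2]
  obtain ⟨hb1, hb2, hb3⟩ := hK k (hAK k hA hk)
  have hslot : m.slot < 2 ^ (m.type.1 + 42 - a - H) := by rwa [hmk]
  refine ⟨placementWord w m, ⟨?_, ?_⟩, m :: σ, h4, .cons ⟨h1, hxy, hmk.symm, hslot, rfl⟩ hsσ⟩
  · simp only [placementWord, List.length_append, hwl, length_binaryWord, hmk]
    omega
  · intro e he htouch
    obtain ⟨m', hm', hrep⟩ := hold' e he
    have hcon := h5 m' hm' (by
      rcases htouch with ht | ht
      · exact ((hrep.touches_iff x').1 ht).imp id Or.inl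
      · exact Or.inr (Or.inr ((hrep.touches_iff y').1 ht)))
    rw [hrep.2.2.2.2]
    exact ⟨placementWord_not_prefix hw hwl hslot hrep.2.2.2.1 hcon,
      placementWord_not_prefix hw hwl hrep.2.2.2.1 hslot
        (hcon.imp Ne.symm fun h => ⟨h.1.symm, h.2.symm⟩)⟩

/-! ### Choice of parameters -/

theorem winnable_of_exponents (A : ℕ → ℕ → Prop) (n a H m j : ℕ) (K : Finset ℕ)
    (hAK : ∀ k, A n k → k ≤ 2 * n → k ∈ K) (ha : 2 ≤ a)
    (hK : ∀ k ∈ K, a + H + 20 ≤ k + 42 ∧ a + 2 * H + 5 ≤ k + 42 ∧ k ≤ 2 * n)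
    (hm : #K ≤ 2 ^ m) (hj : H + 2 ≤ 2 ^ j) (hL : m + j + 18 ≤ H) (hn : n + j ≤ 2 ^ (a - 1))
    (hcard : 2 * n + j * 2 ^ (m + j) + m + 2 * j < 2 ^ a) : Winnable A n := by
  refine winnable_of_parameters A n a H K hAK ha hK ?_ ?_ ?_
  · calc #K * (H + 2) * 2 ^ 18 ≤ 2 ^ m * 2 ^ j * 2 ^ 18 := by gcongr
      _ = 2 ^ (m + j + 18) := by rw [pow_add, pow_add]
      _ ≤ 2 ^ H := Nat.pow_le_pow_right two_pos hL
  · calc 2 ^ n * (H + 1) ≤ 2 ^ n * 2 ^ j := by gcongr; omega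
      _ = 2 ^ (n + j) := by rw [pow_add]
      _ ≤ _ := Nat.pow_le_pow_right two_pos hn
  · have h1 : #K * (H + 1) ≤ 2 ^ (m + j) := by
      rw [pow_add]
      exact Nat.mul_le_mul hm (by omega)
    calc 2 ^ n * 2 ^ n * (H + 2) ^ (#K * (H + 1)) * (#K * (H + 1)) * (H + 1)
        ≤ 2 ^ n * 2 ^ n * (2 ^ j) ^ (2 ^ (m + j)) * 2 ^ (m + j) * 2 ^ j := by
          gcongr
          · exact Nat.one_le_two_pow
          · omega
      _ = 2 ^ (2 * n + j * 2 ^ (m + j) + m + 2 * j) := by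
          rw [← pow_mul, ← pow_add, ← pow_add, ← pow_add, ← pow_add]
          congr 1
          ring
      _ < _ := Nat.pow_lt_pow_right one_lt_two hcard

/-- Levels between `129 / 128 * log n` and `4 * log n`. -/
def LowLevel (n k : ℕ) : Prop := n ^ 129 ≤ 2 ^ (128 * k) ∧ 2 ^ k < n ^ 4

/-- Levels from `4 * log n` on. -/
def HighLevel (n k : ℕ) : Prop := n ^ 4 ≤ 2 ^ k

instance : DecidableRel LowLevel := fun _ _ => inferInstanceAs (Decidable (_ ∧ _))
instance : DecidableRel HighLevel := fun _ _ => inferInstanceAs (Decidable (_ ≤ _))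

theorem mul_le_two_pow {c u₀ : ℕ} (hu₀ : 1 ≤ u₀) (h₀ : c * u₀ ≤ 2 ^ u₀) {u : ℕ} (hu : u₀ ≤ u) :
    c * u ≤ 2 ^ u := by
  induction u, hu using Nat.le_induction with
  | base => exact h₀
  | succ v hv ih => rw [pow_succ]; nlinarith

/-- There are up to 2n + 1 levels, so `H` must exceed l = log n. With a = H = l + 4u and u = l/16,
the sum a + 2H is about 3.75 l, within the 4 l available. -/
theorem winnable_highLevel (n : ℕ) (hn : 256 ≤ Nat.log 2 n) : Winnable HighLevel n := by
  set l := Nat.log 2 n with hl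
  have hn0 : n ≠ 0 := by rintro rfl; simp at hl; omega
  have h1 : 2 ^ l ≤ n := Nat.pow_log_le_self 2 hn0
  have h2 : n < 2 ^ (l + 1) := Nat.lt_pow_succ_log_self one_lt_two n
  have hlsmall := mul_le_two_pow (c := 2) (by norm_num) (by norm_num) hn
  obtain ⟨u, hu⟩ : ∃ u, u = l / 16 := ⟨_, rfl⟩
  have hu16 : 16 ≤ u := by omega
  have hu32 := mul_le_two_pow (c := 64) (by norm_num) (by norm_num) hu16
  have hbig : 2 ^ u * 2 ^ 16 ≤ 2 ^ u * 2 ^ u := by gcongr; norm_num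
  have hP : 2 * 2 ^ (l + 1) + 2 ^ (l + 3 * u + 2) + 2 * 2 ^ l ≤ 2 ^ (l + 4 * u - 1) := by
    calc _ ≤ 2 ^ (l + 3 * u + 2) + 2 ^ (l + 3 * u + 2) + 2 ^ (l + 3 * u + 3) := by
          rw [mul_comm 2, ← pow_succ, mul_comm 2, ← pow_succ]
          gcongr <;> omega
      _ = 2 ^ (l + 3 * u + 4) := by ring
      _ ≤ _ := Nat.pow_le_pow_right two_pos (by omega)
  refine winnable_of_exponents HighLevel n (l + 4 * u) (l + 4 * u) (l + 2) (2 * u)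
    ((range (2 * n + 1)).filter (HighLevel n)) ?_ (by omega) ?_ ?_ ?_ (by omega) ?_ ?_
  · intro k hk hkn
    simp [hk]; omega
  · intro k hk
    simp only [mem_filter, mem_range] at hk
    have h3 : 4 * l ≤ k := by
      rw [← Nat.pow_le_pow_iff_right (a := 2) one_lt_two]
      calc 2 ^ (4 * l) = (2 ^ l) ^ 4 := by rw [← pow_mul, mul_comm]
        _ ≤ n ^ 4 := by gcongr
        _ ≤ _ := hk.2
    omega
  · refine (card_filter_le _ _).trans ?_
    rw [card_range]
    rw [pow_succ] at h2 ⊢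
    rw [pow_succ]
    omega
  · rw [mul_comm 2 u, mul_two u, pow_add]
    have : l ≤ 16 * u + 15 := by omega
    linarith
  · have := Nat.zero_le (2 ^ (l + 3 * u + 2))
    omega
  · have h4 : 2 * u * 2 ^ (l + 2 + 2 * u) ≤ 2 ^ (l + 3 * u + 2) := by
      calc 2 * u * 2 ^ (l + 2 + 2 * u) ≤ 2 ^ u * 2 ^ (l + 2 + 2 * u) := by gcongr; omega
        _ = _ := by rw [← pow_add]; congr 1; ring
    have h5 : 2 ^ (l + 4 * u - 1) < 2 ^ (l + 4 * u) := Nat.pow_lt_pow_right one_lt_two (by omega)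
    omega

/-- Only about 4 log n levels occur, so H = 4u with u = l/1024 is enough. Then a + 2H = l + 3 + 8u
exceeds l by about l/128, which is where the ratio 129/128 in `LowLevel` comes from. -/
theorem winnable_lowLevel (n : ℕ) (hn : 32768 ≤ Nat.log 2 n) : Winnable LowLevel n := by
  set l := Nat.log 2 n with hl
  have hn0 : n ≠ 0 := by rintro rfl; simp at hl; omega
  have h1 : 2 ^ l ≤ n := Nat.pow_log_le_self 2 hn0
  have h2 : n < 2 ^ (l + 1) := Nat.lt_pow_succ_log_self one_lt_two n
  obtain ⟨u, hu⟩ : ∃ u, u = l / 1024 := ⟨_, rfl⟩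
  have hu32 : 32 ≤ u := by omega
  have hu' := mul_le_two_pow (c := 8192) (by norm_num) (by norm_num) hu32
  have hl2 : 2 ^ (l + 1) = 2 * 2 ^ l := by rw [pow_succ, mul_comm]
  have hl3 : 2 ^ (l + 3) = 8 * 2 ^ l := by rw [pow_add, mul_comm]; norm_num
  have h4 : 2 ^ (3 * u) ≤ 2 ^ l := Nat.pow_le_pow_right two_pos (by omega)
  have h5 : u * 2 ^ (u + u) ≤ 2 ^ (3 * u) := by
    calc u * 2 ^ (u + u) ≤ 2 ^ u * 2 ^ (u + u) := by gcongr; omega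
      _ = _ := by rw [← pow_add]; congr 1; ring
  have h6 : 2 ^ u ≤ 2 ^ (3 * u) := Nat.pow_le_pow_right two_pos (by omega)
  refine winnable_of_exponents LowLevel n (l + 3) (4 * u) u u
    ((range (2 * n + 1)).filter (LowLevel n)) ?_ (by omega) ?_ ?_ ?_ (by omega) ?_ ?_
  · intro k hk hkn
    simp [hk]; omega
  · intro k hk
    simp only [mem_filter, mem_range] at hk
    have h3 : 129 * l ≤ 128 * k := by
      rw [← Nat.pow_le_pow_iff_right (a := 2) one_lt_two]
      calc 2 ^ (129 * l) = (2 ^ l) ^ 129 := by rw [← pow_mul, mul_comm]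
        _ ≤ n ^ 129 := by gcongr
        _ ≤ _ := hk.2.1
    omega
  · have hsub : (range (2 * n + 1)).filter (LowLevel n) ⊆ range (4 * (l + 1)) := by
      intro k hk
      simp only [mem_filter, mem_range] at hk ⊢
      rw [← Nat.pow_lt_pow_iff_right (a := 2) one_lt_two]
      calc 2 ^ k < n ^ 4 := hk.2.2
        _ ≤ (2 ^ (l + 1)) ^ 4 := by gcongr
        _ = _ := by rw [← pow_mul, mul_comm]
    refine (card_le_card hsub).trans ?_
    rw [card_range]
    omega
  · omega
  · rw [show l + 3 - 1 = l + 2 from rfl, pow_add]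
    omega
  · omega

/-! ### Primitive recursive predicates and machines -/

section PrimitiveRecursion

variable {α β σ : Type} [Primcodable α] [Primcodable β] [Primcodable σ]

theorem PrimrecPred.exists_mem {f : α → List β} {R : α → β → Prop} (hf : Primrec f)
    (hR : PrimrecPred fun a : α × β => R a.1 a.2) : PrimrecPred fun a => ∃ b ∈ f a, R a b :=
  (PrimrecRel.exists_mem_list (R := fun b a => R a b)
    (hR.comp (Primrec.pair Primrec.snd Primrec.fst))).comp hf Primrec.id

theorem PrimrecPred.forall_mem {f : α → List β} {R : α → β → Prop} (hf : Primrec f)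
    (hR : PrimrecPred fun a : α × β => R a.1 a.2) : PrimrecPred fun a => ∀ b ∈ f a, R a b :=
  (PrimrecRel.forall_mem_list (R := fun b a => R a b)
    (hR.comp (Primrec.pair Primrec.snd Primrec.fst))).comp hf Primrec.id

theorem PrimrecPred.exists_lt_of {f : α → ℕ} {R : α → ℕ → Prop} (hf : Primrec f)
    (hR : PrimrecPred fun a : α × ℕ => R a.1 a.2) : PrimrecPred fun a => ∃ b < f a, R a b :=
  (PrimrecPred.exists_mem (Primrec.list_range.comp hf) hR).of_eq fun a => by
    simp only [List.mem_range]

theorem PrimrecPred.forall_lt_of {f : α → ℕ} {R : α → ℕ → Prop} (hf : Primrec f)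
    (hR : PrimrecPred fun a : α × ℕ => R a.1 a.2) : PrimrecPred fun a => ∀ b < f a, R a b :=
  (PrimrecPred.forall_mem (Primrec.list_range.comp hf) hR).of_eq fun a => by
    simp only [List.mem_range]

theorem Primrec.nat_pow : Primrec₂ ((· ^ ·) : ℕ → ℕ → ℕ) :=
  Primrec₂.unpaired'.1 Nat.Primrec.pow

theorem Primrec.two_pow {f : α → ℕ} (hf : Primrec f) : Primrec fun a => 2 ^ f a :=
  Primrec.nat_pow.comp (Primrec.const 2) hf

theorem PrimrecPred.eq {f g : α → β} (hf : Primrec f) (hg : Primrec g) :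
    PrimrecPred fun a => f a = g a := by
  classical
  exact Primrec.eq.comp hf hg

theorem PrimrecPred.isPrefix {f g : α → List β} (hf : Primrec f) (hg : Primrec g) :
    PrimrecPred fun a => f a <+: g a :=
  (PrimrecPred.eq hf (Primrec.list_take.comp (Primrec.list_length.comp hf) hg)).of_eq
    fun _ => List.prefix_iff_eq_take.symm

theorem Primrec.list_sum {f : α → List ℕ} (hf : Primrec f) : Primrec fun a => (f a).sum :=
  (Primrec.list_foldr hf (Primrec.const 0)
    (h := fun _ b => b.1 + b.2) (Primrec.nat_add.comp (Primrec.fst.comp Primrec.snd)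
      (Primrec.snd.comp Primrec.snd))).of_eq fun a => by rw [List.sum]

end PrimitiveRecursion

/-- A functional primitive recursive relation, projected along its first argument, is a machine. -/
theorem exists_machine (R : ℕ → BitString → BitString → BitString → Prop)
    (hR : PrimrecPred fun a : ℕ × BitString × BitString × BitString => R a.1 a.2.1 a.2.2.1 a.2.2.2)
    (hfun : ∀ m m' p x y y', R m p x y → R m' p x y' → y = y') :
    ∃ V : Machine, Partrec₂ V ∧ ∀ p x y, y ∈ V p x ↔ ∃ m, R m p x y := by
  classical
  -- Dovetailing: the index `i` codes a witness together with a candidate output.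
  let f : BitString × BitString → ℕ → Option BitString := fun a i =>
    (Encodable.decode i : Option (ℕ × BitString)).bind fun d =>
      if R d.1 a.1 a.2 d.2 then some d.2 else none
  have hf : Primrec₂ f := by
    refine Primrec.option_bind (Primrec.decode.comp Primrec.snd) (Primrec.ite ?_
      (Primrec.option_some.comp (Primrec.snd.comp Primrec.snd)) (Primrec.const none))
    exact hR.comp (f := fun a : ((BitString × BitString) × ℕ) × ℕ × BitString =>
      (a.2.1, a.1.1.1, a.1.1.2, a.2.2))
      (Primrec.pair (Primrec.fst.comp Primrec.snd) (Primrec.pair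
        (Primrec.fst.comp (Primrec.fst.comp Primrec.fst)) (Primrec.pair
          (Primrec.snd.comp (Primrec.fst.comp Primrec.fst)) (Primrec.snd.comp Primrec.snd))))
  have hmem : ∀ a i y, y ∈ f a i → ∃ m, R m a.1 a.2 y := by
    intro a i y h
    obtain ⟨d, -, hd⟩ := Option.bind_eq_some_iff.1 h
    split_ifs at hd with hr
    cases hd
    exact ⟨d.1, hr⟩
  refine ⟨fun p x => Nat.rfindOpt (f (p, x)), Partrec.rfindOpt hf.to_comp, fun p x y => ?_⟩
  constructor
  · intro h
    obtain ⟨i, hi⟩ := Nat.rfindOpt_spec h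
    exact hmem _ i y hi
  · rintro ⟨m, hm⟩
    have hdom : (Nat.rfindOpt (f (p, x))).Dom := by
      rw [Nat.rfindOpt_dom]
      refine ⟨Encodable.encode (m, y), y, ?_⟩
      simp [f, hm]
    obtain ⟨i, hi⟩ := Nat.rfindOpt_spec (Part.get_mem hdom)
    obtain ⟨m', hm'⟩ := hmem _ i _ hi
    rw [hfun _ _ _ _ _ _ hm hm']
    exact Part.get_mem hdom

/-- A machine is the projection of a primitive recursive relation. -/
theorem exists_enumeration (U : Machine) (hU : Partrec₂ U) :
    ∃ R : ℕ → BitString → BitString → BitString → Prop,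
      (PrimrecPred fun a : ℕ × BitString × BitString × BitString =>
        R a.1 a.2.1 a.2.2.1 a.2.2.2) ∧ ∀ p x y, y ∈ U p x ↔ ∃ t, R t p x y := by
  classical
  obtain ⟨c, hc⟩ := Nat.Partrec.Code.exists_code.1 hU
  refine ⟨fun t p x y => Nat.Partrec.Code.evaln t c (Encodable.encode (p, x)) =
    some (Encodable.encode y), ?_, fun p x y => ?_⟩
  · refine PrimrecPred.eq (Nat.Partrec.Code.primrec_evaln.comp (Primrec.pair (Primrec.pair
      Primrec.fst (Primrec.const c)) (Primrec.encode.comp (Primrec.pair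
        (Primrec.fst.comp Primrec.snd)
        (Primrec.fst.comp (Primrec.snd.comp Primrec.snd)))))) (Primrec.option_some.comp
        (Primrec.encode.comp (Primrec.snd.comp (Primrec.snd.comp Primrec.snd))))
  · have h : y ∈ U p x ↔ Encodable.encode y ∈ c.eval (Encodable.encode (p, x)) := by
      rw [hc]
      simp
    rw [h, Nat.Partrec.Code.evaln_complete]
    rfl

theorem iInf_length_le_iff {P : BitString → Prop} {k : ℕ} :
    (⨅ p : BitString, ⨅ _ : P p, (p.length : ℕ∞)) ≤ k ↔ ∃ p, P p ∧ p.length ≤ k := by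
  constructor
  · intro h
    by_contra! hcon
    have h1 : ((k + 1 : ℕ) : ℕ∞) ≤ ⨅ p : BitString, ⨅ _ : P p, (p.length : ℕ∞) :=
      le_iInf fun p => le_iInf fun hp => by exact_mod_cast hcon p hp
    have h2 := h1.trans h
    norm_cast at h2
    omega
  · rintro ⟨p, hp, hk⟩
    exact (iInf₂_le p hp).trans (by exact_mod_cast hk)

theorem condComplexity_le_iff {U : Machine} {x y : BitString} {k : ℕ} :
    condComplexity U y x ≤ k ↔ ∃ p, y ∈ U p x ∧ p.length ≤ k := iInf_length_le_iff

theorem dist₁_le_iff {U : Machine} {x y : BitString} {k : ℕ} :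
    dist₁ U x y ≤ k ↔ ∃ p, (y ∈ U p x ∧ x ∈ U p y) ∧ p.length ≤ k := iInf_length_le_iff

/-- A comparison of two extended numbers may be checked on finite upper bounds. -/
theorem le_add_of_forall_le {a b : ℕ∞} {c : ℕ} (h : ∀ k : ℕ, b ≤ k → a ≤ (k + c : ℕ)) :
    a ≤ b + c := by
  induction b using ENat.recTopCoe with
  | top => simp
  | coe k => exact_mod_cast h k le_rfl

/-! ### Kraft inequality and coherent machines -/

/-- Incomparable binary strings satisfy the Kraft inequality. -/
theorem kraft_inequality {ι : Type*} (T : Finset ι) (w : ι → BitString) (R : ℕ)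
    (hw : ∀ i ∈ T, ∀ j ∈ T, w i <+: w j → i = j) (hR : ∀ i ∈ T, (w i).length ≤ R) :
    ∑ i ∈ T, 2 ^ (R - (w i).length) ≤ 2 ^ R := by
  classical
  let E : ι → Finset (List.Vector Bool R) := fun i => univ.filter fun v => w i <+: v.toList
  have hcard : ∀ i ∈ T, 2 ^ (R - (w i).length) ≤ #(E i) := by
    intro i hi
    have h : #(univ : Finset (List.Vector Bool (R - (w i).length))) ≤ #(E i) := by
      refine card_le_card_of_injOn (fun v => ⟨w i ++ v.toList, by simp [hR i hi]⟩) ?_ ?_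
      · intro v _
        exact mem_filter.2 ⟨mem_univ _, List.prefix_append _ _⟩
      · intro v _ v' _ h
        exact List.Vector.toList_injective (List.append_cancel_left (congrArg Subtype.val h))
    simpa using h
  calc ∑ i ∈ T, 2 ^ (R - (w i).length) ≤ ∑ i ∈ T, #(E i) := sum_le_sum hcard
    _ = #(T.biUnion E) := by
        refine (card_biUnion fun i hi j hj hij => ?_).symm
        refine Finset.disjoint_left.2 fun v hv hv' => ?_
        rcases List.prefix_or_prefix_of_prefix (mem_filter.1 hv).2 (mem_filter.1 hv').2 with h | h
        · exact hij (hw i hi j hj h)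
        · exact hij (hw j hj i hi h).symm
    _ ≤ #(univ : Finset (List.Vector Bool R)) := card_le_card (subset_univ _)
    _ = 2 ^ R := by simp

/-- Programs that are comparable lead to the same value. -/
def Coherent (U : Machine) : Prop :=
  ∀ x p q y z : BitString, p <+: q → y ∈ U p x → z ∈ U q x → y = z

theorem IsPrefixFree.coherent {U : Machine} (hU : IsPrefixFree U) : Coherent U := by
  intro x p q y z hpq hy hz
  obtain rfl := hU.prefix_free x p q hpq (Part.dom_iff_mem.2 ⟨y, hy⟩) (Part.dom_iff_mem.2 ⟨z, hz⟩)
  exact Part.mem_unique hy hz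

theorem IsPrefixStable.coherent {U : Machine} (hU : IsPrefixStable U) : Coherent U :=
  fun x p q y _ hpq hy hz => Part.mem_unique (hU.prefix_stable x y p q hpq hy) hz

/-- The total weight of the upper bounds for the conditional complexities is at most two. -/
theorem Coherent.sum_le {U : Machine} (hU : Coherent U) (x : BitString)
    (T : Finset (BitString × ℕ)) (R : ℕ)
    (hT : ∀ e ∈ T, e.2 ≤ R ∧ ∃ p, e.1 ∈ U p x ∧ p.length ≤ e.2) :
    ∑ e ∈ T, 2 ^ (R - e.2) ≤ 2 ^ (R + 1) := by
  classical
  have hp : ∀ y : BitString, (∃ e ∈ T, e.1 = y) →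
      ∃ p, y ∈ U p x ∧ ∀ e ∈ T, e.1 = y → p.length ≤ e.2 := by
    rintro y ⟨e, he, rfl⟩
    obtain ⟨e', he', hmin⟩ := exists_min_image (T.filter fun e' => e'.1 = e.1) Prod.snd
      ⟨e, by simp [he]⟩
    rw [mem_filter] at he'
    obtain ⟨p, hp, hpl⟩ := (hT e' he'.1).2
    exact ⟨p, he'.2 ▸ hp, fun e'' h1 h2 => hpl.trans (hmin e'' (by simp [h1, h2]))⟩
  choose! P hP hPl using hp
  -- A fixed program for each value is followed by a unary code of the excess length. Different
  -- levels of one value thus get incomparable words, at the cost of one bit; hence the bound two.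
  let w : BitString × ℕ → BitString := fun e =>
    P e.1 ++ (List.replicate (e.2 - (P e.1).length) true ++ [false])
  have hwl : ∀ e ∈ T, (w e).length = e.2 + 1 := by
    intro e he
    have := hPl e.1 ⟨e, he, rfl⟩ e he rfl
    simp [w]
    omega
  have h := kraft_inequality T w (R + 1) ?_ ?_
  · refine le_trans (le_of_eq (sum_congr rfl fun e he => ?_)) h
    rw [hwl e he, Nat.add_sub_add_right]
  · intro e he e' he' hpre
    have h1 : e.1 = e'.1 := by
      rcases List.prefix_or_prefix_of_prefix ((List.prefix_append (P e.1) _).trans hpre)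
        (List.prefix_append (P e'.1) _) with h | h
      · exact hU x _ _ _ _ h (hP _ ⟨e, he, rfl⟩) (hP _ ⟨e', he', rfl⟩)
      · exact (hU x _ _ _ _ h (hP _ ⟨e', he', rfl⟩) (hP _ ⟨e, he, rfl⟩)).symm
    have hl := hPl e.1 ⟨e, he, rfl⟩ e he rfl
    have hl' := hPl e'.1 ⟨e', he', rfl⟩ e' he' rfl
    refine Prod.ext h1 ?_
    simp only [w] at hpre
    rw [← h1] at hpre hl'
    rw [List.prefix_append_right_inj] at hpre
    obtain ⟨r, hr⟩ := hpre
    have h2 := congrArg (fun l : List Bool => l[e.2 - (P e.1).length]?) hr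
    by_contra hne
    have h3 := congrArg List.length hr
    simp at h3
    have h4 : e.2 < e'.2 := by omega
    simp at h2
    rw [List.getElem?_append_left (by simp; omega), List.getElem?_replicate] at h2
    split_ifs at h2 with h5
    · simp at h2
  · intro e he
    rw [hwl e he]
    exact Nat.succ_le_succ (hT e he).1

/-! ### Kraft–Chaitin allocation -/

/-- The number with the given binary digits (the highest digit first). -/
def binaryValue (p : BitString) : ℕ := p.foldl (fun a b => 2 * a + b.toNat) 0

theorem binaryValue_append (p q : BitString) :
    binaryValue (p ++ q) = binaryValue p * 2 ^ q.length + binaryValue q := by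
  induction q using List.reverseRecOn with
  | nil => simp [binaryValue]
  | append_singleton q b ih =>
    have h (r : BitString) : binaryValue (r ++ [b]) = 2 * binaryValue r + b.toNat := by
      simp [binaryValue]
    rw [← List.append_assoc, h, h, ih, List.length_append, List.length_singleton, pow_succ]
    ring

theorem binaryValue_lt (p : BitString) : binaryValue p < 2 ^ p.length := by
  induction p using List.reverseRecOn with
  | nil => simp [binaryValue]
  | append_singleton p b ih =>
    have h1 : binaryValue [b] ≤ 1 := by cases b <;> decide
    rw [binaryValue_append, List.length_append, List.length_singleton, pow_succ]
    omega

theorem exists_binaryValue (L v : ℕ) (h : v < 2 ^ L) :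
    ∃ p : BitString, p.length = L ∧ binaryValue p = v := by
  induction L generalizing v with
  | zero => exact ⟨[], rfl, by simp at h; simp [binaryValue, h]⟩
  | succ L ih =>
    obtain ⟨p, hp, hv⟩ := ih (v / 2) (by rw [pow_succ] at h; omega)
    refine ⟨p ++ [v.testBit 0], by simp [hp], ?_⟩
    rw [binaryValue_append, hv, List.length_singleton, pow_one]
    have h2 : binaryValue [v.testBit 0] = v % 2 := by
      rw [Nat.testBit_zero]
      rcases Nat.mod_two_eq_zero_or_one v with h | h <;> rw [h] <;> rfl
    omega

theorem primrec_binaryValue : Primrec binaryValue := by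
  refine Primrec.list_foldl Primrec.id (Primrec.const 0)
    (h := fun _ (d : ℕ × Bool) => 2 * d.1 + d.2.toNat) (Primrec.nat_add.comp
      (Primrec.nat_mul.comp (Primrec.const 2) (Primrec.fst.comp Primrec.snd))
      ((Primrec.dom_bool Bool.toNat).comp (Primrec.snd.comp Primrec.snd)))

section Allocation

variable (acc : ℕ → Option (BitString × ℕ))

/-- The total weight of the requests before step `m`, in units `2 ^ (-m)`; a request of level `k`
has weight `2 ^ (-(k + 1))`. -/
def allocated : ℕ → ℕ
  | 0 => 0
  | m + 1 => 2 * allocated m + ((acc m).elim 0 fun e => 2 ^ (m - e.2))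

/-- The program `p` is the leftmost one available for the request of step `m`. -/
def Assigned (m : ℕ) (p y : BitString) : Prop :=
  ∃ k, acc m = some (y, k) ∧ p.length = k + 2 ∧
    allocated acc m * 2 ^ (k + 2) ≤ binaryValue p * 2 ^ m ∧
    binaryValue p * 2 ^ m < allocated acc m * 2 ^ (k + 2) + 2 ^ m

variable {acc}

theorem allocated_mono {m m' : ℕ} (h : m ≤ m') :
    allocated acc m * 2 ^ (m' - m) ≤ allocated acc m' := by
  induction m', h using Nat.le_induction with
  | base => simp
  | succ m' h ih =>
    rw [Nat.succ_sub h, pow_succ, allocated, ← mul_assoc]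
    omega

theorem allocated_eq_sum (hk : ∀ m e, acc m = some e → e.2 ≤ m) (M : ℕ) :
    allocated acc M = ∑ m ∈ range M, (acc m).elim 0 fun e => 2 ^ (M - (e.2 + 1)) := by
  induction M with
  | zero => rfl
  | succ M ih =>
    rw [allocated, sum_range_succ, ih, mul_sum]
    congr 1
    · refine sum_congr rfl fun m hm => ?_
      rcases h : acc m with - | e
      · rfl
      · have := hk m e h
        rw [mem_range] at hm
        simp only [Option.elim]
        rw [← pow_succ']
        congr 1
        omega
    · simp

/-- Without repetitions the requests form a set, so `Coherent.sum_le` applies; the weights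
2^(-(k+1)) absorb its factor two. -/
theorem allocated_le (hk : ∀ m e, acc m = some e → e.2 ≤ m)
    (hinj : ∀ m m' e, acc m = some e → acc m' = some e → m = m')
    {U : Machine} (hU : Coherent U) (x : BitString)
    (hacc : ∀ m e, acc m = some e → ∃ p, e.1 ∈ U p x ∧ p.length ≤ e.2) (M : ℕ) :
    allocated acc M ≤ 2 ^ M := by
  classical
  rw [allocated_eq_sum hk]
  rcases M with - | R
  · simp
  let S := (range (R + 1)).filter fun m => (acc m).isSome
  let T := S.image fun m => (acc m).getD ([], 0)
  have h1 : ∑ m ∈ range (R + 1), (acc m).elim 0 (fun e => 2 ^ (R + 1 - (e.2 + 1))) =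
      ∑ e ∈ T, 2 ^ (R - e.2) := by
    rw [sum_image, sum_filter]
    · refine sum_congr rfl fun m _ => ?_
      rcases acc m with - | e <;> simp
    · intro m hm m' hm' h
      simp only [S, coe_filter, Set.mem_ofPred_eq, Option.isSome_iff_exists] at hm hm'
      obtain ⟨-, e, he⟩ := hm
      obtain ⟨-, e', he'⟩ := hm'
      simp only [he, he', Option.getD_some] at h
      exact hinj _ _ _ he (h ▸ he')
  rw [h1]
  refine hU.sum_le x T R fun e he => ?_
  obtain ⟨m, hm, rfl⟩ := mem_image.1 he
  simp only [S, mem_filter, mem_range, Option.isSome_iff_exists] at hm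
  obtain ⟨hmR, e, he⟩ := hm
  rw [he]
  have := hk m e he
  exact ⟨by simp; omega, hacc m e he⟩

/-- The reserved interval has length 2^(-(k+1)), twice that of a program of length k + 2. Rounding
its left end up to a multiple of 2^(-(k+2)) therefore stays inside. -/
theorem exists_assigned (hA : ∀ M, allocated acc M ≤ 2 ^ M) {m k : ℕ} {y : BitString} (hk : k ≤ m)
    (h : acc m = some (y, k)) : ∃ p, Assigned acc m p y ∧ p.length = k + 2 := by
  have h1 := hA (m + 1)
  rw [allocated, h] at h1
  simp only [Option.elim] at h1
  have hpow : 2 ^ (m - k) * 2 ^ (k + 1) = 2 ^ (m + 1) := by rw [← pow_add]; congr 1; omega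
  have h2 : allocated acc m * 2 ^ (k + 2) + 2 * 2 ^ m ≤ 2 ^ (k + 2) * 2 ^ m := by
    have h3 := Nat.mul_le_mul_right (2 ^ (k + 1)) h1
    calc _ = (2 * allocated acc m + 2 ^ (m - k)) * 2 ^ (k + 1) := by
            rw [add_mul, hpow]; ring
      _ ≤ _ := h3
      _ = _ := by ring
  have hpos : 0 < 2 ^ m := by positivity
  set N := allocated acc m * 2 ^ (k + 2) with hN
  have h4 := Nat.div_add_mod (N + 2 ^ m - 1) (2 ^ m)
  have h5 := Nat.mod_lt (N + 2 ^ m - 1) hpos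
  set v := (N + 2 ^ m - 1) / 2 ^ m
  rw [mul_comm] at h4
  have hv : v < 2 ^ (k + 2) := by
    by_contra! hcon
    have := Nat.mul_le_mul_right (2 ^ m) hcon
    omega
  obtain ⟨p, hp, hpv⟩ := exists_binaryValue _ v hv
  exact ⟨p, ⟨k, h, hp, by rw [hpv]; omega, by rw [hpv]; omega⟩, hp⟩

/-- The dyadic interval of the earlier program ends before that of the later one begins, and
comparable strings have nested intervals. -/
theorem Assigned.not_comparable {m m' : ℕ} {p q y z : BitString}
    (hk : ∀ m e, acc m = some e → e.2 ≤ m) (h : Assigned acc m p y) (h' : Assigned acc m' q z)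
    (hm : m < m') : ¬ p <+: q ∧ ¬ q <+: p := by
  obtain ⟨k, h1, h2, h3, h4⟩ := h
  obtain ⟨k', h1', h2', h3', h4'⟩ := h'
  have hkm := hk _ _ h1
  simp only at hkm
  have h5 : (2 * allocated acc m + 2 ^ (m - k)) * 2 ^ (m' - (m + 1)) ≤ allocated acc m' := by
    have := allocated_mono (acc := acc) (Nat.succ_le_of_lt hm)
    rw [Nat.succ_eq_add_one, allocated, h1] at this
    exact this
  have key : (binaryValue p + 1 : ℝ) / 2 ^ p.length ≤ binaryValue q / 2 ^ q.length := by
    have e1 : (binaryValue p : ℝ) * 2 ^ m < allocated acc m * 2 ^ (k + 2) + 2 ^ m := by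
      exact_mod_cast h4
    have e2 : (allocated acc m' : ℝ) * 2 ^ (k' + 2) ≤ binaryValue q * 2 ^ m' := by
      exact_mod_cast h3'
    have e3 : ((2 * allocated acc m + 2 ^ (m - k)) * 2 ^ (m' - (m + 1)) : ℝ) ≤
        allocated acc m' := by exact_mod_cast h5
    have e4 : (2 : ℝ) ^ (m - k) * 2 ^ (k + 2) = 4 * 2 ^ m := by
      rw [← pow_add, show m - k + (k + 2) = m + 2 by omega, pow_add]; ring
    have e5 : (2 : ℝ) ^ (m' - (m + 1)) * (2 * 2 ^ m) = 2 ^ m' := by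
      rw [← pow_succ', ← pow_add]; congr 1; omega
    have e6 : (binaryValue p + 1 : ℝ) * 2 ^ (k' + 2) * (2 ^ m * 2 ^ m') ≤
        binaryValue q * 2 ^ (k + 2) * (2 ^ m * 2 ^ m') := by
      calc (binaryValue p + 1 : ℝ) * 2 ^ (k' + 2) * (2 ^ m * 2 ^ m')
          = (binaryValue p * 2 ^ m + 2 ^ m) * (2 ^ (k' + 2) * 2 ^ m') := by ring
        _ ≤ ((allocated acc m * 2 ^ (k + 2) + 2 ^ m) + 2 ^ m) * (2 ^ (k' + 2) * 2 ^ m') := by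
            gcongr
        _ = ((2 * allocated acc m + 2 ^ (m - k)) * 2 ^ (m' - (m + 1))) *
              (2 ^ (k' + 2) * (2 ^ (k + 2) * 2 ^ m)) := by
            rw [← e5]; linear_combination (-(2 : ℝ) ^ (m' - (m + 1)) * 2 ^ (k' + 2) * 2 ^ m) * e4
        _ ≤ allocated acc m' * (2 ^ (k' + 2) * (2 ^ (k + 2) * 2 ^ m)) := by gcongr
        _ = allocated acc m' * 2 ^ (k' + 2) * (2 ^ (k + 2) * 2 ^ m) := by ring
        _ ≤ binaryValue q * 2 ^ m' * (2 ^ (k + 2) * 2 ^ m) := by gcongr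
        _ = _ := by ring
    rw [h2, h2', div_le_div_iff₀ (by positivity) (by positivity)]
    exact le_of_mul_le_mul_right e6 (by positivity)
  rw [div_le_div_iff₀ (by positivity) (by positivity)] at key
  have key' : (binaryValue p + 1) * 2 ^ q.length ≤ binaryValue q * 2 ^ p.length := by
    exact_mod_cast key
  constructor
  · rintro ⟨r, rfl⟩
    rw [binaryValue_append, List.length_append, pow_add] at key'
    have := binaryValue_lt r
    have h6 := Nat.mul_lt_mul_of_pos_right this (show 0 < 2 ^ p.length by positivity)
    nlinarith
  · rintro ⟨r, rfl⟩
    rw [binaryValue_append, List.length_append, pow_add] at key'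
    have : 0 < 2 ^ q.length := by positivity
    nlinarith [Nat.zero_le (binaryValue r * 2 ^ q.length)]

end Allocation

theorem exists_isPrefixFree_of_coherent {U : Machine} (hU : Partrec₂ U) (hc : Coherent U) :
    ∃ V, IsPrefixFree V ∧ ∀ x y, condComplexity V y x ≤ condComplexity U y x + (2 : ℕ) := by
  classical
  obtain ⟨R, hR, hRU⟩ := exists_enumeration U hU
  -- Step `m` codes a value, a level, a program and a running time. The condition that the level is
  -- at most `m` makes its weight an integer in units of 2^(-(m+1)).
  let cand : BitString → ℕ → Option (BitString × ℕ) := fun x m =>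
    (Encodable.decode m : Option ((BitString × ℕ) × BitString × ℕ)).bind fun d =>
      if R d.2.2 d.2.1 x d.1.1 ∧ d.2.1.length ≤ d.1.2 ∧ d.1.2 ≤ m then some d.1 else none
  let acc : BitString → ℕ → Option (BitString × ℕ) := fun x m =>
    if ∃ m' < m, cand x m' = cand x m then none else cand x m
  have hcand : ∀ x m e, cand x m = some e → e.2 ≤ m ∧ ∃ p, e.1 ∈ U p x ∧ p.length ≤ e.2 := by
    intro x m e h
    obtain ⟨d, -, hd⟩ := Option.bind_eq_some_iff.1 h
    split_ifs at hd with hr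
    cases hd
    exact ⟨hr.2.2, d.2.1, (hRU _ _ _).2 ⟨_, hr.1⟩, hr.2.1⟩
  have hacc : ∀ x m e, acc x m = some e → cand x m = some e ∧ ∀ m' < m, cand x m' ≠ some e := by
    intro x m e h
    simp only [acc] at h
    split_ifs at h with hcon
    refine ⟨h, fun m' hm' h' => hcon ⟨m', hm', h'.trans h.symm⟩⟩
  have hinj : ∀ x m m' e, acc x m = some e → acc x m' = some e → m = m' := by
    intro x m m' e h h'
    rcases lt_trichotomy m m' with hlt | rfl | hlt
    · exact absurd (hacc _ _ _ h).1 ((hacc _ _ _ h').2 m hlt)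
    · rfl
    · exact absurd (hacc _ _ _ h').1 ((hacc _ _ _ h).2 m' hlt)
  have hk : ∀ x m e, acc x m = some e → e.2 ≤ m := fun x m e h => (hcand _ _ _ (hacc _ _ _ h).1).1
  have hA : ∀ x M, allocated (acc x) M ≤ 2 ^ M := fun x M =>
    allocated_le (hk x) (hinj x) hc x (fun m e h => (hcand _ _ _ (hacc _ _ _ h).1).2) M
  have hstep : ∀ x m m' p q y z, Assigned (acc x) m p y → Assigned (acc x) m' q z → p <+: q →
      p = q ∧ y = z := by
    intro x m m' p q y z h h' hpq
    rcases lt_trichotomy m m' with hlt | rfl | hlt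
    · exact absurd hpq (h.not_comparable (hk x) h' hlt).1
    · obtain ⟨k, h1, h2, -⟩ := h
      obtain ⟨k', h1', h2', -⟩ := h'
      obtain ⟨rfl, rfl⟩ : y = z ∧ k = k' := by simpa using h1.symm.trans h1'
      exact ⟨hpq.eq_of_length (h2.trans h2'.symm), rfl⟩
    · exact absurd hpq (h'.not_comparable (hk x) h hlt).2
  have hcandP : Primrec₂ cand := by
    refine Primrec.option_bind (Primrec.decode.comp Primrec.snd) (Primrec.ite
      (PrimrecPred.and ?_ (PrimrecPred.and ?_ ?_))
      (Primrec.option_some.comp (Primrec.fst.comp Primrec.snd)) (Primrec.const none))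
    · exact hR.comp (f := fun a : (BitString × ℕ) × (BitString × ℕ) × BitString × ℕ =>
        (a.2.2.2, a.2.2.1, a.1.1, a.2.1.1)) (Primrec.pair
          (Primrec.snd.comp (Primrec.snd.comp Primrec.snd)) (Primrec.pair
          (Primrec.fst.comp (Primrec.snd.comp Primrec.snd)) (Primrec.pair
          (Primrec.fst.comp Primrec.fst) (Primrec.fst.comp (Primrec.fst.comp Primrec.snd)))))
    · exact Primrec.nat_le.comp (Primrec.list_length.comp
        (Primrec.fst.comp (Primrec.snd.comp Primrec.snd)))
        (Primrec.snd.comp (Primrec.fst.comp Primrec.snd))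
    · exact Primrec.nat_le.comp (Primrec.snd.comp (Primrec.fst.comp Primrec.snd))
        (Primrec.snd.comp Primrec.fst)
  have haccP : Primrec₂ acc := by
    refine Primrec.ite (PrimrecPred.exists_lt_of Primrec.snd (PrimrecPred.eq ?_ ?_))
      (Primrec.const none) hcandP
    · exact hcandP.comp (Primrec.fst.comp Primrec.fst) Primrec.snd
    · exact hcandP.comp (Primrec.fst.comp Primrec.fst) (Primrec.snd.comp Primrec.fst)
  have hallocP : Primrec fun a : BitString × ℕ => allocated (acc a.1) a.2 := by
    refine (Primrec.nat_rec' (f := fun a : BitString × ℕ => a.2) (g := fun _ => 0)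
      (h := fun a d => 2 * d.2 + ((acc a.1 d.1).elim 0 fun e => 2 ^ (d.1 - e.2)))
      Primrec.snd (Primrec.const 0) (Primrec.nat_add.comp (Primrec.nat_mul.comp (Primrec.const 2)
        (Primrec.snd.comp Primrec.snd)) ?_)).of_eq fun a => ?_
    · refine (Primrec.option_casesOn (o := fun a : (BitString × ℕ) × ℕ × ℕ => acc a.1.1 a.2.1)
        (f := fun _ => 0) (g := fun a e => 2 ^ (a.2.1 - e.2))
        (haccP.comp (Primrec.fst.comp Primrec.fst) (Primrec.fst.comp Primrec.snd))
        (Primrec.const 0) (Primrec.two_pow (Primrec.nat_sub.comp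
          (Primrec.fst.comp (Primrec.snd.comp Primrec.fst)) (Primrec.snd.comp Primrec.snd)))).of_eq
        fun a => ?_
      rcases acc a.1.1 a.2.1 with - | e <;> rfl
    · obtain ⟨x, m⟩ := a
      induction m with
      | zero => rfl
      | succ m ih =>
        simp only [allocated] at ih ⊢
        rw [← ih]
  have hassignedP : PrimrecPred fun a : ℕ × BitString × BitString × BitString =>
      Assigned (acc a.2.2.1) a.1 a.2.1 a.2.2.2 := by
    have hm : Primrec fun a : ℕ × BitString × BitString × BitString => a.1 := Primrec.fst
    have hp : Primrec fun a : ℕ × BitString × BitString × BitString => a.2.1 :=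
      Primrec.fst.comp Primrec.snd
    have hx : Primrec fun a : ℕ × BitString × BitString × BitString => a.2.2.1 :=
      Primrec.fst.comp (Primrec.snd.comp Primrec.snd)
    have hy : Primrec fun a : ℕ × BitString × BitString × BitString => a.2.2.2 :=
      Primrec.snd.comp (Primrec.snd.comp Primrec.snd)
    have hl := Primrec.list_length.comp hp
    have hv := Primrec.nat_mul.comp (primrec_binaryValue.comp hp) (Primrec.two_pow hm)
    have ha := Primrec.nat_mul.comp (hallocP.comp (Primrec.pair hx hm)) (Primrec.two_pow hl)
    -- The level is recovered as the length minus 2, which removes the unbounded quantifier; length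
    -- at least 2 is required because subtraction is truncated.
    refine (PrimrecPred.and (PrimrecPred.eq (haccP.comp hx hm) (Primrec.option_some.comp
      (Primrec.pair hy (Primrec.nat_sub.comp hl (Primrec.const 2)))))
      (PrimrecPred.and (Primrec.nat_le.comp (Primrec.const 2) hl) (PrimrecPred.and
        (Primrec.nat_le.comp ha hv) (Primrec.nat_lt.comp hv
          (Primrec.nat_add.comp ha (Primrec.two_pow hm)))))).of_eq fun a => ?_
    constructor
    · rintro ⟨h1, h2, h3, h4⟩
      have h5 : a.2.1.length = a.2.1.length - 2 + 2 := by omega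
      exact ⟨_, h1, h5, h5 ▸ h3, h5 ▸ h4⟩
    · rintro ⟨k, h1, h2, h3, h4⟩
      rw [h2]
      exact ⟨h1, by omega, h3, h4⟩
  obtain ⟨V, hV, hVR⟩ := exists_machine (fun m p x y => Assigned (acc x) m p y) hassignedP
    fun m m' p x y y' h h' => (hstep x m m' p p y y' h h' (List.prefix_refl p)).2
  refine ⟨V, ⟨hV, fun x p q hpq hp hq => ?_⟩, fun x y => le_add_of_forall_le fun k h => ?_⟩
  · obtain ⟨y, hy⟩ := Part.dom_iff_mem.1 hp
    obtain ⟨z, hz⟩ := Part.dom_iff_mem.1 hq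
    obtain ⟨m, hm⟩ := (hVR _ _ _).1 hy
    obtain ⟨m', hm'⟩ := (hVR _ _ _).1 hz
    exact (hstep x m m' p q y z hm hm' hpq).1
  · obtain ⟨p, hp, hpk⟩ := condComplexity_le_iff.1 h
    obtain ⟨t, ht⟩ := (hRU _ _ _).1 hp
    have hex : ∃ m, cand x m = some (y, k) := by
      refine ⟨Encodable.encode ((y, k), p, t), ?_⟩
      have hle : k ≤ Encodable.encode ((y, k), p, t) := by
        simp only [Encodable.encode_prod_val, Encodable.encode_nat]
        exact (Nat.right_le_pair _ _).trans (Nat.left_le_pair _ _)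
      simp only [cand, Encodable.encodek, Option.bind_some]
      rw [if_pos ⟨ht, hpk, hle⟩]
    have hmin := fun m' hm' => Nat.find_min hex (m := m') hm'
    have hfind := Nat.find_spec hex
    set m := Nat.find hex
    have hm : acc x m = some (y, k) := by
      simp only [acc]
      rw [if_neg, hfind]
      rintro ⟨m', hm', h'⟩
      exact hmin m' hm' (h'.trans hfind)
    obtain ⟨q, hq, hql⟩ := exists_assigned (hA x) (hk _ _ _ hm) hm
    exact condComplexity_le_iff.2 ⟨q, (hVR _ _ _).2 ⟨m, hq⟩, hql.le⟩

/-! ### Decidability of the game -/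

section GamePrimrec

variable {α : Type} [Primcodable α]

theorem PrimrecPred.touches {z : α → BitString} {r : α → Request} (hz : Primrec z)
    (hr : Primrec r) : PrimrecPred fun a => Touches (z a) (r a) :=
  (PrimrecPred.eq (Primrec.fst.comp (Primrec.fst.comp hr)) hz).or
    (PrimrecPred.eq (Primrec.snd.comp (Primrec.fst.comp hr)) hz)

theorem Primrec.stateLoad {R : α → ℕ} {s : α → GameState} {z : α → BitString} (hR : Primrec R)
    (hs : Primrec s) (hz : Primrec z) : Primrec fun a => stateLoad (R a) (s a) (z a) := by
  refine Primrec.list_sum (Primrec.list_map hs (Primrec.ite (PrimrecPred.touches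
    (hz.comp Primrec.fst) (Primrec.fst.comp Primrec.snd)) (Primrec.two_pow
      (Primrec.nat_sub.comp (hR.comp Primrec.fst)
        (Primrec.snd.comp (Primrec.fst.comp Primrec.snd))))
    (Primrec.const 0)))

theorem PrimrecPred.legal {A : ℕ → ℕ → Prop} (hA : PrimrecPred fun a : ℕ × ℕ => A a.1 a.2)
    {n : α → ℕ} {s : α → GameState} {r : α → Request} (hn : Primrec n) (hs : Primrec s)
    (hr : Primrec r) : PrimrecPred fun a => Legal A (n a) (s a) (r a) := by
  have hx := Primrec.fst.comp (Primrec.fst.comp hr)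
  have hy := Primrec.snd.comp (Primrec.fst.comp hr)
  have hk := Primrec.snd.comp hr
  have h2n := Primrec.nat_mul.comp (Primrec.const 2) hn
  have hw := Primrec.two_pow (Primrec.nat_sub.comp h2n hk)
  have htotal := Primrec.two_pow (Primrec.nat_add.comp h2n (Primrec.const 1))
  refine (PrimrecPred.eq (Primrec.list_length.comp hx) hn).and
    ((PrimrecPred.eq (Primrec.list_length.comp hy) hn).and
    ((Primrec.nat_lt.comp (Primrec.encode.comp hx) (Primrec.encode.comp hy)).and
    ((hA.comp (Primrec.pair hn hk)).and
    ((Primrec.nat_le.comp hk h2n).and (PrimrecPred.and ?_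
    ((Primrec.nat_le.comp (Primrec.nat_add.comp (Primrec.stateLoad h2n hs hx) hw) htotal).and
    (Primrec.nat_le.comp (Primrec.nat_add.comp (Primrec.stateLoad h2n hs hy) hw) htotal)))))))
  refine (PrimrecPred.exists_mem (R := fun a e => e.1 = r a) hs (PrimrecPred.eq
    (Primrec.fst.comp Primrec.snd) (hr.comp Primrec.fst))).not.of_eq fun a => ?_
  rw [List.mem_map]

theorem PrimrecPred.answers {s : α → GameState} {r : α → Request} {p : α → BitString}
    (hs : Primrec s) (hr : Primrec r) (hp : Primrec p) :
    PrimrecPred fun a => Answers (s a) (r a) (p a) := by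
  have hr' := hr.comp (Primrec.fst (α := α) (β := Request × BitString))
  have hp' := hp.comp (Primrec.fst (α := α) (β := Request × BitString))
  have he := Primrec.fst.comp (Primrec.snd (α := α) (β := Request × BitString))
  have hw := Primrec.snd.comp (Primrec.snd (α := α) (β := Request × BitString))
  refine (PrimrecPred.eq (Primrec.list_length.comp hp) (Primrec.nat_add.comp
    (Primrec.snd.comp hr) (Primrec.const 42))).and (PrimrecPred.forall_mem hs ?_)
  refine (((PrimrecPred.touches (Primrec.fst.comp (Primrec.fst.comp hr')) he).or
    (PrimrecPred.touches (Primrec.snd.comp (Primrec.fst.comp hr')) he)).not.or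
    ((PrimrecPred.isPrefix hp' hw).not.and (PrimrecPred.isPrefix hw hp').not)).of_eq fun a => ?_
  rw [imp_iff_not_or]

/-- The state `s'` is obtained from `s` by an answer to the request `r`. -/
def Extends (s : GameState) (r : Request) (s' : GameState) : Prop :=
  s'.tail = s ∧ ∃ e ∈ s'.take 1, e.1 = r ∧ Answers s r e.2

/-- `Extends` is written with `tail` and `take 1` so that it is visibly primitive recursive; this is
its usable form. -/
theorem extends_iff {s s' : GameState} {r : Request} :
    Extends s r s' ↔ ∃ p, s' = (r, p) :: s ∧ Answers s r p := by
  rcases s' with - | ⟨⟨r', p⟩, s'⟩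
  · simp [Extends]
  · simp only [Extends, List.tail_cons, List.take_succ_cons, List.take_zero, List.mem_singleton,
      exists_eq_left, List.cons.injEq, Prod.mk.injEq]
    constructor
    · rintro ⟨rfl, rfl, h⟩
      exact ⟨p, ⟨⟨rfl, rfl⟩, rfl⟩, h⟩
    · rintro ⟨q, ⟨⟨rfl, rfl⟩, rfl⟩, h⟩
      exact ⟨rfl, rfl, h⟩

theorem PrimrecPred.stateExtends {s s' : α → GameState} {r : α → Request} (hs : Primrec s)
    (hr : Primrec r) (hs' : Primrec s') : PrimrecPred fun a => Extends (s a) (r a) (s' a) :=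
  (PrimrecPred.eq (Primrec.list_tail.comp hs') hs).and
    (PrimrecPred.exists_mem (Primrec.list_take.comp (Primrec.const 1) hs')
      ((PrimrecPred.eq (Primrec.fst.comp Primrec.snd) (hr.comp Primrec.fst)).and
        (PrimrecPred.answers (hs.comp Primrec.fst) (hr.comp Primrec.fst)
          (Primrec.snd.comp Primrec.snd))))

end GamePrimrec

/-- The list of the binary strings of length `n`. -/
def words (n : ℕ) : List BitString :=
  n.rec [[]] fun _ l => l.map (List.cons true) ++ l.map (List.cons false)

theorem mem_words {n : ℕ} {x : BitString} : x ∈ words n ↔ x.length = n := by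
  induction n generalizing x with
  | zero => simp [words]
  | succ n ih =>
    have h : words (n + 1) =
        (words n).map (List.cons true) ++ (words n).map (List.cons false) := rfl
    rw [h, List.mem_append, List.mem_map, List.mem_map]
    rcases x with - | ⟨b, x⟩
    · simp
    · cases b <;> simp [ih]

theorem primrec_words : Primrec words := by
  refine Primrec.nat_rec₁ _ (Primrec.list_append.comp ?_ ?_)
  · exact Primrec.list_map Primrec.snd (Primrec.list_cons.comp (Primrec.const true) Primrec.snd)
  · exact Primrec.list_map Primrec.snd (Primrec.list_cons.comp (Primrec.const false) Primrec.snd)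

/-- All pairs of strings of length `n` with a level up to `2 * n`. -/
def requests (n : ℕ) : List Request :=
  (words n).flatMap fun x => (words n).flatMap fun y =>
    (List.range (2 * n + 1)).map fun k => ((x, y), k)

theorem mem_requests {n : ℕ} {r : Request} :
    r ∈ requests n ↔ r.1.1.length = n ∧ r.1.2.length = n ∧ r.2 ≤ 2 * n := by
  obtain ⟨⟨x, y⟩, k⟩ := r
  simp only [requests, List.mem_flatMap, List.mem_map, mem_words, List.mem_range, Prod.mk.injEq]
  constructor
  · rintro ⟨_, hx, _, hy, _, hk, ⟨rfl, rfl⟩, rfl⟩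
    exact ⟨hx, hy, by omega⟩
  · rintro ⟨hx, hy, hk⟩
    exact ⟨x, hx, y, hy, k, by omega, ⟨rfl, rfl⟩, rfl⟩

theorem primrec_requests : Primrec requests := by
  refine Primrec.list_flatMap primrec_words (Primrec.list_flatMap (primrec_words.comp Primrec.fst)
    (Primrec.list_map (Primrec.list_range.comp (Primrec.nat_add.comp (Primrec.nat_mul.comp
      (Primrec.const 2) (Primrec.fst.comp Primrec.fst)) (Primrec.const 1))) ?_))
  exact Primrec.pair (Primrec.pair (Primrec.snd.comp (Primrec.fst.comp Primrec.fst))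
    (Primrec.snd.comp Primrec.fst)) Primrec.snd

/-- All legal requests in the state `s` can be answered inside `C`. -/
def Answerable (A : ℕ → ℕ → Prop) (n : ℕ) (C : List GameState) (s : GameState) : Prop :=
  ∀ r ∈ requests n, Legal A n s r → ∃ s' ∈ C, Extends s r s'

/-- `C` is a set of states in which all legal requests can be answered online. -/
def Certificate (A : ℕ → ℕ → Prop) (n : ℕ) (C : List GameState) : Prop :=
  (∃ s ∈ C, s = []) ∧ ∀ s ∈ C, Answerable A n C s

theorem PrimrecPred.answerable {α : Type} [Primcodable α] {A : ℕ → ℕ → Prop}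
    (hA : PrimrecPred fun a : ℕ × ℕ => A a.1 a.2) {n : α → ℕ} {C : α → List GameState}
    {s : α → GameState} (hn : Primrec n) (hC : Primrec C) (hs : Primrec s) :
    PrimrecPred fun a => Answerable A (n a) (C a) (s a) := by
  have h : PrimrecPred fun b : α × Request =>
      Legal A (n b.1) (s b.1) b.2 → ∃ s' ∈ C b.1, Extends (s b.1) b.2 s' := by
    refine ((PrimrecPred.legal hA (hn.comp Primrec.fst) (hs.comp Primrec.fst)
      Primrec.snd).not.or (PrimrecPred.exists_mem (R := fun b s' => Extends (s b.1) b.2 s')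
        (hC.comp Primrec.fst) (PrimrecPred.stateExtends (hs.comp (Primrec.fst.comp Primrec.fst))
          (Primrec.snd.comp Primrec.fst) Primrec.snd))).of_eq fun a => ?_
    rw [imp_iff_not_or]
  exact PrimrecPred.forall_mem (R := fun a r => Legal A (n a) (s a) r →
    ∃ s' ∈ C a, Extends (s a) r s') (primrec_requests.comp hn) h

theorem PrimrecPred.certificate {α : Type} [Primcodable α] {A : ℕ → ℕ → Prop}
    (hA : PrimrecPred fun a : ℕ × ℕ => A a.1 a.2)
    {n : α → ℕ} {C : α → List GameState} (hn : Primrec n) (hC : Primrec C) :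
    PrimrecPred fun a => Certificate A (n a) (C a) :=
  (PrimrecPred.exists_mem hC (PrimrecPred.eq Primrec.snd (Primrec.const []))).and
    (PrimrecPred.forall_mem (R := fun a s => Answerable A (n a) (C a) s) hC
      (PrimrecPred.answerable hA (hn.comp Primrec.fst) (hC.comp Primrec.fst) Primrec.snd))

/-! ### Plays and finite certificates -/

/-- The states that can occur when only requests with the property `J` are made. -/
inductive Play (A : ℕ → ℕ → Prop) (n : ℕ) (J : Request → Prop) : GameState → Prop
  | nil : Play A n J []
  | cons {s : GameState} {r : Request} {p : BitString} (hs : Play A n J s) (hr : Legal A n s r)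
      (hp : Answers s r p) (hJ : J r) : Play A n J ((r, p) :: s)

namespace Play

variable {A : ℕ → ℕ → Prop} {n : ℕ} {J : Request → Prop} {s : GameState}

theorem of_mem (h : Play A n J s) {e : Request × BitString} (he : e ∈ s) :
    J e.1 ∧ e.1.1.1.length = n ∧ e.1.1.2.length = n ∧
      Encodable.encode e.1.1.1 < Encodable.encode e.1.1.2 ∧ e.1.2 ≤ 2 * n ∧
      e.2.length = e.1.2 + 42 := by
  induction h with
  | nil => simp at he
  | cons _ hr hp hJ ih =>
    rcases List.mem_cons.1 he with rfl | he
    · exact ⟨hJ, hr.1, hr.2.1, hr.2.2.1, hr.2.2.2.2.1, hp.1⟩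
    · exact ih he

theorem nodup (h : Play A n J s) : (s.map Prod.fst).Nodup := by
  induction h with
  | nil => simp
  | cons _ hr _ _ ih => exact List.nodup_cons.2 ⟨hr.2.2.2.2.2.1, ih⟩

theorem eq_of_prefix (h : Play A n J s) {x : BitString} {e e' : Request × BitString} (he : e ∈ s)
    (he' : e' ∈ s) (hx : Touches x e.1) (hx' : Touches x e'.1) (hpre : e.2 <+: e'.2) : e = e' := by
  induction h with
  | nil => simp at he
  | cons _ _ hp _ ih =>
    rcases List.mem_cons.1 he with rfl | he <;> rcases List.mem_cons.1 he' with rfl | he'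
    · rfl
    · refine absurd hpre (hp.2 e' he' ?_).1
      rcases hx with rfl | rfl
      · exact Or.inl hx'
      · exact Or.inr hx'
    · refine absurd hpre (hp.2 e he ?_).2
      rcases hx' with rfl | rfl
      · exact Or.inl hx
      · exact Or.inr hx
    · exact ih he he'

end Play

theorem finite_lists_of_length_le {α : Type*} {F : Set α} (hF : F.Finite) (D : ℕ) :
    {l : List α | l.length ≤ D ∧ ∀ e ∈ l, e ∈ F}.Finite := by
  induction D with
  | zero =>
    refine (Set.finite_singleton []).subset ?_
    rintro l ⟨hl, -⟩
    simpa using hl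
  | succ D ih =>
    refine ((Set.finite_singleton []).union (Set.Finite.image2 List.cons hF ih)).subset ?_
    rintro (- | ⟨e, l⟩) ⟨hl, he⟩
    · exact Or.inl rfl
    · exact Or.inr ⟨e, he e (by simp), l, ⟨by simpa using hl, fun e' h => he e' (by simp [h])⟩, rfl⟩

/-- Reachable good states are finite in number: each request occurs at most once, there are finitely
many requests, and the words have length at most 2n + 42. -/
theorem Winnable.exists_certificate {A : ℕ → ℕ → Prop} {n : ℕ} (h : Winnable A n) :
    ∃ C, Certificate A n C := by
  classical
  obtain ⟨good, hnil, hgood⟩ := h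
  have hw : ∀ L, {x : BitString | x.length ≤ L}.Finite := List.finite_length_le Bool
  have hR : {r : Request | r.1.1.length = n ∧ r.1.2.length = n ∧ r.2 ≤ 2 * n}.Finite := by
    refine (((hw n).prod (hw n)).prod (Set.finite_Iic (2 * n))).subset ?_
    rintro r ⟨h1, h2, h3⟩
    exact ⟨⟨h1.le, h2.le⟩, h3⟩
  have hF := hR.prod (hw (2 * n + 42))
  let S : Set GameState := {s | good s ∧ Play A n (fun _ => True) s}
  have hS : S.Finite := by
    refine (finite_lists_of_length_le hF #hR.toFinset).subset ?_
    rintro s ⟨-, hs⟩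
    have hmem : ∀ e ∈ s, e.1 ∈ hR.toFinset := fun e he => by
      obtain ⟨-, h1, h2, -, h3, -⟩ := hs.of_mem he
      exact hR.mem_toFinset.2 ⟨h1, h2, h3⟩
    constructor
    · rw [← List.length_map (f := Prod.fst), ← List.toFinset_card_of_nodup hs.nodup]
      refine card_le_card fun r hr => ?_
      obtain ⟨e, he, rfl⟩ := List.mem_map.1 (List.mem_toFinset.1 hr)
      exact hmem e he
    · intro e he
      obtain ⟨-, h1, h2, -, h3, h4⟩ := hs.of_mem he
      exact ⟨⟨h1, h2, h3⟩, by simp only [Set.mem_ofPred_eq]; omega⟩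
  refine ⟨hS.toFinset.toList, ⟨[], by simp [S, hnil, Play.nil], rfl⟩, ?_⟩
  intro s hs r _ hl
  have hs' : s ∈ S := by simpa using hs
  obtain ⟨p, hp, hg⟩ := hgood s hs'.1 _ hl
  refine ⟨(r, p) :: s, ?_, extends_iff.2 ⟨p, rfl, hp⟩⟩
  have : (r, p) :: s ∈ S := ⟨hg, hs'.2.cons hl hp trivial⟩
  simpa using this

/-- The other endpoint of a request with the endpoint `x`. -/
def otherEnd (x : BitString) (r : Request) : BitString := if r.1.1 = x then r.1.2 else r.1.1

/-- The machine `U` has programs of length at most `k` for both transformations of the request. -/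
def Justified (U : Machine) (r : Request) : Prop :=
  (∃ p, r.1.2 ∈ U p r.1.1 ∧ p.length ≤ r.2) ∧ ∃ q, r.1.1 ∈ U q r.1.2 ∧ q.length ≤ r.2

theorem Justified.otherEnd {U : Machine} {r : Request} (h : Justified U r) {x : BitString}
    (hx : Touches x r) : ∃ p, otherEnd x r ∈ U p x ∧ p.length ≤ r.2 := by
  unfold _root_.otherEnd
  split_ifs with h1
  · exact h1 ▸ h.1
  · obtain h2 := hx.resolve_left h1
    exact h2 ▸ h.2

/-- Requests at `x` correspond to pairs (other endpoint, level) that bound conditional complexities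
given `x`, so `Coherent.sum_le` bounds their weight. Confirmed requests thus never violate the load
condition. -/
theorem Play.load_le {A : ℕ → ℕ → Prop} {n : ℕ} {U : Machine} (hU : Coherent U) {s : GameState}
    (hs : Play A n (Justified U) s) {r : Request} (hJ : Justified U r) (hk : r.2 ≤ 2 * n)
    (henc : Encodable.encode r.1.1 < Encodable.encode r.1.2) (hnew : r ∉ s.map Prod.fst)
    {x : BitString} (hx : Touches x r) :
    stateLoad (2 * n) s x + 2 ^ (2 * n - r.2) ≤ 2 ^ (2 * n + 1) := by
  classical
  let l := r :: s.map Prod.fst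
  have hnd : l.Nodup := List.nodup_cons.2 ⟨hnew, hs.nodup⟩
  have hl : ∀ r' ∈ l, Justified U r' ∧ r'.2 ≤ 2 * n ∧
      Encodable.encode r'.1.1 < Encodable.encode r'.1.2 := by
    intro r' hr'
    rcases List.mem_cons.1 hr' with rfl | hr'
    · exact ⟨hJ, hk, henc⟩
    · obtain ⟨e, he, rfl⟩ := List.mem_map.1 hr'
      obtain ⟨h1, -, -, h2, h3, -⟩ := hs.of_mem he
      exact ⟨h1, h3, h2⟩
  let T := l.toFinset.filter (Touches x)
  have hsum : stateLoad (2 * n) s x + 2 ^ (2 * n - r.2) = ∑ r' ∈ T, 2 ^ (2 * n - r'.2) := by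
    rw [sum_filter, List.sum_toFinset _ hnd, List.map_cons, List.sum_cons, if_pos hx, add_comm,
      List.map_map]
    rfl
  -- The order of the codes of the endpoints ensures that an unordered pair is requested in only one
  -- orientation.
  have hinj : Set.InjOn (fun r' : Request => (otherEnd x r', r'.2)) T := by
    intro r₁ h₁ r₂ h₂ h
    simp only [T, coe_filter, List.mem_toFinset, Set.mem_ofPred_eq] at h₁ h₂
    obtain ⟨h3, h4⟩ := Prod.mk.inj h
    have e₁ := (hl _ h₁.1).2.2
    have e₂ := (hl _ h₂.1).2.2
    have t₁ := h₁.2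
    have t₂ := h₂.2
    obtain ⟨⟨a, b⟩, k⟩ := r₁
    obtain ⟨⟨a', b'⟩, k'⟩ := r₂
    simp only [otherEnd, Touches] at *
    subst h4
    split_ifs at h3 with h5 h6 h6
    · rw [h5, h6, h3]
    · subst h5 h3
      rw [t₂.resolve_left h6] at e₂
      exact absurd e₂ e₁.asymm
    · subst h6 h3
      rw [t₁.resolve_left h5] at e₁
      exact absurd e₁ e₂.asymm
    · rw [t₁.resolve_left h5, t₂.resolve_left h6, h3]
  rw [hsum, ← sum_image (f := fun e : BitString × ℕ => 2 ^ (2 * n - e.2)) hinj]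
  refine hU.sum_le x _ _ fun e he => ?_
  obtain ⟨r', hr', rfl⟩ := mem_image.1 he
  rw [mem_filter, List.mem_toFinset] at hr'
  exact ⟨(hl r' hr'.1).2.1, (hl r' hr'.1).1.otherEnd hr'.2⟩

/-! ### Playing a certificate online -/

section Online

open Classical in
/-- The states in `C` that arise by an answer to the request `r` in the state `s`. -/
noncomputable def successors (C : List GameState) (s : GameState) (r : Request) : List GameState :=
  C.filter fun s' => Extends s r s'

theorem mem_successors {C : List GameState} {s s' : GameState} {r : Request} :
    s' ∈ successors C s r ↔ s' ∈ C ∧ Extends s r s' := by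
  simp [successors]

open Classical in
/-- The answer to the request encoded by `m`, if it is legal and confirmed. -/
noncomputable def nextState (A : ℕ → ℕ → Prop) (Q : ℕ → Request → Prop) (n : ℕ)
    (C : List GameState) (s : GameState) (m : ℕ) : GameState :=
  (Encodable.decode m : Option (Request × ℕ)).elim s fun d =>
    if Legal A n s d.1 ∧ Q d.2 d.1 then (successors C s d.1).head?.getD s else s

/-- The state of the game after `m` steps. -/
noncomputable def stateAt (A : ℕ → ℕ → Prop) (Q : ℕ → Request → Prop) (n : ℕ)
    (C : List GameState) : ℕ → GameState
  | 0 => []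
  | m + 1 => nextState A Q n C (stateAt A Q n C m) m

variable {A : ℕ → ℕ → Prop} {Q : ℕ → Request → Prop} {n : ℕ} {C : List GameState}

theorem nextState_eq (s : GameState) (m : ℕ) : nextState A Q n C s m = s ∨
    ∃ r p t, Q t r ∧ Legal A n s r ∧ Answers s r p ∧ (r, p) :: s ∈ C ∧
      nextState A Q n C s m = (r, p) :: s := by
  unfold nextState
  rcases (Encodable.decode m : Option (Request × ℕ)) with - | ⟨r, t⟩
  · exact Or.inl rfl
  · simp only [Option.elim]
    split_ifs with h
    · rcases hs : (successors C s r).head? with - | s'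
      · exact Or.inl rfl
      · have hs' := List.mem_of_mem_head? hs
        rw [mem_successors, extends_iff] at hs'
        obtain ⟨hC, p, rfl, hp⟩ := hs'
        exact Or.inr ⟨r, p, t, h.2, h.1, hp, hC, rfl⟩
    · exact Or.inl rfl

theorem stateAt_suffix {m m' : ℕ} (h : m ≤ m') : stateAt A Q n C m <:+ stateAt A Q n C m' := by
  induction m', h using Nat.le_induction with
  | base => exact List.suffix_refl _
  | succ m' _ ih =>
    refine ih.trans ?_
    rw [stateAt]
    rcases nextState_eq (A := A) (Q := Q) (n := n) (C := C) (stateAt A Q n C m') m'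
      with h | ⟨r, p, t, -, -, -, -, h⟩
    · rw [h]
    · rw [h]
      exact List.suffix_cons _ _

theorem stateAt_mem (hC : Certificate A n C) (m : ℕ) : stateAt A Q n C m ∈ C := by
  induction m with
  | zero =>
    obtain ⟨s, hs, rfl⟩ := hC.1
    exact hs
  | succ m ih =>
    rw [stateAt]
    rcases nextState_eq (A := A) (Q := Q) (n := n) (C := C) (stateAt A Q n C m) m
      with h | ⟨r, p, t, -, -, -, h', h⟩
    · rwa [h]
    · rwa [h]

theorem stateAt_play (m : ℕ) :
    Play A n (fun r => ∃ t, Q t r) (stateAt A Q n C m) := by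
  induction m with
  | zero => exact Play.nil
  | succ m ih =>
    rw [stateAt]
    rcases nextState_eq (A := A) (Q := Q) (n := n) (C := C) (stateAt A Q n C m) m
      with h | ⟨r, p, t, h1, h2, h3, -, h⟩
    · rwa [h]
    · rw [h]
      exact ih.cons h2 h3 ⟨t, h1⟩

/-- The request is treated at the step whose number codes it together with its confirmation `t`. If
still unanswered then, it is legal, and the certificate supplies a successor, so the default in
`nextState` is not reached. -/
theorem exists_mem_stateAt (hC : Certificate A n C) {r : Request} {t : ℕ} (hQ : Q t r)
    (hl : ∀ s, Play A n (fun r => ∃ t, Q t r) s → r ∉ s.map Prod.fst → Legal A n s r) :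
    ∃ m, ∃ e ∈ stateAt A Q n C m, e.1 = r := by
  classical
  set m := Encodable.encode (r, t) with hm
  by_cases hmem : r ∈ (stateAt A Q n C m).map Prod.fst
  · obtain ⟨e, he, h⟩ := List.mem_map.1 hmem
    exact ⟨m, e, he, h⟩
  · refine ⟨m + 1, ?_⟩
    have hleg := hl _ (stateAt_play m) hmem
    obtain ⟨s', hs', hext⟩ := hC.2 _ (stateAt_mem (Q := Q) hC m) r
      (mem_requests.2 ⟨hleg.1, hleg.2.1, hleg.2.2.2.2.1⟩) hleg
    rw [stateAt, nextState, hm, Encodable.encodek, ← hm]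
    simp only [Option.elim]
    rw [if_pos ⟨hleg, hQ⟩]
    rcases hs : (successors C (stateAt A Q n C m) r).head? with - | s''
    · rw [List.head?_eq_none_iff] at hs
      exact absurd (mem_successors.2 ⟨hs', hext⟩) (by simp [hs])
    · have hs'' := List.mem_of_mem_head? hs
      rw [mem_successors, extends_iff] at hs''
      obtain ⟨-, p, rfl, -⟩ := hs''
      exact ⟨_, List.mem_cons_self, rfl⟩

theorem Primrec.stateAt {α : Type} [Primcodable α]
    (hA : PrimrecPred fun a : ℕ × ℕ => A a.1 a.2)
    (hQ : PrimrecPred fun a : ℕ × Request => Q a.1 a.2)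
    {n : α → ℕ} {C : α → List GameState} {m : α → ℕ} (hn : Primrec n) (hC : Primrec C)
    (hm : Primrec m) : Primrec fun a => stateAt A Q (n a) (C a) (m a) := by
  classical
  have hfilter : Primrec fun b : List GameState × GameState × Request =>
      successors b.1 b.2.1 b.2.2 := by
    have hR : PrimrecRel fun (s' : GameState) (b : GameState × Request) => Extends b.1 b.2 s' :=
      PrimrecPred.stateExtends (Primrec.fst.comp Primrec.snd) (Primrec.snd.comp Primrec.snd)
        Primrec.fst
    exact hR.listFilter
  have hnext : Primrec fun b : (ℕ × List GameState) × ℕ × GameState =>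
      nextState A Q b.1.1 b.1.2 b.2.2 b.2.1 := by
    let X := (ℕ × List GameState) × ℕ × GameState
    have hd : Primrec fun b : X × Request × ℕ => b.2.1 := Primrec.fst.comp Primrec.snd
    have hs : Primrec fun b : X × Request × ℕ => b.1.2.2 :=
      Primrec.snd.comp (Primrec.snd.comp Primrec.fst)
    have hmain : Primrec fun b : X × Request × ℕ =>
        if Legal A b.1.1.1 b.1.2.2 b.2.1 ∧ Q b.2.2 b.2.1 then
          (successors b.1.1.2 b.1.2.2 b.2.1).head?.getD b.1.2.2 else b.1.2.2 := by
      refine Primrec.ite (PrimrecPred.and (PrimrecPred.legal hA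
        (Primrec.fst.comp (Primrec.fst.comp Primrec.fst)) hs hd)
        (hQ.comp (Primrec.pair (Primrec.snd.comp Primrec.snd) hd))) ?_ hs
      refine Primrec.option_getD.comp (Primrec.list_head?.comp (hfilter.comp (Primrec.pair
        (Primrec.snd.comp (Primrec.fst.comp Primrec.fst)) (Primrec.pair hs hd)))) hs
    refine (Primrec.option_casesOn (o := fun b : X =>
        (Encodable.decode b.2.1 : Option (Request × ℕ)))
      (f := fun b => b.2.2) (Primrec.decode.comp (Primrec.fst.comp Primrec.snd))
      (Primrec.snd.comp Primrec.snd) hmain.to₂).of_eq fun b => ?_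
    unfold nextState
    rcases (Encodable.decode b.2.1 : Option (Request × ℕ)) with - | d <;> rfl
  refine (Primrec.nat_rec' (f := m) (g := fun _ => ([] : GameState))
    (h := fun a d => nextState A Q (n a) (C a) d.2 d.1) hm (Primrec.const [])
    (hnext.comp (g := fun b : α × ℕ × GameState => ((n b.1, C b.1), b.2)) (Primrec.pair
      (Primrec.pair (hn.comp Primrec.fst) (hC.comp Primrec.fst)) Primrec.snd)).to₂).of_eq
    fun a => ?_
  generalize m a = j
  induction j with
  | zero => rfl
  | succ j ih =>
    simp only [_root_.stateAt] at ih ⊢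
    rw [← ih]

end Online

/-- If a game is winnable for the levels allowed by `A`, then some prefix-free machine exchanges
the strings in question. -/
theorem exists_exchange_machine {A : ℕ → ℕ → Prop} (hA : PrimrecPred fun a : ℕ × ℕ => A a.1 a.2)
    {U : Machine} (hU : Partrec₂ U) (hc : Coherent U) :
    ∃ V, IsPrefixFree V ∧ ∀ (n k : ℕ) (x y : BitString), Winnable A n → x.length = n →
      y.length = n → x ≠ y → A n k → k ≤ 2 * n → condComplexity U y x ≤ k →
      condComplexity U x y ≤ k → dist₁ V x y ≤ (k + 42 : ℕ) := by
  classical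
  obtain ⟨R, hR, hRU⟩ := exists_enumeration U hU
  -- The number `t` codes two programs with their running times, one for each direction.
  let Q : ℕ → Request → Prop := fun t r =>
    ∃ d ∈ (Encodable.decode t : Option ((BitString × BitString) × ℕ × ℕ)).toList,
      R d.2.1 d.1.1 r.1.1 r.1.2 ∧ R d.2.2 d.1.2 r.1.2 r.1.1 ∧
        d.1.1.length ≤ r.2 ∧ d.1.2.length ≤ r.2
  have hQJ : ∀ r, (∃ t, Q t r) ↔ Justified U r := by
    intro r
    constructor
    · rintro ⟨t, d, -, h1, h2, h3, h4⟩
      exact ⟨⟨_, (hRU _ _ _).2 ⟨_, h1⟩, h3⟩, _, (hRU _ _ _).2 ⟨_, h2⟩, h4⟩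
    · rintro ⟨⟨p, h1, h3⟩, q, h2, h4⟩
      obtain ⟨t, ht⟩ := (hRU _ _ _).1 h1
      obtain ⟨t', ht'⟩ := (hRU _ _ _).1 h2
      exact ⟨Encodable.encode ((p, q), t, t'), ((p, q), t, t'), by simp, ht, ht', h3, h4⟩
  have hQP : PrimrecPred fun a : ℕ × Request => Q a.1 a.2 := by
    let X := (ℕ × Request) × (BitString × BitString) × ℕ × ℕ
    have hx : Primrec fun b : X => b.1.2.1.1 :=
      Primrec.fst.comp (Primrec.fst.comp (Primrec.snd.comp Primrec.fst))
    have hy : Primrec fun b : X => b.1.2.1.2 :=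
      Primrec.snd.comp (Primrec.fst.comp (Primrec.snd.comp Primrec.fst))
    have hk : Primrec fun b : X => b.1.2.2 := Primrec.snd.comp (Primrec.snd.comp Primrec.fst)
    have hp : Primrec fun b : X => b.2.1.1 := Primrec.fst.comp (Primrec.fst.comp Primrec.snd)
    have hq : Primrec fun b : X => b.2.1.2 := Primrec.snd.comp (Primrec.fst.comp Primrec.snd)
    have ht : Primrec fun b : X => b.2.2.1 := Primrec.fst.comp (Primrec.snd.comp Primrec.snd)
    have ht' : Primrec fun b : X => b.2.2.2 := Primrec.snd.comp (Primrec.snd.comp Primrec.snd)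
    have hmain : PrimrecPred fun b : X => R b.2.2.1 b.2.1.1 b.1.2.1.1 b.1.2.1.2 ∧
        R b.2.2.2 b.2.1.2 b.1.2.1.2 b.1.2.1.1 ∧ b.2.1.1.length ≤ b.1.2.2 ∧
        b.2.1.2.length ≤ b.1.2.2 :=
      (hR.comp (ht.pair (hp.pair (hx.pair hy)))).and
        ((hR.comp (ht'.pair (hq.pair (hy.pair hx)))).and
        ((Primrec.nat_le.comp (Primrec.list_length.comp hp) hk).and
          (Primrec.nat_le.comp (Primrec.list_length.comp hq) hk)))
    exact PrimrecPred.exists_mem (f := fun a : ℕ × Request =>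
      (Encodable.decode a.1 : Option ((BitString × BitString) × ℕ × ℕ)).toList)
      (Primrec.optionToList.comp (Primrec.decode.comp Primrec.fst)) hmain
  let cert : ℕ → List GameState := fun c => (Encodable.decode c : Option (List GameState)).getD []
  have hcert : Primrec cert := Primrec.option_getD.comp Primrec.decode (Primrec.const [])
  -- Both endpoints must follow the same play. The least code is determined by `n`, the common
  -- length, and if there is no certificate the machine is undefined on that length.
  let Best : ℕ → ℕ → Prop := fun n c => Certificate A n (cert c) ∧
    ∀ c' < c, ¬ Certificate A n (cert c')
  have hBest : ∀ n c c', Best n c → Best n c' → c = c' := by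
    intro n c c' h h'
    rcases lt_trichotomy c c' with hlt | rfl | hlt
    · exact absurd h.1 (h'.2 _ hlt)
    · rfl
    · exact absurd h'.1 (h.2 _ hlt)
  let st : ℕ → ℕ → ℕ → GameState := fun n c m => stateAt A Q n (cert c) m
  let V : ℕ → BitString → BitString → BitString → Prop := fun i p x y =>
    Best x.length i.unpair.1 ∧ ∃ e ∈ st x.length i.unpair.1 i.unpair.2,
      e.2 = p ∧ Touches x e.1 ∧ otherEnd x e.1 = y
  -- States only grow, so both entries belong to the later state, where words at a common vertex are
  -- incomparable.
  have hst : ∀ {n c : ℕ} {i i' : ℕ} {x : BitString} {e e' : Request × BitString}, e ∈ st n c i →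
      e' ∈ st n c i' → Touches x e.1 → Touches x e'.1 → e.2 <+: e'.2 → e = e' := by
    intro n c i i' x e e' he he' hx hx' hpre
    exact (stateAt_play (max i i')).eq_of_prefix
      ((stateAt_suffix (le_max_left i i')).subset he)
      ((stateAt_suffix (le_max_right i i')).subset he') hx hx' hpre
  have hkey : ∀ i i' p q x y z, V i p x y → V i' q x z → p <+: q → p = q ∧ y = z := by
    rintro i i' p q x y z ⟨hb, e, he, rfl, hx, rfl⟩ ⟨hb', e', he', rfl, hx', rfl⟩ hpre
    rw [hBest _ _ _ hb hb'] at he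
    obtain rfl := hst he he' hx hx' hpre
    exact ⟨rfl, rfl⟩
  have hVP : PrimrecPred fun a : ℕ × BitString × BitString × BitString =>
      V a.1 a.2.1 a.2.2.1 a.2.2.2 := by
    let X := ℕ × BitString × BitString × BitString
    have hu : Primrec fun a : X => a.1.unpair := Primrec.unpair.comp Primrec.fst
    have hp : Primrec fun a : X => a.2.1 := Primrec.fst.comp Primrec.snd
    have hx : Primrec fun a : X => a.2.2.1 := Primrec.fst.comp (Primrec.snd.comp Primrec.snd)
    have hy : Primrec fun a : X => a.2.2.2 := Primrec.snd.comp (Primrec.snd.comp Primrec.snd)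
    have hn := Primrec.list_length.comp hx
    have hi := Primrec.fst.comp hu
    refine PrimrecPred.and (PrimrecPred.and (PrimrecPred.certificate hA hn (hcert.comp hi)) ?_) ?_
    · exact PrimrecPred.forall_lt_of (R := fun a c' => ¬ Certificate A a.2.2.1.length (cert c')) hi
        (PrimrecPred.certificate hA (hn.comp Primrec.fst) (hcert.comp Primrec.snd)).not
    · have hother : Primrec₂ otherEnd := Primrec.ite (PrimrecPred.eq
        (Primrec.fst.comp (Primrec.fst.comp Primrec.snd)) Primrec.fst)
        (Primrec.snd.comp (Primrec.fst.comp Primrec.snd))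
        (Primrec.fst.comp (Primrec.fst.comp Primrec.snd))
      have he : Primrec fun b : X × Request × BitString => b.2.1 := Primrec.fst.comp Primrec.snd
      exact PrimrecPred.exists_mem (R := fun (a : X) (e : Request × BitString) =>
        e.2 = a.2.1 ∧ Touches a.2.2.1 e.1 ∧ otherEnd a.2.2.1 e.1 = a.2.2.2)
        (Primrec.stateAt hA hQP hn (hcert.comp hi) (Primrec.snd.comp hu))
        ((PrimrecPred.eq (Primrec.snd.comp Primrec.snd) (hp.comp Primrec.fst)).and
          ((PrimrecPred.touches (hx.comp Primrec.fst) he).and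
            (PrimrecPred.eq (hother.comp (hx.comp Primrec.fst) he) (hy.comp Primrec.fst))))
  obtain ⟨W, hW, hWV⟩ := exists_machine V hVP
    fun m m' p x y y' h h' => (hkey m m' p p x y y' h h' (List.prefix_refl p)).2
  refine ⟨W, ⟨hW, fun x p q hpq hp hq => ?_⟩, ?_⟩
  · obtain ⟨y, hy⟩ := Part.dom_iff_mem.1 hp
    obtain ⟨z, hz⟩ := Part.dom_iff_mem.1 hq
    obtain ⟨m, hm⟩ := (hWV _ _ _).1 hy
    obtain ⟨m', hm'⟩ := (hWV _ _ _).1 hz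
    exact (hkey m m' p q x y z hm hm' hpq).1
  have hordered : ∀ (n k : ℕ) (x y : BitString), Winnable A n → x.length = n → y.length = n →
      Encodable.encode x < Encodable.encode y → A n k → k ≤ 2 * n → condComplexity U y x ≤ k →
      condComplexity U x y ≤ k → ∃ p, (y ∈ W p x ∧ x ∈ W p y) ∧ p.length ≤ k + 42 := by
    intro n k x y hwin hx hy hxy hk hkn h1 h2
    have hne : x ≠ y := by rintro rfl; exact lt_irrefl _ hxy
    have hex : ∃ c, Certificate A n (cert c) := by
      obtain ⟨C, hC⟩ := hwin.exists_certificate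
      exact ⟨Encodable.encode C, by simpa [cert] using hC⟩
    have hb : Best n (Nat.find hex) := ⟨Nat.find_spec hex, fun c' h => Nat.find_min hex h⟩
    have hJ : Justified U ((x, y), k) :=
      ⟨condComplexity_le_iff.1 h1, condComplexity_le_iff.1 h2⟩
    obtain ⟨t, ht⟩ := (hQJ _).2 hJ
    obtain ⟨m, e, he, her⟩ := exists_mem_stateAt (Q := Q) hb.1 ht fun s hs hnew => by
      have hs' : Play A n (Justified U) s := by
        rwa [show (fun r => ∃ t, Q t r) = Justified U from funext fun r => propext (hQJ r)] at hs
      exact ⟨hx, hy, hxy, hk, hkn, hnew, hs'.load_le hc hJ hkn hxy hnew (Or.inl rfl),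
        hs'.load_le hc hJ hkn hxy hnew (Or.inr rfl)⟩
    refine ⟨e.2, ⟨(hWV _ _ _).2 ⟨Nat.pair (Nat.find hex) m, ?_⟩,
      (hWV _ _ _).2 ⟨Nat.pair (Nat.find hex) m, ?_⟩⟩, ?_⟩
    · simp only [V, Nat.unpair_pair, hx]
      exact ⟨hb, e, he, rfl, by rw [her]; exact Or.inl rfl, by rw [her]; simp [otherEnd]⟩
    · simp only [V, Nat.unpair_pair, hy]
      exact ⟨hb, e, he, rfl, by rw [her]; exact Or.inr rfl, by rw [her]; simp [otherEnd, hne]⟩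
    · obtain ⟨-, -, -, -, -, hl⟩ := (stateAt_play m).of_mem he
      rw [hl, her]
  intro n k x y hwin hx hy hne hk hkn h1 h2
  rw [dist₁_le_iff]
  rcases lt_or_gt_of_ne (Encodable.encode_injective.ne hne) with hlt | hlt
  · exact hordered n k x y hwin hx hy hlt hk hkn h1 h2
  · obtain ⟨p, h, hp⟩ := hordered n k y x hwin hy hx hlt hk hkn h2 h1
    exact ⟨p, h.symm, hp⟩

/-! ### Auxiliary machines and simple bounds -/

theorem primrecPred_lowLevel : PrimrecPred fun a : ℕ × ℕ => LowLevel a.1 a.2 :=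
  (Primrec.nat_le.comp (Primrec.nat_pow.comp Primrec.fst (Primrec.const 129))
    (Primrec.two_pow (Primrec.nat_mul.comp (Primrec.const 128) Primrec.snd))).and
    (Primrec.nat_lt.comp (Primrec.two_pow Primrec.snd)
      (Primrec.nat_pow.comp Primrec.fst (Primrec.const 4)))

theorem primrecPred_highLevel : PrimrecPred fun a : ℕ × ℕ => HighLevel a.1 a.2 :=
  Primrec.nat_le.comp (Primrec.nat_pow.comp Primrec.fst (Primrec.const 4))
    (Primrec.two_pow Primrec.snd)

/-- Every prefix-free machine is extended by a prefix-stable one. -/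
theorem IsPrefixFree.exists_isPrefixStable {U : Machine} (hU : IsPrefixFree U) :
    ∃ V, IsPrefixStable V ∧ ∀ p x y, y ∈ U p x → y ∈ V p x := by
  obtain ⟨R, hR, hRU⟩ := exists_enumeration U hU.partrec
  let S : ℕ → BitString → BitString → BitString → Prop := fun m q x y =>
    ∃ i < q.length + 1, R m (q.take i) x y
  have hS : PrimrecPred fun a : ℕ × BitString × BitString × BitString =>
      S a.1 a.2.1 a.2.2.1 a.2.2.2 := by
    refine PrimrecPred.exists_lt_of (Primrec.succ.comp (Primrec.list_length.comp
      (Primrec.fst.comp Primrec.snd))) ?_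
    exact hR.comp (f := fun b : (ℕ × BitString × BitString × BitString) × ℕ =>
      (b.1.1, b.1.2.1.take b.2, b.1.2.2)) (Primrec.pair (Primrec.fst.comp Primrec.fst)
        (Primrec.pair (Primrec.list_take.comp Primrec.snd (Primrec.fst.comp (Primrec.snd.comp
          Primrec.fst))) (Primrec.snd.comp (Primrec.snd.comp Primrec.fst))))
  obtain ⟨V, hV, hVS⟩ := exists_machine S hS (by
    rintro m m' p x y y' ⟨i, -, h⟩ ⟨j, -, h'⟩
    have hy := (hRU _ _ _).2 ⟨m, h⟩
    have hy' := (hRU _ _ _).2 ⟨m', h'⟩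
    rcases List.prefix_or_prefix_of_prefix (List.take_prefix i p) (List.take_prefix j p)
      with hp | hp
    · exact hU.coherent x _ _ _ _ hp hy hy'
    · exact (hU.coherent x _ _ _ _ hp hy' hy).symm)
  refine ⟨V, ⟨hV, ?_⟩, fun p x y h => ?_⟩
  · rintro x y p _ ⟨r, rfl⟩ hy
    obtain ⟨m, i, hi, h⟩ := (hVS _ _ _).1 hy
    refine (hVS _ _ _).2 ⟨m, i, by rw [List.length_append]; omega, ?_⟩
    rwa [List.take_append_of_le_length (by omega)]
  · obtain ⟨t, ht⟩ := (hRU _ _ _).1 h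
    exact (hVS _ _ _).2 ⟨t, p.length, by omega, by rwa [List.take_length]⟩

/-- For a given input all programs have the length of that input, hence form a prefix-free set. This
keeps the levels below 2n for large n. -/
theorem exists_copy_machine : ∃ U, IsPrefixFree U ∧
    ∀ x y : BitString, y.length = x.length → condComplexity U y x ≤ x.length := by
  obtain ⟨U, hU, hUR⟩ := exists_machine (fun _ p x y => p = y ∧ p.length = x.length)
    ((PrimrecPred.eq (Primrec.fst.comp Primrec.snd)
      (Primrec.snd.comp (Primrec.snd.comp Primrec.snd))).and
      (PrimrecPred.eq (Primrec.list_length.comp (Primrec.fst.comp Primrec.snd))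
        (Primrec.list_length.comp (Primrec.fst.comp (Primrec.snd.comp Primrec.snd)))))
    (fun _ _ _ _ _ _ h h' => h.1.symm.trans h'.1)
  refine ⟨U, ⟨hU, fun x p q hpq hp hq => ?_⟩, fun x y h => ?_⟩
  · obtain ⟨y, hy⟩ := Part.dom_iff_mem.1 hp
    obtain ⟨z, hz⟩ := Part.dom_iff_mem.1 hq
    obtain ⟨-, -, h1⟩ := (hUR _ _ _).1 hy
    obtain ⟨-, -, h2⟩ := (hUR _ _ _).1 hz
    exact hpq.eq_of_length (h1.trans h2.symm)
  · exact condComplexity_le_iff.2 ⟨y, (hUR _ _ _).2 ⟨0, rfl, h⟩, h.le⟩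

/-- A functional primitive recursive relation is computed with the empty program. -/
theorem exists_trivial_machine (R : BitString → BitString → Prop)
    (hR : PrimrecPred fun a : BitString × BitString => R a.1 a.2)
    (hfun : ∀ x y y', R x y → R x y' → y = y') :
    ∃ U, IsPrefixFree U ∧ ∀ x y, R x y → R y x → dist₁ U x y ≤ (0 : ℕ) := by
  obtain ⟨U, hU, hUR⟩ := exists_machine (fun _ p x y => p = [] ∧ R x y)
    ((PrimrecPred.eq (Primrec.fst.comp Primrec.snd) (Primrec.const [])).and
      (hR.comp (Primrec.snd.comp Primrec.snd))) (fun _ _ _ _ _ _ h h' => hfun _ _ _ h.2 h'.2)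
  refine ⟨U, ⟨hU, fun x p q hpq hp hq => ?_⟩, fun x y h h' => ?_⟩
  · obtain ⟨y, hy⟩ := Part.dom_iff_mem.1 hp
    obtain ⟨z, hz⟩ := Part.dom_iff_mem.1 hq
    obtain ⟨-, h1, -⟩ := (hUR _ _ _).1 hy
    obtain ⟨-, h2, -⟩ := (hUR _ _ _).1 hz
    rw [h1, h2]
  · exact dist₁_le_iff.2 ⟨[], ⟨(hUR _ _ _).2 ⟨0, rfl, h⟩, (hUR _ _ _).2 ⟨0, rfl, h'⟩⟩, le_rfl⟩

/-- Equal strings are treated apart, since requests have distinct endpoints. -/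
theorem IsPrefixFreeDistance.exists_le_self {D : BitString → BitString → ℕ∞}
    (hD : IsPrefixFreeDistance D) : ∃ c : ℕ, ∀ x, D x x ≤ c := by
  obtain ⟨U, hU, h⟩ := exists_trivial_machine (fun x y => x = y)
    (PrimrecPred.eq Primrec.fst Primrec.snd) (fun _ _ _ h h' => h.symm.trans h')
  obtain ⟨c, hc⟩ := hD.2 _ ⟨U, hU, rfl⟩
  refine ⟨c, fun x => (hc x x).trans ?_⟩
  simpa using add_le_add_left (h x x rfl rfl) (c : ℕ∞)

theorem IsPrefixFreeDistance.exists_le {D : BitString → BitString → ℕ∞}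
    (hD : IsPrefixFreeDistance D) (x y : BitString) : ∃ c : ℕ, D x y ≤ c := by
  have hx : PrimrecPred fun a : BitString × BitString =>
      (a.1 = x ∧ a.2 = y) ∨ (a.1 = y ∧ a.2 = x) :=
    ((PrimrecPred.eq Primrec.fst (Primrec.const x)).and
      (PrimrecPred.eq Primrec.snd (Primrec.const y))).or
    ((PrimrecPred.eq Primrec.fst (Primrec.const y)).and
      (PrimrecPred.eq Primrec.snd (Primrec.const x)))
  obtain ⟨U, hU, h⟩ := exists_trivial_machine
    (fun a b => (a = x ∧ b = y) ∨ (a = y ∧ b = x)) hx (by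
    rintro a b b' (⟨rfl, rfl⟩ | ⟨rfl, rfl⟩) (⟨h1, rfl⟩ | ⟨h1, rfl⟩)
    · rfl
    · exact h1.symm
    · exact h1.symm
    · rfl)
  obtain ⟨c, hc⟩ := hD.2 _ ⟨U, hU, rfl⟩
  refine ⟨c, (hc x y).trans ?_⟩
  simpa using add_le_add_left (h x y (Or.inl ⟨rfl, rfl⟩) (Or.inr ⟨rfl, rfl⟩)) (c : ℕ∞)

/-- Finitely many pairs, each at finite distance; this covers lengths too small for the strategy. -/
theorem IsPrefixFreeDistance.exists_le_of_length {D : BitString → BitString → ℕ∞}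
    (hD : IsPrefixFreeDistance D) (N : ℕ) :
    ∃ c : ℕ, ∀ x y : BitString, x.length ≤ N → y.length ≤ N → D x y ≤ c := by
  choose f hf using hD.exists_le
  have hfin := List.finite_length_le Bool N
  refine ⟨(hfin.toFinset ×ˢ hfin.toFinset).sup fun a => f a.1 a.2, fun x y hx hy => ?_⟩
  refine (hf x y).trans ?_
  have : f x y ≤ (hfin.toFinset ×ˢ hfin.toFinset).sup fun a => f a.1 a.2 :=
    le_sup (f := fun a : BitString × BitString => f a.1 a.2) (b := (x, y))
      (by simp [hx, hy])
  exact_mod_cast this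

theorem IsPrefixComplexity.exists_le_length {K : BitString → BitString → ℕ∞}
    (hK : IsPrefixComplexity K) :
    ∃ c : ℕ, ∀ x y : BitString, y.length = x.length → K y x ≤ (x.length + c : ℕ) := by
  obtain ⟨U, hU, h⟩ := exists_copy_machine
  obtain ⟨c, hc⟩ := hK.2 _ ⟨U, hU, rfl⟩
  refine ⟨c, fun x y hxy => (hc y x).trans ?_⟩
  push_cast
  gcongr
  exact h x y hxy

/-! ### Comparison of the distances with E -/

theorem bipartiteDist_mono {U U' V V' : Machine} (h : ∀ p x y, y ∈ U p x → y ∈ V p x)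
    (h' : ∀ p x y, y ∈ U' p x → y ∈ V' p x) (x y : BitString) :
    bipartiteDist V V' x y ≤ bipartiteDist U U' x y :=
  iInf_mono fun _ => iInf_mono' fun hp => ⟨⟨h _ _ _ hp.1, h' _ _ _ hp.2⟩, le_rfl⟩

theorem condComplexity_le_bipartiteDist (U U' : Machine) (x y : BitString) :
    condComplexity U y x ≤ bipartiteDist U U' x y :=
  iInf_mono fun _ => iInf_mono' fun hp => ⟨hp.1, le_rfl⟩

theorem condComplexity_le_bipartiteDist' (U U' : Machine) (x y : BitString) :
    condComplexity U' x y ≤ bipartiteDist U U' x y :=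
  iInf_mono fun _ => iInf_mono' fun hp => ⟨hp.2, le_rfl⟩

theorem IsPrefixComplexity.exists_le_condComplexity {K : BitString → BitString → ℕ∞}
    (hK : IsPrefixComplexity K) {U : Machine} (hU : IsPrefixStable U) :
    ∃ c : ℕ, ∀ x y, K y x ≤ condComplexity U y x + c := by
  obtain ⟨V, hV, h⟩ := exists_isPrefixFree_of_coherent hU.partrec hU.coherent
  obtain ⟨c, hc⟩ := hK.2 _ ⟨V, hV, rfl⟩
  refine ⟨2 + c, fun x y => (hc y x).trans ?_⟩
  push_cast
  rw [← add_assoc]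
  gcongr
  exact h x y

theorem exists_maxComplexity_le {K D : BitString → BitString → ℕ∞}
    (hK : IsPrefixComplexity K) (hD : IsBipartitePrefixStableDistance D) :
    ∃ c : ℕ, ∀ x y, maxComplexity K x y ≤ D x y + c := by
  obtain ⟨U, U', hU, hU', rfl⟩ := hD.1
  obtain ⟨c, hc⟩ := hK.exists_le_condComplexity hU
  obtain ⟨c', hc'⟩ := hK.exists_le_condComplexity hU'
  refine ⟨max c c', fun x y => max_le ((hc' y x).trans ?_) ((hc x y).trans ?_)⟩
  · gcongr
    · exact condComplexity_le_bipartiteDist' U U' x y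
    · exact_mod_cast le_max_right c c'
  · gcongr
    · exact condComplexity_le_bipartiteDist U U' x y
    · exact_mod_cast le_max_left c c'

/-- This is 1.01 > 129/128. -/
theorem exists_isLevel_of_le {n k : ℕ} (hn : 1 ≤ n) (h : 1.01 * Real.logb 2 n ≤ k) :
    n ^ 129 ≤ 2 ^ (128 * k) := by
  have h0 : 0 ≤ Real.logb 2 n := Real.logb_nonneg one_lt_two (by exact_mod_cast hn)
  have h1 : Real.logb 2 ((n : ℝ) ^ 129) ≤ Real.logb 2 ((2 : ℝ) ^ (128 * k)) := by
    rw [Real.logb_pow, Real.logb_pow, Real.logb_self_eq_one one_lt_two]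
    push_cast
    linarith
  have h2 := (Real.logb_le_logb one_lt_two (by positivity) (by positivity)).1 h1
  exact_mod_cast h2

theorem exists_prefixFreeDistance_le {K D : BitString → BitString → ℕ∞}
    (hK : IsPrefixComplexity K) (hD : IsPrefixFreeDistance D) :
    ∃ c : ℕ, ∀ (n : ℕ) (x y : BitString), x.length = n → y.length = n →
      ((1.01 * Real.logb 2 (n : ℝ) : ℝ) : EReal) ≤ ((maxComplexity K x y : ENNReal) : EReal) →
        D x y ≤ maxComplexity K x y + c := by
  obtain ⟨U, hU, hKU⟩ := hK.1
  obtain ⟨c₁, hc₁⟩ := hK.exists_le_length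
  obtain ⟨c₂, hc₂⟩ := hD.exists_le_self
  obtain ⟨N, hN⟩ : ∃ N, ∀ n, N ≤ n → 32768 ≤ Nat.log 2 n := by
    generalize 32768 = L
    exact ⟨2 ^ L, fun n => Nat.le_log_of_pow_le one_lt_two⟩
  obtain ⟨c₃, hc₃⟩ := hD.exists_le_of_length (N + c₁)
  obtain ⟨V, hV, hVd⟩ := exists_exchange_machine primrecPred_lowLevel hU.partrec hU.coherent
  obtain ⟨W, hW, hWd⟩ := exists_exchange_machine primrecPred_highLevel hU.partrec hU.coherent
  obtain ⟨c₄, hc₄⟩ := hD.2 _ ⟨V, hV, rfl⟩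
  obtain ⟨c₅, hc₅⟩ := hD.2 _ ⟨W, hW, rfl⟩
  refine ⟨c₂ + c₃ + c₄ + c₅ + 42, fun n x y hx hy hE => ?_⟩
  by_cases hne : x = y
  · subst hne
    exact ((hc₂ x).trans (by norm_cast; omega)).trans le_add_self
  rcases Nat.lt_or_ge n (N + c₁) with hn | hn
  · exact ((hc₃ x y (by omega) (by omega)).trans (by norm_cast; omega)).trans le_add_self
  have hlog := hN n (by omega)
  have hle : maxComplexity K x y ≤ (n + c₁ : ℕ) :=
    max_le (hy ▸ hc₁ y x (hx.trans hy.symm)) (hx ▸ hc₁ x y (hy.trans hx.symm))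
  obtain ⟨k, hk⟩ := ENat.ne_top_iff_exists.1 (ne_top_of_le_ne_top (ENat.natCast_ne_top _) hle)
  have hkn : k ≤ 2 * n := by
    rw [← hk] at hle
    norm_cast at hle
    omega
  have h1 : condComplexity U y x ≤ k := by
    rw [hk, ← hKU]
    exact le_max_right _ _
  have h2 : condComplexity U x y ≤ k := by
    rw [hk, ← hKU]
    exact le_max_left _ _
  have hlevel : n ^ 129 ≤ 2 ^ (128 * k) := by
    refine exists_isLevel_of_le (Nat.pos_of_ne_zero ?_) ?_
    · rintro rfl
      simp at hlog
    · rw [← hk] at hE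
      have h3 : (((k : ℕ∞) : ENNReal) : EReal) = ((k : ℝ) : EReal) := by
        rw [ENat.toENNReal_coe, ← ENNReal.coe_natCast, EReal.coe_nnreal_eq_coe_real]
        simp
      rw [h3] at hE
      exact EReal.coe_le_coe_iff.1 hE
  rw [← hk]
  -- Minimality compares the distance with both exchange machines, so each range of levels may use
  -- its own.
  rcases Nat.lt_or_ge (2 ^ k) (n ^ 4) with hlow | hhigh
  · refine (hc₄ x y).trans ((add_le_add_left (hVd n k x y (winnable_lowLevel n hlog) hx hy hne
      ⟨hlevel, hlow⟩ hkn h1 h2) _).trans ?_)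
    norm_cast
    omega
  · refine (hc₅ x y).trans ((add_le_add_left (hWd n k x y (winnable_highLevel n (by omega))
      hx hy hne hhigh hkn h1 h2) _).trans ?_)
    norm_cast
    omega

theorem theorem1
    (K : BitString → BitString → ℕ∞) (hK : IsPrefixComplexity K)
    (Dpf Dps Dbpf Dbps : BitString → BitString → ℕ∞)
    (hpf : IsPrefixFreeDistance Dpf) (hps : IsPrefixStableDistance Dps)
    (hbpf : IsBipartitePrefixFreeDistance Dbpf) (hbps : IsBipartitePrefixStableDistance Dbps) :
    ∃ c : ℕ, ∀ (n : ℕ) (x y : BitString), x.length = n → y.length = n →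
      ((1.01 * Real.logb 2 (n : ℝ) : ℝ) : EReal) ≤ ((maxComplexity K x y : ENNReal) : EReal) →
        EqUpTo c (Dpf x y) (maxComplexity K x y) ∧
        EqUpTo c (Dps x y) (maxComplexity K x y) ∧
        EqUpTo c (Dbpf x y) (maxComplexity K x y) ∧
        EqUpTo c (Dbps x y) (maxComplexity K x y) := by
  -- Up to constants `Dbps` is the smallest and `Dpf` the largest of the four, so a lower bound for
  -- the former and an upper bound for the latter settle all.
  obtain ⟨c₀, h₀⟩ := exists_maxComplexity_le hK hbps
  obtain ⟨c₁, h₁⟩ : ∃ c : ℕ, ∀ x y, Dbps x y ≤ Dps x y + c := by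
    obtain ⟨U, hU, rfl⟩ := hps.1
    exact hbps.2 _ ⟨U, U, hU, hU, rfl⟩
  obtain ⟨c₂, h₂⟩ : ∃ c : ℕ, ∀ x y, Dps x y ≤ Dpf x y + c := by
    obtain ⟨U, hU, rfl⟩ := hpf.1
    obtain ⟨V, hV, hUV⟩ := hU.exists_isPrefixStable
    obtain ⟨c, hc⟩ := hps.2 _ ⟨V, hV, rfl⟩
    exact ⟨c, fun x y => (hc x y).trans (add_le_add_left (bipartiteDist_mono hUV hUV x y) _)⟩
  obtain ⟨c₃, h₃⟩ : ∃ c : ℕ, ∀ x y, Dbps x y ≤ Dbpf x y + c := by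
    obtain ⟨U, U', hU, hU', rfl⟩ := hbpf.1
    obtain ⟨V, hV, hUV⟩ := hU.exists_isPrefixStable
    obtain ⟨V', hV', hUV'⟩ := hU'.exists_isPrefixStable
    obtain ⟨c, hc⟩ := hbps.2 _ ⟨V, V', hV, hV', rfl⟩
    exact ⟨c, fun x y => (hc x y).trans (add_le_add_left (bipartiteDist_mono hUV hUV' x y) _)⟩
  obtain ⟨c₄, h₄⟩ : ∃ c : ℕ, ∀ x y, Dbpf x y ≤ Dpf x y + c := by
    obtain ⟨U, hU, rfl⟩ := hpf.1
    exact hbpf.2 _ ⟨U, U, hU, hU, rfl⟩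
  obtain ⟨c₅, h₅⟩ := exists_prefixFreeDistance_le hK hpf
  have trans_le : ∀ {a b d : ℕ∞} {c c' : ℕ}, a ≤ b + c → b ≤ d + c' → a ≤ d + (c + c' : ℕ) := by
    intro a b d c c' h h'
    refine h.trans ((add_le_add_left h' _).trans ?_)
    push_cast
    rw [add_assoc, add_comm (c' : ℕ∞)]
  have weaken : ∀ {a b : ℕ∞} {c c' : ℕ}, a ≤ b + c → c ≤ c' → a ≤ b + c' := by
    intro a b c c' h hc
    exact h.trans (by gcongr)
  refine ⟨c₀ + c₁ + c₂ + c₃ + c₄ + c₅, fun n x y hx hy hE => ?_⟩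
  have h := h₅ n x y hx hy hE
  refine ⟨⟨weaken h (by omega), weaken (trans_le (h₀ x y) (trans_le (h₁ x y) (h₂ x y))) (by omega)⟩,
    ⟨weaken (trans_le (h₂ x y) h) (by omega), weaken (trans_le (h₀ x y) (h₁ x y)) (by omega)⟩,
    ⟨weaken (trans_le (h₄ x y) h) (by omega), weaken (trans_le (h₀ x y) (h₃ x y)) (by omega)⟩,
    ⟨weaken (trans_le (h₁ x y) (trans_le (h₂ x y) h)) (by omega), weaken (h₀ x y) (by omega)⟩⟩
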